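/- **Theorem.** Let $\Sigma$ be a countably infinite set of labels (identified with $\mathbb{N}$). A knowledge base is a finite edge-labeled directed graph $K=(V,E)$ with $V$ finite and nonempty and $E\subseteq V\times\Sigma\times V$ finite. Regular expressions are built from $\emptyset$, $\varepsilon$, labels $\sigma\in\Sigma$, and the wildcard $\_$ (which matches every one-letter word over $\Sigma$) by union $+$, concatenation $\cdot$ and Kleene star $*$. A conjunctive regular path query (CRPQ) $Q(x_1,\dots,x_n)\leftarrow A_1\wedge\dots\wedge A_m$ has atoms $A_i$ of the form $y\,R\,z$ with variables $y,z$ and a regular expression $R$, and every $x_j$ occurs in some atom. Its set of answers $\mathrm{ans}(Q,K)$ consists of the tuples $(\mu(x_1),\dots,\mu(x_n))$ for all maps $\mu$ from the variables of $Q$ to $V$ such that for every atom $y\,R\,z$ of $Q$ there is a (possibly empty) path in $K$ from $\mu(y)$ to $\mu(z)$ labeled with a word of $L(R)$. We write $Q_1\subseteq Q_2$ if $\mathrm{ans}(Q_1,K)\subseteq\mathrm{ans}(Q_2,K)$ for every knowledge base $K$. Let $\mathrm{CRPQ}(W)$ be the set of CRPQs all of whose regular expressions are generated by $R$ in the grammar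 $$R\to\sigma\mid\_\mid S^*\mid R\cdot R\mid (R+R),\qquad S\to\sigma\mid\_\mid S\cdot S\qquad(\sigma\in\Sigma).$$ Then the problem "given $Q_1\in\mathrm{CRPQ}(W)$ and a CRPQ $Q_2$, is $Q_1\subseteq Q_2$?" is in $\Pi_2^p$. That is, let $L$ be the language of all strings that encode a pair $(Q_1,Q_2)$ with $Q_1\in\mathrm{CRPQ}(W)$, $Q_2$ a CRPQ and $Q_1\subseteq Q_2$ (expressions in prefix notation, labels and variable names in binary). Then there are a polynomial $p$ and a relation $R$ decidable in deterministic polynomial time by a Turing machine such that, for every string $x$, $x\in L$ iff for all strings $y$ with $|y|\le p(|x|)$ there is a string $z$ with $|z|\le p(|x|)$ such that $R(x,y,z)$ holds. -/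

import Mathlib

namespace CRPQContainment

open Computability

/-! ## Knowledge bases -/

/-- The infinite set of edge labels. -/
abbrev Label : Type := ℕ

/-- A knowledge base: a finite nonempty set of nodes with a finite set of labeled directed edges. -/
structure KnowledgeBase where
  /-- nodes -/
  V : Type
  [finite_V : Finite V]
  [nonempty_V : Nonempty V]
  /-- labeled edges -/
  E : Set (V × Label × V)
  finite_E : E.Finite

/-- `K.Path u w v`: there is a (possibly empty) path from `u` to `v` whose label is the word `w`. -/
inductive KnowledgeBase.Path (K : KnowledgeBase) : K.V → List Label → K.V → Prop
  | nil (u : K.V) : Path K u [] u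
  | cons {u v t : K.V} {a : Label} {w : List Label} :
      (u, a, v) ∈ K.E → Path K v w t → Path K u (a :: w) t

/-! ## Regular expressions, with wildcard -/

/-- Regular expressions over the labels; `any` is the wildcard. -/
inductive Regex where
  | empty : Regex
  | eps : Regex
  | label (a : Label) : Regex
  | any : Regex
  | plus (R S : Regex) : Regex
  | comp (R S : Regex) : Regex
  | star (R : Regex) : Regex

/-- The language of a regular expression. The wildcard matches every one-letter word. -/
def Regex.lang : Regex → Language Label
  | empty => 0
  | eps => 1
  | label a => {[a]}
  | any => {w | ∃ a : Label, w = [a]}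
  | plus R S => R.lang + S.lang
  | comp R S => R.lang * S.lang
  | star R => KStar.kstar R.lang

/-- The grammar `S → σ | _ | S·S` of fixed strings. -/
inductive Regex.IsString : Regex → Prop
  | label (a : Label) : IsString (Regex.label a)
  | any : IsString Regex.any
  | comp {R S : Regex} : IsString R → IsString S → IsString (Regex.comp R S)

/-- The grammar `R → σ | _ | S* | R·R | (R+R)` of the W-fragment. -/
inductive Regex.IsW : Regex → Prop
  | label (a : Label) : IsW (Regex.label a)
  | any : IsW Regex.any
  | star {S : Regex} : Regex.IsString S → IsW (Regex.star S)
  | comp {R S : Regex} : IsW R → IsW S → IsW (Regex.comp R S)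
  | plus {R S : Regex} : IsW R → IsW S → IsW (Regex.plus R S)

/-! ## Conjunctive regular path queries -/

/-- Names of query variables. -/
abbrev Var : Type := ℕ

/-- An atom `y R z`. -/
structure Atom where
  src : Var
  re : Regex
  tgt : Var

/-- A conjunctive regular path query `Q(x₁, …, xₙ) ← A₁ ∧ … ∧ Aₘ`. -/
structure CRPQ where
  /-- the distinguished variables `x₁, …, xₙ` -/
  head : List Var
  /-- the atoms `A₁, …, Aₘ` -/
  body : List Atom
  /-- each distinguished variable occurs in some atom -/
  head_occurs : ∀ x ∈ head, ∃ A ∈ body, x = A.src ∨ x = A.tgt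

/-- `μ` is a satisfying homomorphism from `Q` to `K`. (The values of `μ` at names that do not occur
in `Q` are irrelevant.) -/
def CRPQ.Satisfies (Q : CRPQ) (K : KnowledgeBase) (μ : Var → K.V) : Prop :=
  ∀ A ∈ Q.body, ∃ w ∈ A.re.lang, K.Path (μ A.src) w (μ A.tgt)

/-- The set of answers of `Q` on `K`, a set of tuples of nodes. -/
def CRPQ.ans (Q : CRPQ) (K : KnowledgeBase) : Set (List K.V) :=
  {d | ∃ μ : Var → K.V, Q.Satisfies K μ ∧ d = Q.head.map μ}

/-- Containment of queries. -/
def CRPQ.ContainedIn (Q₁ Q₂ : CRPQ) : Prop :=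
  ∀ K : KnowledgeBase, Q₁.ans K ⊆ Q₂.ans K

/-- The queries whose regular expressions are all in the W-fragment. -/
def CRPQ.W : Set CRPQ := {Q | ∀ A ∈ Q.body, A.re.IsW}

/-! ## Queries as strings

Regular expressions are written in prefix notation; labels and variable names are written in
binary. -/

/-- The finite input alphabet. -/
inductive Token where
  | bit (b : Bool)
  | empty
  | eps
  | label
  | any
  | plus
  | comp
  | star
  | var
  | atom
  | sep
  deriving DecidableEq, Fintype

/-- The bits of a number. -/
def encodeBits (n : ℕ) : List Token := (encodeNat n).map Token.bit

def encodeVar (x : Var) : List Token := Token.var :: encodeBits x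

def Regex.encode : Regex → List Token
  | empty => [Token.empty]
  | eps => [Token.eps]
  | label a => Token.label :: encodeBits a
  | any => [Token.any]
  | plus R S => Token.plus :: (R.encode ++ S.encode)
  | comp R S => Token.comp :: (R.encode ++ S.encode)
  | star R => Token.star :: R.encode

def Atom.encode (A : Atom) : List Token :=
  Token.atom :: (encodeVar A.src ++ A.re.encode ++ encodeVar A.tgt)

def CRPQ.encode (Q : CRPQ) : List Token :=
  Q.head.flatMap encodeVar ++ Q.body.flatMap Atom.encode

/-- The string that represents a pair of queries. -/
def encodePair (Q₁ Q₂ : CRPQ) : List Token :=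
  Q₁.encode ++ Token.sep :: Q₂.encode

/-- The decision problem "containment of `F₁` in `F₂`" as a formal language: the strings that
represent a pair `Q₁ ∈ F₁`, `Q₂ ∈ F₂` with `Q₁ ⊆ Q₂`. -/
def queryContainment (F₁ F₂ : Set CRPQ) : Set (List Token) :=
  {x | ∃ Q₁ ∈ F₁, ∃ Q₂ ∈ F₂, x = encodePair Q₁ Q₂ ∧ Q₁.ContainedIn Q₂}

/-! ### The representation is unambiguous -/

/-- A string that does not begin with a bit. -/
def NoBit (l : List Token) : Prop := ∀ b : Bool, l.head? ≠ some (Token.bit b)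

theorem bits_append_inj {b b' : List Bool} {l l' : List Token} (h : NoBit l) (h' : NoBit l')
    (e : b.map Token.bit ++ l = b'.map Token.bit ++ l') : b = b' ∧ l = l' := by
  induction b generalizing b' with
  | nil =>
    cases b' with
    | nil => exact ⟨rfl, by simpa using e⟩
    | cons c cs => exact absurd (by simp at e; simp [e]) (h c)
  | cons c cs ih =>
    cases b' with
    | nil => exact absurd (by simp at e; simp [← e]) (h' c)
    | cons d ds =>
      simp only [List.map_cons, List.cons_append, List.cons.injEq, Token.bit.injEq] at e
      obtain ⟨h1, h2⟩ := ih e.2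
      exact ⟨by rw [e.1, h1], h2⟩

theorem encodeBits_append_inj {m n : ℕ} {l l' : List Token} (h : NoBit l) (h' : NoBit l')
    (e : encodeBits m ++ l = encodeBits n ++ l') : m = n ∧ l = l' := by
  obtain ⟨h1, h2⟩ := bits_append_inj h h' e
  exact ⟨encodingNatBool.encode_injective h1, h2⟩

theorem Regex.noBit_encode (R : Regex) (l : List Token) : NoBit (R.encode ++ l) := by
  intro b; cases R <;> simp [Regex.encode]

theorem Regex.encode_append_inj {R R' : Regex} {l l' : List Token} (h : NoBit l) (h' : NoBit l')
    (e : R.encode ++ l = R'.encode ++ l') : R = R' ∧ l = l' := by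
  induction R generalizing R' l l' with
  | empty => cases R' <;> simp_all [Regex.encode]
  | eps => cases R' <;> simp_all [Regex.encode]
  | any => cases R' <;> simp_all [Regex.encode]
  | label a =>
    cases R' <;> simp [Regex.encode] at e
    obtain ⟨h1, h2⟩ := encodeBits_append_inj h h' e
    exact ⟨by rw [h1], h2⟩
  | star R ih =>
    cases R' <;> simp [Regex.encode] at e
    obtain ⟨h1, h2⟩ := ih h h' e
    exact ⟨by rw [h1], h2⟩
  | plus R S ihR ihS =>
    cases R' <;> simp [Regex.encode] at e
    obtain ⟨h1, h2⟩ := ihR (S.noBit_encode _) (Regex.noBit_encode _ _) e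
    obtain ⟨h3, h4⟩ := ihS h h' h2
    exact ⟨by rw [h1, h3], h4⟩
  | comp R S ihR ihS =>
    cases R' <;> simp [Regex.encode] at e
    obtain ⟨h1, h2⟩ := ihR (S.noBit_encode _) (Regex.noBit_encode _ _) e
    obtain ⟨h3, h4⟩ := ihS h h' h2
    exact ⟨by rw [h1, h3], h4⟩

theorem noBit_body (B : List Atom) {l : List Token} (h : NoBit l) :
    NoBit (B.flatMap Atom.encode ++ l) := by
  cases B with
  | nil => simpa using h
  | cons A B => intro b; simp [Atom.encode]

theorem body_append_inj {B B' : List Atom} {l l' : List Token} (h : NoBit l) (h' : NoBit l')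
    (ha : l.head? ≠ some Token.atom) (ha' : l'.head? ≠ some Token.atom)
    (e : B.flatMap Atom.encode ++ l = B'.flatMap Atom.encode ++ l') : B = B' ∧ l = l' := by
  induction B generalizing B' with
  | nil =>
    cases B' with
    | nil => exact ⟨rfl, by simpa using e⟩
    | cons A' B' => exact absurd (by simp [Atom.encode] at e; simp [e]) ha
  | cons A B ih =>
    cases B' with
    | nil => exact absurd (by simp [Atom.encode] at e; simp [← e]) ha'
    | cons A' B' =>
      obtain ⟨s, r, t⟩ := A
      obtain ⟨s', r', t'⟩ := A'
      simp only [List.flatMap_cons, Atom.encode, encodeVar, List.cons_append, List.append_assoc,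
        List.cons.injEq, true_and] at e
      obtain ⟨h1, h2⟩ := encodeBits_append_inj (r.noBit_encode _) (r'.noBit_encode _) e
      obtain ⟨h3, h4⟩ := Regex.encode_append_inj (by intro b; simp) (by intro b; simp) h2
      simp only [List.cons.injEq, true_and] at h4
      obtain ⟨h5, h6⟩ := encodeBits_append_inj (noBit_body B h) (noBit_body B' h') h4
      obtain ⟨h7, h8⟩ := ih h6
      exact ⟨by rw [h1, h3, h5, h7], h8⟩

theorem head_append_inj {H H' : List Var} {l l' : List Token} (h : NoBit l) (h' : NoBit l')
    (ha : l.head? ≠ some Token.var) (ha' : l'.head? ≠ some Token.var)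
    (e : H.flatMap encodeVar ++ l = H'.flatMap encodeVar ++ l') : H = H' ∧ l = l' := by
  have nb : ∀ (H : List Var) {l : List Token}, NoBit l → NoBit (H.flatMap encodeVar ++ l) := by
    intro H l h
    cases H with
    | nil => simpa using h
    | cons A B => intro b; simp [encodeVar]
  induction H generalizing H' with
  | nil =>
    cases H' with
    | nil => exact ⟨rfl, by simpa using e⟩
    | cons x' H' => exact absurd (by simp [encodeVar] at e; simp [e]) ha
  | cons x H ih =>
    cases H' with
    | nil => exact absurd (by simp [encodeVar] at e; simp [← e]) ha'
    | cons x' H' =>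
      simp only [List.flatMap_cons, encodeVar, List.cons_append, List.append_assoc,
        List.cons.injEq, true_and] at e
      obtain ⟨h1, h2⟩ := encodeBits_append_inj (nb H h) (nb H' h') e
      obtain ⟨h3, h4⟩ := ih h2
      exact ⟨by rw [h1, h3], h4⟩

theorem body_head_ne_var (B : List Atom) {l : List Token} (h : l.head? ≠ some Token.var) :
    (B.flatMap Atom.encode ++ l).head? ≠ some Token.var := by
  cases B with
  | nil => simpa using h
  | cons A B => simp [Atom.encode]

theorem CRPQ.encode_append_inj {Q Q' : CRPQ} {l l' : List Token} (h : NoBit l) (h' : NoBit l')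
    (ha : l.head? ≠ some Token.atom) (ha' : l'.head? ≠ some Token.atom)
    (hv : l.head? ≠ some Token.var) (hv' : l'.head? ≠ some Token.var)
    (e : Q.encode ++ l = Q'.encode ++ l') : Q = Q' ∧ l = l' := by
  obtain ⟨H, B, _⟩ := Q
  obtain ⟨H', B', _⟩ := Q'
  simp only [CRPQ.encode, List.append_assoc] at e
  obtain ⟨h1, h2⟩ := head_append_inj (noBit_body B h) (noBit_body B' h')
    (body_head_ne_var B hv) (body_head_ne_var B' hv') e
  obtain ⟨h3, h4⟩ := body_append_inj h h' ha ha' h2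
  subst h1 h3
  exact ⟨rfl, h4⟩

/-- Distinct pairs of queries are represented by distinct strings. -/
theorem encodePair_inj {Q₁ Q₂ Q₁' Q₂' : CRPQ} (e : encodePair Q₁ Q₂ = encodePair Q₁' Q₂') :
    Q₁ = Q₁' ∧ Q₂ = Q₂' := by
  obtain ⟨h1, h2⟩ := CRPQ.encode_append_inj (by intro b; simp) (by intro b; simp)
    (by simp) (by simp) (by simp) (by simp) e
  simp only [List.cons.injEq, true_and] at h2
  obtain ⟨h3, -⟩ := CRPQ.encode_append_inj (l := []) (l' := []) (by intro b; simp)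
    (by intro b; simp) (by simp) (by simp) (by simp) (by simp) (by simpa using h2)
  exact ⟨h1, h3⟩

/-! ## The complexity class -/

/-- The class `Π₂ᵖ`: a language `L` is in it if there are a polynomial `p` and a relation `R` that
a deterministic (multi-stack) Turing machine decides in polynomial time, such that `x ∈ L` iff for
every string `y` of length at most `p(|x|)` there is a string `z` of length at most `p(|x|)` with
`R(x, y, z)`. The strings `y` and `z` are over some finite alphabet `Δ`. The machine reads `x y z`,
where the three strings are over disjoint alphabets, and the running time is bounded by a polynomial
in `|x| + |y| + |z|`. -/
def InPi2P {Γ : Type} [Finite Γ] (L : Set (List Γ)) : Prop :=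
  ∃ (Δ : Type) (_ : Finite Δ) (p : Polynomial ℕ) (R : List Γ × List Δ × List Δ → Bool),
    Nonempty (Turing.TM2ComputableInPolyTime
      (encodingProd (encodingList Γ) (encodingProd (encodingList Δ) (encodingList Δ))).encode
      encodeBool R) ∧
    ∀ x : List Γ, x ∈ L ↔
      ∀ y : List Δ, y.length ≤ p.eval x.length →
        ∃ z : List Δ, z.length ≤ p.eval x.length ∧ R (x, y, z) = true

end CRPQContainment

/-!
The containment problem is put into `Π₂ᵖ` by a statement of the form "for every short binary tree
`Y`, the fact `goal(input, Y)` has a short derivation from a fixed finite set of Horn clauses".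

**Machines.** A derivation from Horn clauses whose facts are labelled binary trees is checked by a
single program on stacks, uniformly in the clauses: it reads a certificate line by line, where a
line names a clause and gives the trees to be substituted for its variables, instantiates the
clause, looks up the premises among the facts found before, and adds the conclusion. Structured
stack programs are compiled to the Turing machines of Mathlib, with a bound on their running times.
The outcome is `inPi2P_of_horn`: to put a language into `Π₂ᵖ` it is enough to give finitely many
clauses for which `x` belongs to the language if and only if the facts `goal(x, Y)` with small `Y`
are derivable, where the derivations that show membership are short.

**Small counterexamples.** A map from `Q₁` into a knowledge base uses a word for each atom of `Q₁`,
and `Q₁ ⊆ Q₂` holds if each graph that results from a choice of these words, which may contain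
wildcards, has a match of `Q₂` in its canonical knowledge base (`Good`). In `CRPQ(W)` only strings
`u` of labels and wildcards are iterated, hence an expression and the exponents of the powers `u ^
n` determine the word. If an exponent is huge, a match of `Q₂` leaves a long part of the power free
of images of variables of `Q₂`, and there a power can be replaced by a longer one with the same
effect on the automaton of `Q₂` (`exists_pump`). So in a smallest counterexample the exponents are
at most exponential, and their binary digits form a tree `Y` of polynomial size
(`containedIn_of_good`).

**Short witnesses.** Conversely, let `Q₂` match the graph of a choice, whose edges carry words that
are exponentially long but succinctly described. The edges are cut at the images of the variables of
`Q₂`; the description of a word can be cut at a given position by expanding it, which adds few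
pieces (`exists_flats`, `exists_refinement_of_good`). Whether an atom of `Q₂` holds between two
points of the refined graph is a reachability question for pairs of a point and a state of the
automaton, whose steps are the runs of the automaton on the pieces; runs on powers are obtained by
repeated squaring. All trees that occur in the facts needed are subtrees of a few trees of
polynomial size, hence there is a short derivation: it need not repeat a line, and there are few
lines (`BDer.exists_short`, `exists_short_proof`).

**Soundness.** Every tree is read as an object of the kind that is needed, ill-formed trees being
decoded to defaults, in such a way that each clause preserves truth (`Derivable.meaning`). Hence
well-formedness need not be checked, except for the input, which the clauses parse.
-/

namespace CRPQContainment

open Computability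

/-! ### Structured programs on stacks -/

/-- Structured programs acting on stacks indexed by `K` with symbols in `A`. -/
inductive Prog (K A : Type) where
  | skip : Prog K A
  | push (k : K) (a : A) : Prog K A
  | seq (p q : Prog K A) : Prog K A
  /-- pop a symbol from `k`; run `n` if there was none, and `c a` if it was `a` -/
  | cases (k : K) (n : Prog K A) (c : A → Prog K A) : Prog K A
  /-- while `k` is nonempty, pop a symbol `a` from it and run `c a` -/
  | loop (k : K) (c : A → Prog K A) : Prog K A

open Function (update)

/-- The contents of the stacks. -/
abbrev Store (K A : Type) := K → List A

/-- `Exec p s s' t`: the program `p` turns the store `s` into `s'` in exactly `t` machine steps. -/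
inductive Exec {K A : Type} [DecidableEq K] : Prog K A → Store K A → Store K A → ℕ → Prop
  | skip (s : Store K A) : Exec .skip s s 1
  | push (k : K) (a : A) (s : Store K A) : Exec (.push k a) s (update s k (a :: s k)) 1
  | seq {p q : Prog K A} {s s' s'' : Store K A} {t t' : ℕ} :
      Exec p s s' t → Exec q s' s'' t' → Exec (.seq p q) s s'' (t + t')
  | casesNil {k : K} {n : Prog K A} {c : A → Prog K A} {s s' : Store K A} {t : ℕ} :
      s k = [] → Exec n s s' t → Exec (.cases k n c) s s' (t + 1)
  | casesCons {k : K} {n : Prog K A} {c : A → Prog K A} {s s' : Store K A} {t : ℕ} {a : A}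
      {l : List A} :
      s k = a :: l → Exec (c a) (update s k l) s' t → Exec (.cases k n c) s s' (t + 1)
  | loopNil {k : K} {c : A → Prog K A} {s : Store K A} : s k = [] → Exec (.loop k c) s s 1
  | loopCons {k : K} {c : A → Prog K A} {s s' s'' : Store K A} {t t' : ℕ} {a : A} {l : List A} :
      s k = a :: l → Exec (c a) (update s k l) s' t → Exec (.loop k c) s' s'' t' →
      Exec (.loop k c) s s'' (t + t' + 1)

namespace Prog

variable {K A : Type}

/-- The program points of a program, which serve as labels of the machine. -/
def Lab : Prog K A → Type
  | skip => Unit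
  | push _ _ => Unit
  | seq p q => Lab p ⊕ Lab q
  | cases _ n c => Option (Lab n ⊕ Σ a, Lab (c a))
  | loop _ c => Option (Σ a, Lab (c a))

/-- The program point at which a program starts. -/
def entry : (p : Prog K A) → p.Lab
  | skip => ()
  | push _ _ => ()
  | seq p _ => Sum.inl p.entry
  | cases _ _ _ => none
  | loop _ _ => none

theorem finite_lab [Finite A] (p : Prog K A) : Finite p.Lab := by
  induction p with
  | skip => exact inferInstanceAs (Finite Unit)
  | push _ _ => exact inferInstanceAs (Finite Unit)
  | seq p q hp hq => exact inferInstanceAs (Finite (Lab p ⊕ Lab q))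
  | cases k n c hn hc => exact inferInstanceAs (Finite (Option (Lab n ⊕ Σ a, Lab (c a))))
  | loop k c hc => exact inferInstanceAs (Finite (Option (Σ a, Lab (c a))))

/-- The stack alphabets of the compiled machine: `none` is the output stack. -/
@[reducible] def Alph (K A : Type) : Option K → Type
  | none => Bool
  | some _ => A

/-- The code at the program points of `p`, inside a machine with labels `Λ`; control passes to
`exit` when `p` is done. The internal state holds the symbol popped last. -/
def code {Λ : Type} : (p : Prog K A) → (p.Lab → Λ) → Λ → p.Lab →
    Turing.TM2.Stmt (Alph K A) Λ (Option A)
  | skip, _, exit, _ => .goto fun _ => exit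
  | push k a, _, exit, _ => .push (some k) (fun _ => a) (.goto fun _ => exit)
  | seq p q, emb, exit, l =>
    match l with
    | .inl l => p.code (fun l => emb (.inl l)) (emb (.inr q.entry)) l
    | .inr l => q.code (fun l => emb (.inr l)) exit l
  | cases k n c, emb, exit, l =>
    match l with
    | none => .pop (some k) (fun _ o => o) (.goto fun o =>
        match o with
        | none => emb (some (.inl n.entry))
        | some a => emb (some (.inr ⟨a, (c a).entry⟩)))
    | some (.inl l) => n.code (fun l => emb (some (.inl l))) exit l
    | some (.inr ⟨a, l⟩) => (c a).code (fun l => emb (some (.inr ⟨a, l⟩))) exit l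
  | loop k c, emb, exit, l =>
    match l with
    | none => .pop (some k) (fun _ o => o) (.goto fun o =>
        match o with
        | none => exit
        | some a => emb (some ⟨a, (c a).entry⟩))
    | some ⟨a, l⟩ => (c a).code (fun l => emb (some ⟨a, l⟩)) (emb none) l

/-- The stacks of the compiled machine, with empty output stack. -/
def stk (s : Store K A) : ∀ k, List (Alph K A k)
  | none => []
  | some k => s k

theorem stk_update [DecidableEq K] (s : Store K A) (k : K) (l : List A) :
    update (stk s) (some k) l = stk (update s k l) := by
  funext k'
  cases k' with
  | none => simp [stk]
  | some k' =>
    by_cases h : k' = k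
    · subst h; simp [stk]
    · simp [stk, h]

/-- Exactly `n` steps of a machine. -/
inductive Steps {K Λ σ : Type} {Γ : K → Type} [DecidableEq K] (M : Λ → Turing.TM2.Stmt Γ Λ σ) :
    ℕ → Turing.TM2.Cfg Γ Λ σ → Turing.TM2.Cfg Γ Λ σ → Prop
  | refl (c : Turing.TM2.Cfg Γ Λ σ) : Steps M 0 c c
  | head {n : ℕ} {c c' c'' : Turing.TM2.Cfg Γ Λ σ} :
      Turing.TM2.step M c = some c' → Steps M n c' c'' → Steps M (n + 1) c c''

theorem Steps.trans {K Λ σ : Type} {Γ : K → Type} [DecidableEq K]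
    {M : Λ → Turing.TM2.Stmt Γ Λ σ} {m n : ℕ} {a b c : Turing.TM2.Cfg Γ Λ σ}
    (h : Steps M m a b) (h' : Steps M n b c) : Steps M (m + n) a c := by
  induction h with
  | refl => simpa using h'
  | head hs _ ih => rw [Nat.add_right_comm]; exact .head hs (ih h')

theorem Steps.iterate {K Λ σ : Type} {Γ : K → Type} [DecidableEq K]
    {M : Λ → Turing.TM2.Stmt Γ Λ σ} {n : ℕ} {a b : Turing.TM2.Cfg Γ Λ σ}
    (h : Steps M n a b) : (flip bind (Turing.TM2.step M))^[n] (some a) = some b := by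
  induction h with
  | refl => rfl
  | head hs _ ih =>
    rw [Function.iterate_succ_apply, ← ih]
    congr 1

/-- The compiled code simulates the program, step by step. -/
theorem code_steps {Λ : Type} [DecidableEq K] (M : Λ → Turing.TM2.Stmt (Alph K A) Λ (Option A))
    {p : Prog K A} {s s' : Store K A} {t : ℕ} (h : Exec p s s' t) :
    ∀ (emb : p.Lab → Λ) (exit : Λ), (∀ l, M (emb l) = p.code emb exit l) → ∀ v,
      ∃ v', Steps M t ⟨some (emb p.entry), v, stk s⟩ ⟨some exit, v', stk s'⟩ := by
  induction h with
  | skip s =>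
    intro emb exit hM v
    refine ⟨v, .head ?_ (.refl _)⟩
    simp [hM, code]
  | push k a s =>
    intro emb exit hM v
    refine ⟨v, .head ?_ (.refl _)⟩
    simp only [Turing.TM2.step, hM, code, Turing.TM2.stepAux, Option.some.injEq]
    rw [← stk_update]; rfl
  | @seq p q s s' s'' t t' _ _ ih ih' =>
    intro emb exit hM v
    obtain ⟨v', h1⟩ := ih (fun l => emb (.inl l)) (emb (.inr q.entry)) (fun l => hM (.inl l)) v
    obtain ⟨v'', h2⟩ := ih' (fun l => emb (.inr l)) exit (fun l => hM (.inr l)) v'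
    exact ⟨v'', h1.trans h2⟩
  | @casesNil k n c s s' t hk _ ih =>
    intro emb exit hM v
    obtain ⟨v', h1⟩ := ih (fun l => emb (some (.inl l))) exit (fun l => hM (some (.inl l))) none
    refine ⟨v', .head ?_ h1⟩
    have e : update (stk s) (some k) (stk s (some k)).tail = stk s := by
      have : stk s (some k) = [] := hk
      rw [this, stk_update]; congr 1; rw [List.tail_nil, ← hk]; simp
    have e2 : stk s (some k) = [] := hk
    refine congrArg some ?_
    rw [hM]
    change Turing.TM2.stepAux (.pop (some k) (fun _ o => o) (.goto _)) v (stk s) = _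
    simp only [Turing.TM2.stepAux, e]
    simp only [e2, List.head?_nil]
  | @casesCons k n c s s' t a l hk _ ih =>
    intro emb exit hM v
    obtain ⟨v', h1⟩ := ih (fun l => emb (some (.inr ⟨a, l⟩))) exit
      (fun l => hM (some (.inr ⟨a, l⟩))) (some a)
    refine ⟨v', .head ?_ h1⟩
    have e2 : stk s (some k) = a :: l := hk
    refine congrArg some ?_
    rw [hM]
    change Turing.TM2.stepAux (.pop (some k) (fun _ o => o) (.goto _)) v (stk s) = _
    simp only [Turing.TM2.stepAux, e2, List.head?_cons, List.tail_cons]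
    rw [stk_update]
  | @loopNil k c s hk =>
    intro emb exit hM v
    refine ⟨none, .head ?_ (.refl _)⟩
    have e : update (stk s) (some k) (stk s (some k)).tail = stk s := by
      have : stk s (some k) = [] := hk
      rw [this, stk_update]; congr 1; rw [List.tail_nil, ← hk]; simp
    have e2 : stk s (some k) = [] := hk
    refine congrArg some ?_
    rw [hM]
    change Turing.TM2.stepAux (.pop (some k) (fun _ o => o) (.goto _)) v (stk s) = _
    simp only [Turing.TM2.stepAux, e]
    simp only [e2, List.head?_nil]
  | @loopCons k c s s' s'' t t' a l hk _ _ ih ih' =>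
    intro emb exit hM v
    obtain ⟨v', h1⟩ := ih (fun l => emb (some ⟨a, l⟩)) (emb none)
      (fun l => hM (some ⟨a, l⟩)) (some a)
    obtain ⟨v'', h2⟩ := ih' emb exit hM v'
    refine ⟨v'', .head ?_ (h1.trans h2)⟩
    have e2 : stk s (some k) = a :: l := hk
    refine congrArg some ?_
    rw [hM]
    change Turing.TM2.stepAux (.pop (some k) (fun _ o => o) (.goto _)) v (stk s) = _
    simp only [Turing.TM2.stepAux, e2, List.head?_cons, List.tail_cons]
    rw [stk_update]

/-- The machine that runs a program and then outputs whether the stack `res` is nonempty. -/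
noncomputable def machine [DecidableEq K] [Fintype K] [Fintype A] (p : Prog K A) (inp res : K) :
    Turing.FinTM2 where
  K := Option K
  k₀ := some inp
  k₁ := none
  Γ := Alph K A
  Λ := Option p.Lab
  main := some p.entry
  ΛFin := by haveI := p.finite_lab; exact Fintype.ofFinite _
  σ := Option A
  initialState := none
  Γk₀Fin := inferInstanceAs (Fintype A)
  m l := match l with
    | some l => p.code some none l
    | none => .pop (some res) (fun _ o => o) (.push none (fun o => o.isSome)
        (.load (fun _ => none) .halt))

/-- A program that decides `f` in polynomial time yields a machine that does. -/
theorem polyTime_of_exec [DecidableEq K] [Fintype K] [Fintype A] (p : Prog K A) (inp res : K)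
    {α : Type} (ea : α → List A) (f : α → Bool) (P : Polynomial ℕ)
    (h : ∀ a, ∃ s' t, t ≤ P.eval (ea a).length ∧ Exec p (update (fun _ => []) inp (ea a)) s' t ∧
      (∀ k, k ≠ res → s' k = []) ∧ (s' res).length = (f a).toNat) :
    Nonempty (Turing.TM2ComputableInPolyTime ea encodeBool f) := by
  classical
  refine ⟨{ tm := p.machine inp res
            inputAlphabet := Equiv.refl A
            outputAlphabet := Equiv.refl Bool
            time := P + 1
            outputsFun := fun a => ?_ }⟩
  choose s' t ht hex hk hr using h
  have hM : ∀ l, (p.machine inp res).m (some l) = p.code some none l := fun l => rfl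
  have key := code_steps (p.machine inp res).m (hex a) some none hM none
  have step1 : (p.machine inp res).step = Turing.TM2.step (p.machine inp res).m := rfl
  refine { steps := t a + 1, evals_in_steps := ?_, steps_le_m := ?_ }
  · obtain ⟨v', h1⟩ := key
    have h2 : Steps (p.machine inp res).m 1 ⟨some none, v', stk (s' a)⟩
        (Turing.haltList (p.machine inp res) (encodeBool (f a))) := by
      refine .head ?_ (.refl _)
      have e : (p.machine inp res).m none = .pop (some res) (fun _ o => o)
        (.push none (fun o => o.isSome) (.load (fun _ => none) .halt)) := rfl
      simp only [Turing.TM2.step, e, Turing.TM2.stepAux]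
      have hv : (stk (s' a) (some res)).head?.isSome = f a := by
        have := hr a
        change (s' a res).head?.isSome = f a
        cases hs : s' a res <;> cases hf : f a <;> simp_all
      refine congrArg (fun S => some (⟨none, none, S⟩ : Turing.TM2.Cfg _ _ _)) (funext fun k => ?_)
      cases k with
      | none =>
        refine (Function.update_self ..).trans ?_
        change [(stk (s' a) (some res)).head?.isSome] = [f a]
        rw [hv]
      | some k =>
        refine (Function.update_of_ne (Option.some_ne_none k) _ _).trans ?_
        have : (some k : Option K) ≠ (p.machine inp res).k₁ := by
          intro h; cases h
        refine Eq.trans ?_ (dif_neg this).symm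
        by_cases h : k = res
        · subst h
          refine (Function.update_self ..).trans ?_
          have := hr a
          change (s' a k).tail = []
          cases hs : s' a k with
          | nil => rfl
          | cons b l =>
            rw [hs, List.length_cons] at this
            have := (f a).toNat_le
            change l = []
            exact List.eq_nil_of_length_eq_zero (by omega)
        · refine (Function.update_of_ne (fun h' => h (Option.some_injective _ h')) _ _).trans ?_
          exact hk a k h
    have h3 := (h1.trans h2).iterate
    have ei : Turing.initList (p.machine inp res) (List.map (Equiv.refl A).invFun (ea a)) =
        ⟨some (some p.entry), none, stk (update (fun _ => []) inp (ea a))⟩ := by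
      unfold Turing.initList
      congr 1
      funext k
      cases k with
      | none =>
        exact dif_neg (by intro h; cases h)
      | some k =>
        by_cases h : k = inp
        · subst h
          refine (dif_pos (show some k = (p.machine k res).k₀ from rfl)).trans ?_
          change List.map (Equiv.refl A).invFun (ea a) = update (fun _ => []) k (ea a) k
          simp
        · refine (dif_neg (by intro h'; cases h'; exact h rfl)).trans ?_
          exact (Function.update_of_ne (f := fun _ => []) h (ea a)).symm
    have eo : List.map (Equiv.refl Bool).invFun (encodeBool (f a)) = encodeBool (f a) := by
      simp
    rw [step1]
    refine Eq.trans ?_ (h3.trans ?_)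
    · exact congrArg _ (congrArg some ei)
    · exact congrArg (fun l => some (Turing.haltList (p.machine inp res) l)) eo.symm
  · have := ht a
    simp
    omega

end Prog

/-! ### Running times of programs -/

section Runs

variable {K A : Type} [DecidableEq K]

/-- `p` turns `s` into `s'` in at most `b` machine steps. -/
def Runs (p : Prog K A) (s s' : Store K A) (b : ℕ) : Prop := ∃ t ≤ b, Exec p s s' t

namespace Runs

variable {p q : Prog K A} {s s' s'' : Store K A} {b b' : ℕ} {k : K} {n : Prog K A}
  {c : A → Prog K A} {a : A} {l : List A}

theorem mono (h : Runs p s s' b) (hb : b ≤ b') : Runs p s s' b' := by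
  obtain ⟨t, ht, h⟩ := h
  exact ⟨t, ht.trans hb, h⟩

theorem congr (h : Runs p s s' b) (hs : s' = s'') (hb : b ≤ b') : Runs p s s'' b' :=
  hs ▸ h.mono hb

theorem skip : Runs (.skip : Prog K A) s s 1 := ⟨1, le_rfl, .skip s⟩

theorem push : Runs (.push k a) s (update s k (a :: s k)) 1 := ⟨1, le_rfl, .push k a s⟩

theorem seq (h : Runs p s s' b) (h' : Runs q s' s'' b') : Runs (.seq p q) s s'' (b + b') := by
  obtain ⟨t, ht, h⟩ := h
  obtain ⟨t', ht', h'⟩ := h'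
  exact ⟨t + t', by omega, .seq h h'⟩

theorem cases_nil (hk : s k = []) (h : Runs n s s' b) : Runs (.cases k n c) s s' (b + 1) := by
  obtain ⟨t, ht, h⟩ := h
  exact ⟨t + 1, by omega, .casesNil hk h⟩

theorem cases_cons (hk : s k = a :: l) (h : Runs (c a) (update s k l) s' b) :
    Runs (.cases k n c) s s' (b + 1) := by
  obtain ⟨t, ht, h⟩ := h
  exact ⟨t + 1, by omega, .casesCons hk h⟩

theorem loop_nil (hk : s k = []) : Runs (.loop k c) s s 1 := ⟨1, le_rfl, .loopNil hk⟩

theorem loop_cons (hk : s k = a :: l) (h : Runs (c a) (update s k l) s' b)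
    (h' : Runs (.loop k c) s' s'' b') : Runs (.loop k c) s s'' (b + b' + 1) := by
  obtain ⟨t, ht, h⟩ := h
  obtain ⟨t', ht', h'⟩ := h'
  exact ⟨t + t' + 1, by omega, .loopCons hk h h'⟩

end Runs

namespace Prog

/-- Empty the stack `a`. -/
def clear (a : K) : Prog K A := .loop a fun _ => .skip

theorem clear_runs (a : K) (s : Store K A) :
    Runs (clear a) s (update s a []) (2 * (s a).length + 1) := by
  generalize hl : s a = l
  induction l generalizing s with
  | nil => exact (Runs.loop_nil hl).congr (by rw [← hl]; simp) (by simp)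
  | cons c l ih =>
    exact (Runs.loop_cons hl .skip (ih (update s a l) (by simp))).congr (by simp)
      (by simp; omega)

/-- Move the contents of `a` onto `b`, reversing their order. -/
def move (a b : K) : Prog K A := .loop a fun c => .push b c

theorem move_runs {a b : K} (h : a ≠ b) (s : Store K A) :
    Runs (move a b) s (update (update s a []) b ((s a).reverse ++ s b))
      (2 * (s a).length + 1) := by
  generalize hl : s a = l
  induction l generalizing s with
  | nil =>
    refine (Runs.loop_nil hl).congr ?_ (by simp)
    funext k
    simp only [Function.update_apply]
    split_ifs <;> simp_all
  | cons c l ih =>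
    refine (Runs.loop_cons hl .push (ih _ (by simp [h]))).congr ?_ (by simp; omega)
    funext k
    simp only [Function.update_apply, List.reverse_cons, List.append_assoc]
    split_ifs <;> simp_all

/-- Move the contents of `a` onto both `b` and `c`, reversing their order. -/
def dup (a b c : K) : Prog K A := .loop a fun d => .seq (.push b d) (.push c d)

theorem dup_runs {a b c : K} (hb : a ≠ b) (hc : a ≠ c) (hbc : b ≠ c) (s : Store K A) :
    Runs (dup a b c) s
      (update (update (update s a []) b ((s a).reverse ++ s b)) c ((s a).reverse ++ s c))
      (3 * (s a).length + 1) := by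
  generalize hl : s a = l
  induction l generalizing s with
  | nil =>
    refine (Runs.loop_nil hl).congr ?_ (by simp)
    funext k
    simp only [Function.update_apply]
    split_ifs <;> simp_all
  | cons d l ih =>
    refine (Runs.loop_cons hl (Runs.seq .push .push) (ih _ (by simp [hb, hc]))).congr ?_
      (by simp; omega)
    funext k
    simp only [Function.update_apply, List.reverse_cons, List.append_assoc]
    split_ifs <;> simp_all

end Prog

end Runs

/-! ### Labelled trees, patterns and Horn clauses -/

/-- Binary trees with labelled leaves, the data of the certificates. -/
inductive LTree (L : Type) where
  | leaf (c : L) : LTree L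
  | node (a b : LTree L) : LTree L

namespace LTree

variable {L : Type}

/-- The string of a tree in prefix notation; `none` marks an inner node. -/
def enc : LTree L → List (Option L)
  | leaf c => [some c]
  | node a b => none :: (a.enc ++ b.enc)

/-- The number of nodes. -/
def size : LTree L → ℕ
  | leaf _ => 1
  | node a b => a.size + b.size + 1

theorem size_pos (t : LTree L) : 0 < t.size := by cases t <;> simp [size]

theorem length_enc (t : LTree L) : t.enc.length = t.size := by
  induction t with
  | leaf c => rfl
  | node a b iha ihb => simp [enc, size, iha, ihb]

theorem enc_append_inj {t t' : LTree L} {l l' : List (Option L)}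
    (e : t.enc ++ l = t'.enc ++ l') : t = t' ∧ l = l' := by
  induction t generalizing t' l l' with
  | leaf c => cases t' <;> simp_all [enc]
  | node a b iha ihb =>
    cases t' with
    | leaf c => simp [enc] at e
    | node a' b' =>
      simp only [enc, List.cons_append, List.append_assoc, List.cons.injEq, true_and] at e
      obtain ⟨h1, h2⟩ := iha e
      obtain ⟨h3, h4⟩ := ihb h2
      exact ⟨by rw [h1, h3], h4⟩

theorem enc_injective {t t' : LTree L} (e : t.enc = t'.enc) : t = t' :=
  (enc_append_inj (l := []) (l' := []) (by simpa using e)).1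

/-- The tree of a list, with `nl` at its end. -/
def list (nl : L) (l : List (LTree L)) : LTree L := l.foldr node (leaf nl)

end LTree

/-- The number of variables that a Horn clause may use. -/
abbrev numVars : ℕ := 12

/-- Tree patterns. -/
inductive Pat (L : Type) where
  | var (i : Fin numVars) : Pat L
  | leaf (c : L) : Pat L
  | node (p q : Pat L) : Pat L

namespace Pat

variable {L : Type}

/-- The instance of a pattern. -/
def subst (σ : Fin numVars → LTree L) : Pat L → LTree L
  | var i => σ i
  | leaf c => .leaf c
  | node p q => .node (p.subst σ) (q.subst σ)

/-- The string of an instance of a pattern, from the strings of the trees substituted. -/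
def substStr (v : Fin numVars → List (Option L)) : Pat L → List (Option L)
  | var i => v i
  | leaf c => [some c]
  | node p q => none :: (p.substStr v ++ q.substStr v)

theorem substStr_enc (σ : Fin numVars → LTree L) (p : Pat L) :
    p.substStr (fun i => (σ i).enc) = (p.subst σ).enc := by
  induction p with
  | var i => rfl
  | leaf c => rfl
  | node p q hp hq => simp [substStr, subst, LTree.enc, hp, hq]

/-- A measure of the work needed to write an instance. -/
def weight : Pat L → ℕ
  | var _ => 1
  | leaf _ => 1
  | node p q => p.weight + q.weight + 1

theorem length_substStr_le (v : Fin numVars → List (Option L)) (M : ℕ)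
    (h : ∀ i, (v i).length ≤ M) (p : Pat L) : (p.substStr v).length ≤ p.weight * (M + 1) := by
  induction p with
  | var i => simp [substStr, weight]; have := h i; omega
  | leaf c => simp [substStr, weight]
  | node p q hp hq => simp [substStr, weight, add_mul]; omega

end Pat

/-- A Horn clause over trees. -/
structure Clause (L : Type) where
  prems : List (Pat L)
  concl : Pat L

/-- The facts that follow from a system of Horn clauses. -/
inductive Derivable {L R : Type} (rules : R → Clause L) : LTree L → Prop
  | rule (r : R) (σ : Fin numVars → LTree L)
      (h : ∀ p ∈ (rules r).prems, Derivable rules (p.subst σ)) :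
      Derivable rules ((rules r).concl.subst σ)

/-! ### Reading certificates -/

/-- The symbols of the strings quantified over: symbols of trees, and names of clauses. -/
abbrev CertSym (L R : Type) := Option L ⊕ R

/-- The symbols that the machine reads. -/
abbrev InSym (Γ L R : Type) := Γ ⊕ (CertSym L R ⊕ CertSym L R)

section Spec

variable {Γ L R : Type}

/-- Read the encodings of `n` trees from a string; returns the encodings and the rest of the
string. Every string can be read: missing or wrong symbols count as leaves `nl`. -/
def readN (nl : L) : List (CertSym L R) → ℕ → List (Option L) × List (CertSym L R)
  | l, 0 => ([], l)
  | [], n + 1 => (List.replicate (n + 1) (some nl), [])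
  | .inl none :: l, n + 1 => (none :: (readN nl l (n + 2)).1, (readN nl l (n + 2)).2)
  | .inl (some c) :: l, n + 1 => (some c :: (readN nl l n).1, (readN nl l n).2)
  | .inr _ :: l, n + 1 => (some nl :: (readN nl l n).1, (readN nl l n).2)

theorem length_readN (nl : L) (l : List (CertSym L R)) (n : ℕ) :
    (readN nl l n).1.length + 2 * (readN nl l n).2.length ≤ 2 * l.length + n := by
  fun_induction readN nl l n <;> simp_all <;> omega

theorem exists_forest_readN (nl : L) (l : List (CertSym L R)) (n : ℕ) :
    ∃ ts : List (LTree L), ts.length = n ∧ (readN nl l n).1 = ts.flatMap LTree.enc := by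
  fun_induction readN nl l n with
  | case1 l => exact ⟨[], rfl, rfl⟩
  | case2 n =>
    refine ⟨List.replicate (n + 1) (.leaf nl), by simp, ?_⟩
    generalize n + 1 = k
    induction k with
    | zero => rfl
    | succ k ih => simpa [List.replicate_succ, LTree.enc] using ih
  | case3 l n ih =>
    obtain ⟨ts, h1, h2⟩ := ih
    match ts, h1 with
    | a :: b :: ts, h1 =>
      exact ⟨.node a b :: ts, by simpa using h1, by simp [h2, LTree.enc]⟩
  | case4 c l n ih =>
    obtain ⟨ts, h1, h2⟩ := ih
    exact ⟨.leaf c :: ts, by simpa using h1, by simp [h2, LTree.enc]⟩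
  | case5 c l n ih =>
    obtain ⟨ts, h1, h2⟩ := ih
    exact ⟨.leaf nl :: ts, by simpa using h1, by simp [h2, LTree.enc]⟩

theorem exists_tree_readN (nl : L) (l : List (CertSym L R)) :
    ∃ t : LTree L, (readN nl l 1).1 = t.enc := by
  obtain ⟨ts, h1, h2⟩ := exists_forest_readN nl l 1
  obtain ⟨t, rfl⟩ := List.length_eq_one_iff.1 h1
  exact ⟨t, by simpa using h2⟩

theorem readN_enc (nl : L) (t : LTree L) (l : List (CertSym L R)) (n : ℕ) :
    readN nl (t.enc.map .inl ++ l) (n + 1) =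
      (t.enc ++ (readN nl l n).1, (readN nl l n).2) := by
  induction t generalizing l n with
  | leaf c => simp [LTree.enc, readN]
  | node a b iha ihb => simp [LTree.enc, readN, iha, ihb]

/-- Read one tree for each variable in a list. -/
def readVars (nl : L) : List (Fin numVars) → List (CertSym L R) →
    (Fin numVars → List (Option L)) → List (CertSym L R) × (Fin numVars → List (Option L))
  | [], l, v => (l, v)
  | i :: is, l, v => readVars nl is (readN nl l 1).2 (update v i (readN nl l 1).1)

theorem readVars_rest_length_le (nl : L) (is : List (Fin numVars)) (l : List (CertSym L R))
    (v : Fin numVars → List (Option L)) : (readVars nl is l v).1.length ≤ l.length := by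
  induction is generalizing l v with
  | nil => simp [readVars]
  | cons i is ih =>
    have h1 := ih (readN nl l 1).2 (update v i (readN nl l 1).1)
    have h2 := length_readN nl l 1
    have h3 : 0 < (readN nl l 1).1.length := by
      obtain ⟨t, ht⟩ := exists_tree_readN nl l
      rw [ht, LTree.length_enc]; exact t.size_pos
    simp only [readVars]; omega

theorem length_readVars_le (nl : L) (is : List (Fin numVars)) (l : List (CertSym L R))
    (v : Fin numVars → List (Option L)) (M : ℕ) (hM : 2 * l.length + 1 ≤ M)
    (hv : ∀ i, (v i).length ≤ M) (i : Fin numVars) :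
    ((readVars nl is l v).2 i).length ≤ M := by
  induction is generalizing l v with
  | nil => exact hv i
  | cons j is ih =>
    have h2 := length_readN nl l 1
    have h3 : 0 < (readN nl l 1).1.length := by
      obtain ⟨t, ht⟩ := exists_tree_readN nl l
      rw [ht, LTree.length_enc]; exact t.size_pos
    refine ih _ _ (by omega) fun k => ?_
    by_cases hk : k = j
    · subst hk; simp; omega
    · rw [Function.update_of_ne hk]; exact hv k

theorem readVars_eq_of_notMem (nl : L) (is : List (Fin numVars)) (l : List (CertSym L R))
    (v : Fin numVars → List (Option L)) (i : Fin numVars) (hi : i ∉ is) :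
    (readVars nl is l v).2 i = v i := by
  induction is generalizing l v with
  | nil => rfl
  | cons j is ih =>
    rw [List.mem_cons, not_or] at hi
    rw [readVars, ih _ _ hi.2, Function.update_of_ne hi.1]

theorem exists_tree_readVars (nl : L) (is : List (Fin numVars)) (l : List (CertSym L R))
    (v : Fin numVars → List (Option L)) (i : Fin numVars) (hi : i ∈ is) :
    ∃ t : LTree L, (readVars nl is l v).2 i = t.enc := by
  induction is generalizing l v with
  | nil => simp at hi
  | cons j is ih =>
    by_cases h : i ∈ is
    · exact ih _ _ h
    · obtain rfl : i = j := by simpa [h] using hi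
      rw [readVars, readVars_eq_of_notMem _ _ _ _ _ h, Function.update_self]
      exact exists_tree_readN nl l

theorem readVars_enc (nl : L) (is : List (Fin numVars)) (σ : Fin numVars → LTree L)
    (l : List (CertSym L R)) (v : Fin numVars → List (Option L)) :
    (readVars nl is ((is.flatMap fun i => (σ i).enc).map .inl ++ l) v).1 = l ∧
    ∀ i, i ∈ is ∨ v i = (σ i).enc →
      (readVars nl is ((is.flatMap fun i => (σ i).enc).map .inl ++ l) v).2 i = (σ i).enc := by
  induction is generalizing v with
  | nil => exact ⟨rfl, fun i hi => by simpa [readVars] using hi⟩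
  | cons j is ih =>
    simp only [List.flatMap_cons, List.map_append, List.append_assoc, readVars, readN_enc, readN,
      List.append_nil]
    refine ⟨(ih _).1, fun i hi => (ih _).2 i ?_⟩
    by_cases h : i = j
    · subst h; simp
    · rcases hi with hi | hi
      · exact .inl (by simpa [h] using hi)
      · exact .inr (by simpa [h] using hi)

/-- What the verifier does with a list of lines, each of which names a clause and gives the trees
to be substituted for its variables: it collects the conclusions, and notes whether some premise is
not among the previous conclusions. The first argument bounds the number of lines. -/
def scan [DecidableEq L] (nl : L) (rules : R → Clause L) : ℕ → List (CertSym L R) →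
    List (List (Option L)) → Bool → List (List (Option L)) × Bool
  | 0, _, ws, bad => (ws, bad)
  | _ + 1, [], ws, bad => (ws, bad)
  | k + 1, .inl _ :: l, ws, bad => scan nl rules k l ws bad
  | k + 1, .inr r :: l, ws, bad =>
    scan nl rules k (readVars nl (List.finRange numVars) l fun _ => []).1
      ((rules r).concl.substStr (readVars nl (List.finRange numVars) l fun _ => []).2 :: ws)
      (bad || (rules r).prems.any fun p =>
        decide (p.substStr (readVars nl (List.finRange numVars) l fun _ => []).2 ∉ ws))

theorem scan_bad [DecidableEq L] (nl : L) (rules : R → Clause L) (k : ℕ)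
    (l : List (CertSym L R)) (ws : List (List (Option L))) :
    (scan nl rules k l ws true).2 = true := by
  induction k generalizing l ws with
  | zero => rfl
  | succ k ih =>
    rcases l with - | ⟨c | r, l⟩
    · rfl
    · exact ih _ _
    · simp only [scan, Bool.true_or]; exact ih _ _

/-- Everything that the verifier collects is derivable, unless a premise was missing. -/
theorem derivable_of_scan [DecidableEq L] (nl : L) (rules : R → Clause L) (k : ℕ)
    (l : List (CertSym L R)) (ws : List (List (Option L))) (bad : Bool)
    (hws : ∀ w ∈ ws, ∃ t, w = LTree.enc t ∧ Derivable rules t)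
    (h : (scan nl rules k l ws bad).2 = false) :
    ∀ w ∈ (scan nl rules k l ws bad).1, ∃ t, w = LTree.enc t ∧ Derivable rules t := by
  induction k generalizing l ws bad with
  | zero => exact hws
  | succ k ih =>
    rcases l with - | ⟨c | r, l⟩
    · exact hws
    · exact ih _ _ _ hws h
    · simp only [scan] at h ⊢
      refine ih _ _ _ ?_ h
      cases hb : (bad || (rules r).prems.any fun p =>
        decide (p.substStr (readVars nl (List.finRange numVars) l fun _ => []).2 ∉ ws)) with
      | true => rw [hb, scan_bad] at h; simp at h
      | false =>
        simp only [Bool.or_eq_false_iff, List.any_eq_false, decide_eq_true_eq,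
          not_not] at hb
        choose σ hσ using fun i =>
          exists_tree_readVars nl (List.finRange numVars) l (fun _ => []) i (List.mem_finRange i)
        have hv : (readVars nl (List.finRange numVars) l fun _ => []).2 = fun i => (σ i).enc :=
          funext hσ
        rw [hv] at hb ⊢
        intro w hw
        rw [List.mem_cons] at hw
        rcases hw with rfl | hw
        · refine ⟨_, Pat.substStr_enc σ _, .rule r σ fun p hp => ?_⟩
          obtain ⟨t, h1, h2⟩ := hws _ (hb.2 p hp)
          rw [Pat.substStr_enc] at h1
          rwa [LTree.enc_injective h1]
        · exact hws w hw

/-- A line of a certificate. -/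
abbrev Line (L R : Type) := R × (Fin numVars → LTree L)

/-- The fact that a line proves. -/
def Line.fact (rules : R → Clause L) (s : Line L R) : LTree L := (rules s.1).concl.subst s.2

/-- The string of a line. -/
def Line.enc (s : Line L R) : List (CertSym L R) :=
  .inr s.1 :: ((List.finRange numVars).flatMap fun i => (s.2 i).enc).map .inl

/-- `ss`, written with the last line first, is a proof: the premises of a line are proved by earlier
lines. -/
def IsProof (rules : R → Clause L) : List (Line L R) → Prop
  | [] => True
  | s :: ss => (∀ p ∈ (rules s.1).prems, p.subst s.2 ∈ ss.map (Line.fact rules)) ∧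
      IsProof rules ss

theorem IsProof.of_append {rules : R → Clause L} {ss ss' : List (Line L R)}
    (h : IsProof rules (ss ++ ss')) : IsProof rules ss' := by
  induction ss with
  | nil => exact h
  | cons s ss ih => exact ih h.2

/-- The verifier accepts proofs. -/
theorem scan_proof [DecidableEq L] (nl : L) (rules : R → Clause L) (ss ss' : List (Line L R))
    (h : IsProof rules (ss.reverse ++ ss')) (k : ℕ) (hk : (ss.flatMap Line.enc).length ≤ k) :
    scan nl rules k (ss.flatMap Line.enc) ((ss'.map (Line.fact rules)).map LTree.enc) false =
      (((ss.reverse ++ ss').map (Line.fact rules)).map LTree.enc, false) := by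
  induction ss generalizing ss' k with
  | nil => cases k <;> simp [scan]
  | cons s ss ih =>
    obtain ⟨r, σ⟩ := s
    cases k with
    | zero => simp [Line.enc] at hk
    | succ k =>
      have e := readVars_enc nl (List.finRange numVars) σ (ss.flatMap Line.enc) (fun _ => [])
      have hv : (readVars nl (List.finRange numVars)
          (((List.finRange numVars).flatMap fun i => (σ i).enc).map .inl ++ ss.flatMap Line.enc)
          fun _ => []).2 = fun i => (σ i).enc :=
        funext fun i => e.2 i (.inl (List.mem_finRange i))
      simp only [List.flatMap_cons, Line.enc, List.cons_append, scan]
      simp only [List.reverse_cons, List.append_assoc, List.singleton_append] at h ⊢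
      rw [hv, e.1]
      have h2 := h.of_append
      have hb : (false || (rules r).prems.any fun p =>
          decide (p.substStr (fun i => (σ i).enc) ∉
            (ss'.map (Line.fact rules)).map LTree.enc)) = false := by
        simp only [Bool.false_or, List.any_eq_false, decide_eq_true_eq, not_not]
        intro p hp
        rw [Pat.substStr_enc]
        exact List.mem_map_of_mem (h2.1 p hp)
      rw [hb, Pat.substStr_enc]
      refine ih ((r, σ) :: ss') h k ?_
      simp only [List.flatMap_cons, List.length_append, Line.enc, List.length_cons] at hk
      omega

end Spec

/-! ### The verifier as a stack program -/

/-- The stacks of the verifier: the input `inp`; the tree `x` of the input string and the tree `u`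
of the universally quantified string; the unread part `z` of the certificate; the facts `f` proved
so far; the fact `p` looked for; a flag `b` for missing premises; the result `r`; the values `v i`
of the variables of a clause; and auxiliary stacks. -/
inductive Reg where
  | inp | x | u | y | z | n | o | t | f | g | p | q | m | e | b | r
  | v (i : Fin numVars)
  deriving DecidableEq, Fintype

section

variable {Γ L R : Type}

/-- A tree symbol as a symbol on the stacks. -/
def sy (c : Option L) : InSym Γ L R := .inr (.inl (.inl c))

/-- A certificate symbol as a symbol on the stacks. -/
def ce (c : CertSym L R) : InSym Γ L R := .inr (.inl c)

/-- The end marker of a fact. -/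
def sep : InSym Γ L R := .inr (.inr (.inl none))

/-- Read a symbol as the symbol of a tree. -/
def unsy (nl : L) : InSym Γ L R → Option L
  | .inr (.inl (.inl c)) => c
  | _ => some nl

theorem sy_injective : Function.Injective (sy : Option L → InSym Γ L R) := by
  intro a b h
  simpa [sy] using h

theorem sy_ne_sep (c : Option L) : (sy c : InSym Γ L R) ≠ sep := by simp [sy, sep]

/-- The stack that holds a list of facts. -/
def facts (ws : List (List (Option L))) : List (InSym Γ L R) :=
  ws.flatMap fun w => w.map sy ++ [sep]

/-- The store between two lines of the certificate. -/
def mainStore (x u : List (InSym Γ L R)) (z : List (CertSym L R))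
    (v : Fin numVars → List (Option L)) (ws : List (List (Option L))) (b : List (InSym Γ L R)) :
    Store Reg (InSym Γ L R)
  | .x => x
  | .u => u
  | .z => z.map ce
  | .v i => (v i).map sy
  | .f => facts ws
  | .b => b
  | _ => []

/-! #### Reading trees -/

/-- Handle the next symbol of a tree: write it on `o` and update the number of trees to be read. -/
def readSym (nl : L) (c : InSym Γ L R) : Prog Reg (InSym Γ L R) :=
  match unsy nl c with
  | none => .seq (.push .n sep) (.seq (.push .n sep) (.push .o (sy none)))
  | some c => .push .o (sy (some c))

/-- Move the encoding of the tree at the top of `src` to `dst`. The stack `n` counts the trees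
still to be read. -/
def readTree (nl : L) (src dst : Reg) : Prog Reg (InSym Γ L R) :=
  .seq (.push .n sep) (.seq (.loop .n fun _ => .cases src (.push .o (sy (some nl)))
    (readSym nl)) (Prog.move .o dst))

theorem readTree_loop_runs_nil (nl : L) (src : Reg) (hn : src ≠ .n) (ho : src ≠ .o) (k : ℕ)
    (s : Store Reg (InSym Γ L R)) (hs : s src = []) (hk : s .n = List.replicate k sep) :
    Runs (.loop .n fun _ => .cases src (.push .o (sy (some nl))) (readSym nl)) s
      (update (update (update s .n []) src []) .o
        (((List.replicate k (some nl)).map sy).reverse ++ s .o))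
      (5 * (List.replicate k (some nl)).length + 1) := by
  induction k generalizing s with
  | zero =>
    refine (Runs.loop_nil (by simpa using hk)).congr ?_ (by simp)
    funext j
    simp only [Function.update_apply]
    split_ifs <;> simp_all
  | succ k ih =>
    rw [List.replicate_succ] at hk
    have hp : Runs (.push .o (sy (some nl))) (update s .n (List.replicate k sep)) _ 1 := Runs.push
    refine (Runs.loop_cons hk (Runs.cases_nil (by simpa [hn] using hs) hp)
      (ih _ (by simpa [hn, ho] using hs) (by simp))).congr ?_ (by simp; omega)
    funext j
    have e : List.replicate k (sy (some nl)) ++ sy (some nl) :: s .o =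
        sy (some nl) :: (List.replicate k (sy (some nl)) ++ s .o) := by
      clear ih hp hk
      induction k <;> simp_all [List.replicate_succ]
    simp only [Function.update_apply, List.replicate_succ']
    split_ifs with h1 h2 h3 <;> simp_all

/-- The register `n` holds the number of trees that are still to be read, in unary notation; an
inner node increases it, and if the stack `src` is exhausted, the missing trees become leaves `nl`.
-/
theorem readTree_loop_runs (nl : L) (src : Reg) (hn : src ≠ .n) (ho : src ≠ .o)
    (l : List (CertSym L R)) (k : ℕ) (s : Store Reg (InSym Γ L R)) (hs : s src = l.map ce)
    (hk : s .n = List.replicate k sep) :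
    Runs (.loop .n fun _ => .cases src (.push .o (sy (some nl))) (readSym nl)) s
      (update (update (update s .n []) src ((readN nl l k).2.map ce)) .o
        (((readN nl l k).1.map sy).reverse ++ s .o)) (5 * (readN nl l k).1.length + 1) := by
  have hn' := hn.symm
  have ho' := ho.symm
  fun_induction readN nl l k generalizing s with
  | case1 l =>
    refine (Runs.loop_nil (by simpa using hk)).congr ?_ (by simp)
    funext j
    simp only [Function.update_apply]
    split_ifs <;> simp_all
  | case2 n => exact readTree_loop_runs_nil nl src hn ho (n + 1) s hs hk
  | case3 l n ih =>
    rw [List.replicate_succ] at hk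
    rw [List.map_cons] at hs
    refine (Runs.loop_cons hk (Runs.cases_cons (by simpa [hn] using hs)
      (Runs.seq .push (Runs.seq .push .push)))
      (ih _ (by simp [hn, ho]) (by simp [List.replicate_succ, hn']))).congr ?_ (by simp; omega)
    funext j
    simp only [Function.update_apply]
    split_ifs <;> simp_all
  | case4 c l n ih =>
    rw [List.replicate_succ] at hk
    rw [List.map_cons] at hs
    have hp : Runs (.push .o (sy (some c)))
      (update (update s .n (List.replicate n sep)) src (l.map ce))
      (update (update (update s .n (List.replicate n sep)) src (l.map ce)) .o
        (sy (some c) :: s .o)) 1 := Runs.push.congr (by simp [ho']) le_rfl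
    refine (Runs.loop_cons (b := 1 + 1) (b' := 5 * (readN nl l n).1.length + 1) hk
      (Runs.cases_cons (c := readSym nl) (a := ce (.inl (some c))) (b := 1)
        (by simpa [hn] using hs) hp)
      (ih (update (update (update s .n (List.replicate n sep)) src (l.map ce)) .o
        (sy (some c) :: s .o)) (by simp [ho]) (by simp [hn']))).congr ?_ (by simp; omega)
    funext j
    simp only [Function.update_apply]
    split_ifs <;> simp_all
  | case5 c l n ih =>
    rw [List.replicate_succ] at hk
    rw [List.map_cons] at hs
    have hp : Runs (.push .o (sy (some nl)))
        (update (update s .n (List.replicate n sep)) src (l.map ce))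
      _ 1 := Runs.push
    refine (Runs.loop_cons hk (Runs.cases_cons (a := ce (.inr c)) (b := 1)
      (by simpa [hn] using hs) hp)
      (ih _ (by simp [ho]) (by simp [hn']))).congr ?_ (by simp; omega)
    funext j
    simp only [Function.update_apply]
    split_ifs <;> simp_all

theorem readTree_runs (nl : L) {src dst : Reg} (hn : src ≠ .n) (ho : src ≠ .o) (hsd : src ≠ dst)
    (hn' : dst ≠ .n) (ho' : dst ≠ .o) (l : List (CertSym L R)) (s : Store Reg (InSym Γ L R))
    (hs : s src = l.map ce) (hk : s .n = []) (ho0 : s .o = []) (hd : s dst = []) :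
    Runs (readTree nl src dst) s
      (update (update s src ((readN nl l 1).2.map ce)) dst ((readN nl l 1).1.map sy))
      (14 * l.length + 10) := by
  refine (Runs.seq .push (Runs.seq (readTree_loop_runs nl src hn ho l 1 _
    (by simpa [hn] using hs) (by simp [hk])) (Prog.move_runs ho'.symm _))).congr ?_ ?_
  · funext j
    simp only [Function.update_apply]
    split_ifs <;> simp_all
  · have := length_readN nl l 1
    simp [ho0]
    omega

/-! #### Instantiating patterns and looking up facts -/

/-- Push the instance of a pattern under the current values of the variables onto `dst`. -/
def build (dst : Reg) : Pat L → Prog Reg (InSym Γ L R)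
  | .var i => .seq (Prog.move (.v i) .t) (Prog.dup .t (.v i) dst)
  | .leaf c => .push dst (sy (some c))
  | .node p q => .seq (build dst q) (.seq (build dst p) (.push dst (sy none)))

/-- `build` leaves the variables unchanged. -/
theorem build_runs {dst : Reg} (hd : ∀ i, dst ≠ .v i) (hdt : dst ≠ .t)
    (v : Fin numVars → List (Option L)) (M : ℕ) (hM : ∀ i, (v i).length ≤ M) (p : Pat L)
    (s : Store Reg (InSym Γ L R)) (hv : ∀ i, s (.v i) = (v i).map sy) (ht : s .t = []) :
    Runs (build dst p) s (update s dst ((p.substStr v).map sy ++ s dst))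
      (p.weight * (5 * M + 2)) := by
  induction p generalizing s with
  | var i =>
    refine (Runs.seq (Prog.move_runs (by simp) s)
      (Prog.dup_runs (by simp) hdt.symm (hd i).symm _)).congr ?_ ?_
    · have := hd i
      funext j
      simp only [Function.update_apply, Pat.substStr]
      split_ifs <;> simp_all
    · have := hM i
      simp [hv, ht, Pat.weight]
      omega
  | leaf c =>
    exact Runs.push.congr (by simp [Pat.substStr]) (by simp [Pat.weight])
  | node p q hp hq =>
    have h1 := fun i => (hd i).symm
    have h2 := hdt.symm
    refine (Runs.seq (hq s hv ht) (Runs.seq (hp _ (fun i => by simp [h1 i, hv])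
      (by simp [h2, ht])) .push)).congr ?_ ?_
    · simp [Pat.substStr]
    · simp only [Pat.weight, add_mul]; omega

variable [DecidableEq Γ] [DecidableEq L] [DecidableEq R]

/-- Compare a symbol of a fact with the next symbol of `p`; differences are noted on `m`, and the
symbols of `p` are kept on `q`. -/
def compareStep (c : InSym Γ L R) : Prog Reg (InSym Γ L R) :=
  .cases .p (.push .m c) fun d => .seq (.push .q d) (if d = c then .skip else .push .m c)

/-- At the end of a fact: note success on `e`, and restore `p`. -/
def compareEnd : Prog Reg (InSym Γ L R) :=
  .seq (.cases .p (.cases .m (.push .e sep) fun _ => .skip) fun d => .push .p d)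
    (.seq (Prog.clear .m) (Prog.move .q .p))

/-- Compare the string on `p` with all facts on `f`, moving these to `g`. -/
def searchLoop : Prog Reg (InSym Γ L R) :=
  .loop .f fun c => .seq (.push .g c) (if c = sep then compareEnd else compareStep c)

/-- Test whether the string on `p` is a fact; if it is not, note this on `b`. -/
def lookup : Prog Reg (InSym Γ L R) :=
  .seq searchLoop (.seq (Prog.move .g .f) (.seq (.cases .e (.push .b sep) fun _ => Prog.clear .e)
    (Prog.clear .p)))

theorem compareStep_runs (c : InSym Γ L R) (s : Store Reg (InSym Γ L R)) :
    ∃ p q m : List (InSym Γ L R), q.reverse ++ p = (s .q).reverse ++ s .p ∧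
      m.length ≤ (s .m).length + 1 ∧
      (∀ w : List (InSym Γ L R), m = [] ∧ w = p ↔ s .m = [] ∧ c :: w = s .p) ∧
      Runs (compareStep c) s (update (update (update s .p p) .q q) .m m) 3 := by
  rcases hp : s .p with - | ⟨d, p⟩
  · refine ⟨[], s .q, c :: s .m, by simp, by simp, by simp, ?_⟩
    refine (Runs.cases_nil hp .push).congr ?_ (by simp)
    funext j
    cases j <;> simp [hp]
  · by_cases hd : d = c
    · subst hd
      refine ⟨p, d :: s .q, s .m, by simp, by simp, by simp, ?_⟩
      refine Runs.cases_cons (b := 1 + 1) hp (Runs.seq .push ?_)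
      rw [if_pos rfl]
      refine Runs.skip.congr ?_ le_rfl
      funext j
      cases j <;> simp
    · refine ⟨p, d :: s .q, c :: s .m, by simp, by simp, fun w => by simp [Ne.symm hd], ?_⟩
      refine Runs.cases_cons (b := 1 + 1) hp (Runs.seq .push ?_)
      rw [if_neg hd]
      refine Runs.push.congr ?_ le_rfl
      funext j
      cases j <;> simp

/-- Comparing `p` with the first fact on `f`, symbol by symbol. -/
theorem compare_runs (w : List (Option L)) (s : Store Reg (InSym Γ L R)) (l : List (InSym Γ L R))
    (hf : s .f = w.map sy ++ l) (s' : Store Reg (InSym Γ L R)) (b : ℕ)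
    (hrest : ∀ p q m : List (InSym Γ L R), q.reverse ++ p = (s .q).reverse ++ s .p →
      m.length ≤ (s .m).length + w.length →
      (p = [] ∧ m = [] ↔ s .m = [] ∧ w.map sy = s .p) →
      Runs searchLoop (update (update (update (update (update s .f l) .g
        ((w.map sy).reverse ++ s .g)) .p p) .q q) .m m) s' b) :
    Runs searchLoop s s' (5 * w.length + b) := by
  induction w generalizing s with
  | nil =>
    refine Runs.mono (b := b) ?_ (by simp)
    convert hrest (s .p) (s .q) (s .m) rfl (by simp) (by simp [eq_comm, and_comm]) using 1
    funext j
    simp only [Function.update_apply]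
    split_ifs <;> simp_all
  | cons c w ih =>
    rw [List.map_cons, List.cons_append] at hf
    obtain ⟨p, q, m, h1, h2, h3, h4⟩ := compareStep_runs (sy c)
      (update (update s .f (w.map sy ++ l)) .g (sy c :: s .g))
    simp only [ne_eq, reduceCtorEq, not_false_eq_true, Function.update_of_ne] at h1 h2 h3
    rw [show compareStep (sy c) = if (sy c : InSym Γ L R) = sep then compareEnd else
      compareStep (sy c) from (if_neg (sy_ne_sep c)).symm] at h4
    have h5 := Runs.seq ((Runs.push (s := update s .f (w.map sy ++ l)) (k := .g)
      (a := (sy c : InSym Γ L R))).congr (by simp) le_rfl) h4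
    refine (Runs.loop_cons hf h5 (ih _ (by simp) ?_)).mono (by simp; omega)
    intro p' q' m' h1' h2' h3'
    simp only [ne_eq, reduceCtorEq, not_false_eq_true, Function.update_of_ne,
      Function.update_self] at h1' h2' h3'
    have := hrest p' q' m' (h1'.trans h1) (by simp; omega)
      (h3'.trans ((h3 _).trans (by simp)))
    convert this using 1
    clear this h1' h2' h3' h3 h4 h5 ih hrest
    funext j
    cases j <;> simp

omit [DecidableEq Γ] [DecidableEq L] [DecidableEq R] in
theorem compareEnd_runs (s : Store Reg (InSym Γ L R)) :
    Runs compareEnd s (update (update (update (update s .m []) .q []) .p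
        ((s .q).reverse ++ s .p)) .e (if s .p = [] ∧ s .m = [] then sep :: s .e else s .e))
      (2 * (s .m).length + 2 * (s .q).length + 5) := by
  rcases hp : s .p with - | ⟨d, p⟩
  · rcases hm : s .m with - | ⟨c, m⟩
    · refine (Runs.seq (Runs.cases_nil hp (Runs.cases_nil hm .push)) (Runs.seq
        (Prog.clear_runs _ _) (Prog.move_runs (by simp) _))).congr ?_ ?_
      · funext j
        simp only [Function.update_apply]
        split_ifs <;> simp_all
      · simp [hm]; omega
    · refine (Runs.seq (Runs.cases_nil hp (Runs.cases_cons hm .skip)) (Runs.seq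
        (Prog.clear_runs _ _) (Prog.move_runs (by simp) _))).congr ?_ ?_
      · funext j
        simp only [Function.update_apply]
        split_ifs <;> simp_all
      · simp; omega
  · refine (Runs.seq (Runs.cases_cons hp .push) (Runs.seq
        (Prog.clear_runs _ _) (Prog.move_runs (by simp) _))).congr ?_ ?_
    · funext j
      simp only [Function.update_apply]
      split_ifs <;> simp_all
    · simp; omega

end

/-! ### Correctness of the verifier -/

section

variable {Γ L R : Type} [DecidableEq Γ] [DecidableEq L] [DecidableEq R]

omit [DecidableEq Γ] [DecidableEq L] [DecidableEq R] in
theorem length_facts_cons (w : List (Option L)) (ws : List (List (Option L))) :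
    (facts (w :: ws) : List (InSym Γ L R)).length =
      w.length + 1 + (facts ws : List (InSym Γ L R)).length := by
  simp [facts]
  omega

omit [DecidableEq Γ] [DecidableEq L] [DecidableEq R] in
theorem length_le_length_facts (ws : List (List (Option L))) :
    ws.length ≤ (facts ws : List (InSym Γ L R)).length := by
  induction ws with
  | nil => simp
  | cons w ws ih => rw [length_facts_cons, List.length_cons]; omega

/-- The stack `e` is nonempty at the end if and only if it was at the start or the string on `p` is
among the facts; the facts end up on `g` in reverse order. -/
theorem searchLoop_runs (w₀ : List (Option L)) (ws : List (List (Option L)))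
    (s : Store Reg (InSym Γ L R)) (hf : s .f = facts ws) (hp : s .p = w₀.map sy)
    (hq : s .q = []) (hm : s .m = []) :
    ∃ e : List (InSym Γ L R), (e = [] ↔ s .e = [] ∧ w₀ ∉ ws) ∧
      e.length ≤ (s .e).length + ws.length ∧
      Runs searchLoop s (update (update (update s .f []) .g ((facts ws).reverse ++ s .g)) .e e)
        ((8 + 2 * w₀.length) * (facts ws : List (InSym Γ L R)).length + 1) := by
  induction ws generalizing s with
  | nil =>
    refine ⟨s .e, by simp, by simp, (Runs.loop_nil hf).congr ?_ (by simp)⟩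
    have hf : s .f = [] := hf
    funext j
    cases j <;> simp [hf, facts]
  | cons w ws ih =>
    have hf' : s .f = w.map sy ++ (sep :: facts ws) := by simp [hf, facts]
    obtain ⟨e, h1, h2, h3⟩ := ih (update (update (update s .f (facts ws)) .g
      (sep :: ((w.map sy).reverse ++ s .g))) .e (if w = w₀ then sep :: s .e else s .e))
      (by simp) (by simp [hp]) (by simp [hq]) (by simp [hm])
    refine ⟨e, h1.trans ?_, h2.trans ?_, ?_⟩
    · by_cases h : w = w₀
      · simp [h]
      · simp [h, Ne.symm h]
    · simp only [Function.update_self, List.length_cons]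
      split_ifs <;> simp; all_goals omega
    · refine (compare_runs w s _ hf' _ (2 * w.length + 2 * w₀.length + 8 +
        ((8 + 2 * w₀.length) * (facts ws : List (InSym Γ L R)).length + 1)) ?_).mono ?_
      · intro p q m h4 h5 h6
        rw [hq, hp] at h4
        rw [hm] at h5 h6
        have hlq : q.length ≤ w₀.length := by
          have := congrArg List.length h4
          simp at this; omega
        have hmw : (p = [] ∧ m = []) ↔ w = w₀ := by
          rw [h6, hp, List.map_inj_right (fun _ _ h => sy_injective h)]
          simp
        refine (Runs.loop_cons (l := facts ws) (a := sep) (by simp)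
          (Runs.seq .push (b' := 2 * w.length + 2 * w₀.length + 5) ?_) h3).congr ?_ ?_
        · rw [if_pos rfl]
          refine (compareEnd_runs _).congr ?_ (by simp at h5 ⊢; omega)
          funext j
          simp only [List.nil_append, List.reverse_nil] at h4
          cases j <;> simp [h4, hp, hq, hm, hmw]
        · funext j
          cases j <;> simp [facts]
        · omega
      · rw [length_facts_cons]
        nlinarith

theorem lookup_runs (w₀ : List (Option L)) (ws : List (List (Option L)))
    (s : Store Reg (InSym Γ L R)) (hf : s .f = facts ws) (hp : s .p = w₀.map sy)
    (hq : s .q = []) (hm : s .m = []) (hg : s .g = []) (he : s .e = []) :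
    Runs lookup s (update (update s .p []) .b (if w₀ ∈ ws then s .b else sep :: s .b))
      ((14 + 2 * w₀.length) * ((facts ws : List (InSym Γ L R)).length + 1)) := by
  obtain ⟨e, h1, h2, h3⟩ := searchLoop_runs w₀ ws s hf hp hq hm
  rw [he] at h1 h2
  have hlen := length_le_length_facts (Γ := Γ) (R := R) ws
  simp at h1
  have hfinal : Runs (.cases .e (.push .b sep) fun _ => Prog.clear .e)
      (update s .e e) (update s .b (if w₀ ∈ ws then s .b else sep :: s .b))
      (2 * (facts ws : List (InSym Γ L R)).length + 2) := by
    rcases e with - | ⟨c, e⟩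
    · have hw : w₀ ∉ ws := h1.1 rfl
      refine (Runs.cases_nil (by simp) .push).congr ?_ (by omega)
      funext j
      cases j <;> simp [hw, he]
    · have hw : w₀ ∈ ws := by
        by_contra h; exact absurd (h1.2 h) (List.cons_ne_nil _ _)
      refine (Runs.cases_cons (k := Reg.e) (a := c) (l := e) (c := fun _ => Prog.clear .e)
        (by simp) (Prog.clear_runs _ _)).congr ?_ ?_
      · funext j
        cases j <;> simp [hw, he]
      · simp at h2 ⊢; omega
  refine (Runs.seq h3 (Runs.seq ((Prog.move_runs (by simp) _).congr ?_ le_rfl)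
    (Runs.seq hfinal (Prog.clear_runs _ _)))).congr ?_ ?_
  · funext j
    cases j <;> simp [hf, hg]
  · funext j
    cases j <;> simp
  · simp [hp, hg]
    nlinarith

/-! #### Processing a line -/

/-- Check a list of premises. -/
def checkPrems : List (Pat L) → Prog Reg (InSym Γ L R)
  | [] => .skip
  | p :: ps => .seq (build .p p) (.seq lookup (checkPrems ps))

/-- The total weight of a list of patterns. -/
def weights (ps : List (Pat L)) : ℕ := (ps.map Pat.weight).sum

/-- The stack `b` is empty as long as no premise has been missing. -/
theorem checkPrems_runs (x u : List (InSym Γ L R)) (z : List (CertSym L R))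
    (v : Fin numVars → List (Option L)) (ws : List (List (Option L))) (M F : ℕ)
    (hM : ∀ i, (v i).length ≤ M) (hF : (facts ws : List (InSym Γ L R)).length ≤ F)
    (ps : List (Pat L)) (b : List (InSym Γ L R)) :
    ∃ b' : List (InSym Γ L R), (b' = [] ↔ b = [] ∧ ∀ p ∈ ps, p.substStr v ∈ ws) ∧
      b'.length ≤ b.length + ps.length ∧
      Runs (checkPrems ps) (mainStore x u z v ws b) (mainStore x u z v ws b')
        (weights ps * (25 * (M + 1) * (F + 1)) + 1) := by
  induction ps generalizing b with
  | nil => exact ⟨b, by simp, by simp, Runs.skip.mono (by simp [weights])⟩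
  | cons p ps ih =>
    obtain ⟨b', h1, h2, h3⟩ := ih (if p.substStr v ∈ ws then b else sep :: b)
    refine ⟨b', h1.trans ?_, h2.trans ?_, ?_⟩
    · by_cases h : p.substStr v ∈ ws <;> simp [h]
    · split_ifs <;> simp; omega
    · refine (Runs.seq (build_runs (by simp) (by simp) v M hM p _ (fun i => rfl) rfl)
        (Runs.seq ((lookup_runs (p.substStr v) ws _ rfl (by simp [mainStore]) rfl rfl rfl rfl).congr
          ?_ le_rfl) h3)).mono ?_
      · funext j
        cases j <;> simp [mainStore]
      · have hl := Pat.length_substStr_le v M hM p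
        have hw : 1 ≤ p.weight := by cases p <;> simp [Pat.weight]
        simp only [weights, List.map_cons, List.sum_cons]
        have e1 : (14 + 2 * (p.substStr v).length) *
            ((facts ws : List (InSym Γ L R)).length + 1) ≤
            (14 * (p.weight * (M + 1)) + 2 * (p.weight * (M + 1))) * (F + 1) := by
          refine Nat.mul_le_mul ?_ (by omega)
          have : 1 ≤ p.weight * (M + 1) := Nat.one_le_iff_ne_zero.2 (by positivity)
          omega
        have e2 : p.weight * (5 * M + 2) ≤ 5 * (p.weight * (M + 1)) * (F + 1) := by
          have : p.weight * (5 * M + 2) ≤ 5 * (p.weight * (M + 1)) := by nlinarith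
          exact this.trans (Nat.le_mul_of_pos_right _ (by omega))
        have e3 : (p.weight + (List.map Pat.weight ps).sum) * (25 * (M + 1) * (F + 1)) =
            25 * (p.weight * (M + 1)) * (F + 1) +
            (List.map Pat.weight ps).sum * (25 * (M + 1) * (F + 1)) := by ring
        rw [e3]
        have e4 : 25 * (p.weight * (M + 1)) * (F + 1) = 5 * (p.weight * (M + 1)) * (F + 1) +
            (14 * (p.weight * (M + 1)) + 2 * (p.weight * (M + 1))) * (F + 1) +
            4 * (p.weight * (M + 1)) * (F + 1) := by ring
        omega

/-- Read the values of a list of variables. -/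
def readVarsProg (nl : L) : List (Fin numVars) → Prog Reg (InSym Γ L R)
  | [] => .skip
  | i :: is => .seq (readTree nl .z (.v i)) (readVarsProg nl is)

omit [DecidableEq Γ] [DecidableEq L] [DecidableEq R] in
theorem readVarsProg_runs (nl : L) (x u : List (InSym Γ L R)) (ws : List (List (Option L)))
    (b : List (InSym Γ L R)) (is : List (Fin numVars)) (his : is.Nodup) (l : List (CertSym L R))
    (v : Fin numVars → List (Option L)) (hv : ∀ i ∈ is, v i = []) :
    Runs (readVarsProg nl is) (mainStore x u l v ws b)
      (mainStore x u (readVars nl is l v).1 (readVars nl is l v).2 ws b)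
      (is.length * (14 * l.length + 10) + 1) := by
  induction is generalizing l v with
  | nil => exact Runs.skip.mono (by simp)
  | cons i is ih =>
    rw [List.nodup_cons] at his
    have hle := readVars_rest_length_le nl [i] l v
    simp only [readVars] at hle
    refine (Runs.seq ((readTree_runs nl (by simp) (by simp) (by simp) (by simp) (by simp) l _
      rfl rfl rfl (by simp [mainStore, hv])).congr ?_ le_rfl)
      (ih his.2 (readN nl l 1).2 (update v i (readN nl l 1).1) fun j hj => ?_)).mono ?_
    · funext j
      cases j with
      | v j =>
        by_cases h : j = i
        · subst h; simp [mainStore]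
        · simp [mainStore, h]
      | _ => simp [mainStore]
    · have : j ≠ i := fun h => his.1 (h ▸ hj)
      simp [this, hv j (List.mem_cons_of_mem _ hj)]
    · rw [List.length_cons, add_mul]
      have : is.length * (14 * (readN nl l 1).2.length + 10) ≤ is.length * (14 * l.length + 10) :=
        Nat.mul_le_mul le_rfl (by omega)
      omega

/-- Empty the stacks of a list of variables. -/
def clearVars : List (Fin numVars) → Prog Reg (InSym Γ L R)
  | [] => .skip
  | i :: is => .seq (Prog.clear (.v i)) (clearVars is)

omit [DecidableEq Γ] [DecidableEq L] [DecidableEq R] in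
theorem clearVars_runs (is : List (Fin numVars)) (x u : List (InSym Γ L R))
    (z : List (CertSym L R)) (v : Fin numVars → List (Option L)) (ws : List (List (Option L)))
    (b : List (InSym Γ L R)) (M : ℕ) (hM : ∀ i, (v i).length ≤ M) :
    Runs (clearVars is) (mainStore x u z v ws b)
      (mainStore x u z (fun i => if i ∈ is then [] else v i) ws b)
      (is.length * (2 * M + 1) + 1) := by
  induction is generalizing v with
  | nil => exact Runs.skip.congr (by simp) (by simp)
  | cons i is ih =>
    refine (Runs.seq ((Prog.clear_runs _ _).congr (s'' := mainStore x u z (update v i []) ws b)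
      ?_ le_rfl) (ih (update v i []) fun j => ?_)).congr ?_ ?_
    · funext j
      cases j with
      | v j =>
        by_cases h : j = i
        · subst h; simp [mainStore]
        · simp [mainStore, h]
      | _ => simp [mainStore]
    · by_cases h : j = i
      · subst h; simp
      · simpa [h] using hM j
    · congr 1
      funext j
      by_cases h : j = i
      · subst h; simp
      · simp [h]
    · have := hM i
      rw [List.length_cons, add_mul]
      simp [mainStore]
      omega

/-- Process a line that uses the given clause. -/
def lineProg (nl : L) (c : Clause L) : Prog Reg (InSym Γ L R) :=
  .seq (readVarsProg nl (List.finRange numVars)) (.seq (checkPrems c.prems)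
    (.seq (.push .f sep) (.seq (build .f c.concl) (clearVars (List.finRange numVars)))))

theorem lineProg_runs (nl : L) (c : Clause L) (x u : List (InSym Γ L R))
    (ws : List (List (Option L))) (b : List (InSym Γ L R)) (l : List (CertSym L R)) (M F : ℕ)
    (hM : 2 * l.length + 1 ≤ M) (hF : (facts ws : List (InSym Γ L R)).length ≤ F) :
    ∃ b' : List (InSym Γ L R), (b' = [] ↔ b = [] ∧ ∀ p ∈ c.prems,
        p.substStr (readVars nl (List.finRange numVars) l fun _ => []).2 ∈ ws) ∧
      b'.length ≤ b.length + c.prems.length ∧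
      Runs (lineProg nl c) (mainStore x u l (fun _ => []) ws b)
        (mainStore x u (readVars nl (List.finRange numVars) l fun _ => []).1 (fun _ => [])
          (c.concl.substStr (readVars nl (List.finRange numVars) l fun _ => []).2 :: ws) b')
        ((weights (c.concl :: c.prems) + 20) * (25 * (M + 1) * (F + 1))) := by
  have hv := length_readVars_le nl (List.finRange numVars) l (fun _ => []) M hM (by simp)
  obtain ⟨b', h1, h2, h3⟩ := checkPrems_runs x u
    (readVars nl (List.finRange numVars) l fun _ => []).1 _ ws M F hv hF c.prems b
  refine ⟨b', h1, h2, ?_⟩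
  refine (Runs.seq (readVarsProg_runs nl x u ws b _ (List.nodup_finRange _) l _ (by simp))
    (Runs.seq h3 (Runs.seq .push (Runs.seq ((build_runs (by simp) (by simp) _ M hv c.concl _
      (fun i => ?_) ?_).congr ?_ le_rfl) (clearVars_runs _ x u
        (readVars nl (List.finRange numVars) l fun _ => []).1 _
        (c.concl.substStr (readVars nl (List.finRange numVars) l fun _ => []).2 :: ws) b' M
        hv))))).congr ?_ ?_
  · simp [mainStore]
  · simp [mainStore]
  · funext j
    cases j <;> simp [mainStore, facts]
  · congr 1
    funext i
    simp
  · simp only [List.length_finRange, weights, List.map_cons, List.sum_cons]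
    have e0 : M + 1 ≤ (M + 1) * (F + 1) := Nat.le_mul_of_pos_right _ (by omega)
    have e1 : c.concl.weight * (5 * M + 2) ≤ 5 * (c.concl.weight * ((M + 1) * (F + 1))) := by
      have : 5 * M + 2 ≤ 5 * ((M + 1) * (F + 1)) := by omega
      calc _ ≤ c.concl.weight * (5 * ((M + 1) * (F + 1))) := Nat.mul_le_mul le_rfl this
        _ = _ := by ring
    have e2 : (c.concl.weight + (List.map Pat.weight c.prems).sum + 20) *
        (25 * (M + 1) * (F + 1)) = 25 * (c.concl.weight * ((M + 1) * (F + 1))) +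
        (List.map Pat.weight c.prems).sum * (25 * (M + 1) * (F + 1)) +
        500 * ((M + 1) * (F + 1)) := by ring
    rw [e2]
    have e3 : 12 * (14 * l.length + 10) ≤ 120 * (M + 1) := by omega
    have : numVars = 12 := rfl
    rw [this]
    omega

/-! #### The main loop -/

/-- Process the line that begins with the given symbol, if it is the name of a clause. -/
def mainStep (nl : L) (rules : R → Clause L) : InSym Γ L R → Prog Reg (InSym Γ L R)
  | .inr (.inl (.inr r)) => lineProg nl (rules r)
  | _ => .skip

/-- Process all lines of the certificate. -/
def mainLoop (nl : L) (rules : R → Clause L) : Prog Reg (InSym Γ L R) :=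
  .loop .z (mainStep nl rules)

/-- The main loop computes `scan`. The bound `F` holds for the total length of the facts during all
of the remaining lines, each of which adds one instance of the conclusion of a clause. -/
theorem mainLoop_runs (nl : L) (rules : R → Clause L) (x u : List (InSym Γ L R)) (M F W : ℕ)
    (hW : ∀ r, weights ((rules r).concl :: (rules r).prems) ≤ W)
    (k : ℕ) (l : List (CertSym L R)) (ws : List (List (Option L))) (b : List (InSym Γ L R))
    (bad : Bool) (hb : b = [] ↔ bad = false) (hk : l.length ≤ k) (hM : 2 * l.length + 1 ≤ M)
    (hF : (facts ws : List (InSym Γ L R)).length + k * (W * (M + 1) + 1) ≤ F) :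
    ∃ b' : List (InSym Γ L R), (b' = [] ↔ (scan nl rules k l ws bad).2 = false) ∧
      b'.length ≤ b.length + k * W ∧
      (facts (scan nl rules k l ws bad).1 : List (InSym Γ L R)).length ≤ F ∧
      Runs (mainLoop nl rules) (mainStore x u l (fun _ => []) ws b)
        (mainStore x u [] (fun _ => []) (scan nl rules k l ws bad).1 b')
        (k * ((W + 20) * (25 * (M + 1) * (F + 1)) + 1) + 1) := by
  induction k generalizing l ws b bad with
  | zero =>
    obtain rfl : l = [] := List.eq_nil_of_length_eq_zero (by omega)
    exact ⟨b, hb, by simp, by simp [scan]; omega, (Runs.loop_nil rfl).mono (by simp)⟩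
  | succ k ih =>
    have hpos : 1 ≤ (W + 20) * (25 * (M + 1) * (F + 1)) :=
      Nat.one_le_iff_ne_zero.2 (by positivity)
    rw [Nat.add_mul k 1 (W * (M + 1) + 1)] at hF
    rcases l with - | ⟨c | r, l⟩
    · exact ⟨b, hb, by simp, by simp [scan]; omega, (Runs.loop_nil rfl).mono (by simp)⟩
    · rw [List.length_cons] at hk hM
      obtain ⟨b', h1, h2, h3, h4⟩ := ih l ws b bad hb (by omega) (by omega) (by omega)
      refine ⟨b', h1, by rw [Nat.add_mul k 1 W]; omega, h3, ?_⟩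
      refine (Runs.loop_cons (k := Reg.z) (c := mainStep nl rules)
        (a := ce (.inl c)) (l := l.map ce) rfl
        (Runs.skip.congr (s'' := mainStore x u l (fun _ => []) ws b) ?_ le_rfl) h4).mono ?_
      · funext j
        cases j <;> simp [mainStore]
      · rw [Nat.add_mul k 1 ((W + 20) * (25 * (M + 1) * (F + 1)) + 1)]; omega
    · rw [List.length_cons] at hk hM
      obtain ⟨b₁, g1, g2, g3⟩ := lineProg_runs nl (rules r) x u ws b l M F (by omega) (by omega)
      have hv := length_readVars_le nl (List.finRange numVars) l (fun _ => []) M (by omega)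
        (by simp)
      have hr := readVars_rest_length_le nl (List.finRange numVars) l (fun _ => [])
      have hc := Pat.length_substStr_le _ M hv (rules r).concl
      have hWr := hW r
      have hpl : (rules r).prems.length ≤ W := by
        refine le_trans ?_ hWr
        simp only [weights, List.map_cons, List.sum_cons]
        have : ∀ ps : List (Pat L), ps.length ≤ (ps.map Pat.weight).sum := fun ps => by
          induction ps with
          | nil => simp
          | cons p ps ih =>
            have hw : 1 ≤ p.weight := by cases p <;> simp [Pat.weight]
            simp; omega
        have := this (rules r).prems
        omega
      have hcw : (rules r).concl.weight * (M + 1) ≤ W * (M + 1) := by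
        refine Nat.mul_le_mul ?_ le_rfl
        simp only [weights, List.map_cons, List.sum_cons] at hWr
        omega
      obtain ⟨b', h1, h2, h3, h4⟩ := ih (readVars nl (List.finRange numVars) l fun _ => []).1
        ((rules r).concl.substStr (readVars nl (List.finRange numVars) l fun _ => []).2 :: ws) b₁
        (bad || (rules r).prems.any fun p =>
          decide (p.substStr (readVars nl (List.finRange numVars) l fun _ => []).2 ∉ ws))
        (by simp [g1, hb]) (by omega) (by omega) (by rw [length_facts_cons]; omega)
      refine ⟨b', h1, by rw [Nat.add_mul k 1 W]; omega, h3, ?_⟩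
      refine (Runs.loop_cons (k := Reg.z) (c := mainStep nl rules)
        (a := ce (.inr r)) (l := l.map ce) rfl
        (b := (W + 20) * (25 * (M + 1) * (F + 1))) ?_ h4).mono ?_
      · refine Runs.mono (b := (weights ((rules r).concl :: (rules r).prems) + 20) *
          (25 * (M + 1) * (F + 1))) ?_ (Nat.mul_le_mul (by omega) le_rfl)
        convert g3 using 1
        · rfl
        funext j
        cases j <;> simp [mainStore]
      · rw [Nat.add_mul k 1 ((W + 20) * (25 * (M + 1) * (F + 1)) + 1)]; omega

end

/-! ### Preparing the stacks -/

section

variable {Γ L R : Type}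

/-- The stores that occur before the certificate is processed. -/
def preStore (inp x u y z o t q m : List (InSym Γ L R)) : Store Reg (InSym Γ L R)
  | .inp => inp
  | .x => x
  | .u => u
  | .y => y
  | .z => z
  | .o => o
  | .t => t
  | .q => q
  | .m => m
  | _ => []

/-- Put an input symbol on the stack `u`, `o` or `t`, depending on the part it belongs to. -/
def splitStep : InSym Γ L R → Prog Reg (InSym Γ L R)
  | .inl c => .push .u (.inl c)
  | .inr (.inl d) => .push .o (ce d)
  | .inr (.inr d) => .push .t (ce d)

/-- Distribute the three parts of the input to the stacks `u`, `o`, `t`. -/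
def splitInput : Prog Reg (InSym Γ L R) := .loop .inp splitStep

/-- The three parts of the input, each in reverse order. -/
theorem splitInput_runs (l u o t : List (InSym Γ L R)) :
    Runs splitInput (preStore l [] u [] [] o t [] [])
      (preStore [] [] (((l.filterMap Sum.getLeft?).map .inl).reverse ++ u) [] []
        (((l.filterMap fun c => c.getRight?.bind Sum.getLeft?).map ce).reverse ++ o)
        (((l.filterMap fun c => c.getRight?.bind Sum.getRight?).map ce).reverse ++ t) [] [])
      (2 * l.length + 1) := by
  induction l generalizing u o t with
  | nil => exact (Runs.loop_nil rfl).congr (by simp) (by simp)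
  | cons c l ih =>
    have hstep : ∀ u' o' t', update (update (preStore (c :: l) [] u [] [] o t [] []) .inp l)
          (match c with | .inl _ => .u | .inr (.inl _) => .o | .inr (.inr _) => .t)
          (match c with
            | .inl c => .inl c :: u
            | .inr (.inl d) => ce d :: o
            | .inr (.inr d) => ce d :: t) = preStore l [] u' [] [] o' t' [] [] →
        Runs (splitStep c) (update (preStore (c :: l) [] u [] [] o t [] []) .inp l)
          (preStore l [] u' [] [] o' t' [] []) 1 := fun u' o' t' h => by
      rcases c with c | d | d <;> exact Runs.push.congr h le_rfl
    rcases c with c | d | d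
    · refine (Runs.loop_cons (k := Reg.inp) (c := splitStep) rfl
        (hstep (.inl c :: u) o t ?_) (ih _ _ _)).congr
          (by simp [List.filterMap_cons]) (by simp; omega)
      funext j
      cases j <;> simp [preStore]
    · refine (Runs.loop_cons (k := Reg.inp) (c := splitStep) rfl
        (hstep u (ce d :: o) t ?_) (ih _ _ _)).congr
          (by simp [List.filterMap_cons]) (by simp; omega)
      funext j
      cases j <;> simp [preStore]
    · refine (Runs.loop_cons (k := Reg.inp) (c := splitStep) rfl
        (hstep u o (ce d :: t) ?_) (ih _ _ _)).congr
          (by simp [List.filterMap_cons]) (by simp; omega)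
      funext j
      cases j <;> simp [preStore]

/-- The tree of an input string. -/
def inputTree (nl : L) (tok : Γ → L) (x : List Γ) : LTree L :=
  .list nl (x.map fun c => .leaf (tok c))

theorem size_inputTree (nl : L) (tok : Γ → L) (x : List Γ) :
    (inputTree nl tok x).size = 2 * x.length + 1 := by
  induction x with
  | nil => rfl
  | cons c x ih =>
    have : (inputTree nl tok (c :: x)).size = 1 + (inputTree nl tok x).size + 1 := rfl
    rw [this, ih, List.length_cons]; omega

/-- Write an input symbol as the next entry of a list of leaves, and count it. -/
def writeStep (tok : Γ → L) : InSym Γ L R → Prog Reg (InSym Γ L R)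
  | .inl c => .seq (.push .x (sy (some (tok c)))) (.seq (.push .x (sy none)) (.push .q sep))
  | .inr _ => .skip

/-- Write the tree of the input string, and its length in unary. -/
def writeInput (nl : L) (tok : Γ → L) : Prog Reg (InSym Γ L R) :=
  .seq (.push .x (sy (some nl))) (.loop .u (writeStep tok))

theorem writeInput_loop_runs (nl : L) (tok : Γ → L) (x x' : List Γ) (y z q : List (InSym Γ L R)) :
    Runs (.loop .u (writeStep tok))
      (preStore [] ((inputTree nl tok x').enc.map sy) (x.map .inl) y z [] [] q [])
      (preStore [] ((inputTree nl tok (x.reverse ++ x')).enc.map sy) [] y z [] []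
        (List.replicate x.length sep ++ q) []) (4 * x.length + 1) := by
  induction x generalizing x' q with
  | nil => exact (Runs.loop_nil rfl).congr (by simp) (by simp)
  | cons c x ih =>
    have hstep : Runs (writeStep tok (.inl c))
        (update (preStore [] ((inputTree nl tok x').enc.map sy) ((c :: x).map .inl) y z [] [] q [])
          .u (x.map .inl))
        (preStore [] ((inputTree nl tok (c :: x')).enc.map sy) (x.map .inl) y z [] [] (sep :: q) [])
        (1 + (1 + 1)) := by
      refine (Runs.seq .push (Runs.seq .push .push)).congr ?_ le_rfl
      funext j
      cases j <;> simp [preStore, inputTree, LTree.list, LTree.enc]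
    refine (Runs.loop_cons (k := Reg.u) (c := writeStep tok) rfl hstep
      (ih (c :: x') (sep :: q))).congr ?_ (by simp; omega)
    rw [List.reverse_cons, List.append_assoc, List.length_cons, List.replicate_succ']
    simp

theorem writeInput_runs (nl : L) (tok : Γ → L) (x : List Γ) (y z q : List (InSym Γ L R)) :
    Runs (writeInput nl tok) (preStore [] [] (x.reverse.map .inl) y z [] [] q [])
      (preStore [] ((inputTree nl tok x).enc.map sy) [] y z [] []
        (List.replicate x.length sep ++ q) []) (4 * x.length + 2) := by
  refine (Runs.seq (b := 1) (b' := 4 * x.length + 1) (Runs.push.congr ?_ le_rfl)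
    ((writeInput_loop_runs nl tok x.reverse [] y z q).congr ?_ ?_)).mono (by omega)
  · funext j
    cases j <;> simp [preStore, inputTree, LTree.list, LTree.enc]
  · simp
  · simp

/-- Add the number in unary on `q` to the one on `m`. -/
def addStep : Prog Reg (InSym Γ L R) := .seq (Prog.move .q .g) (Prog.dup .g .q .m)

/-- Multiply the number in unary on `m` by the one on `q`. -/
def mul : Prog Reg (InSym Γ L R) :=
  .seq (Prog.move .m .t) (.loop .t fun _ => addStep)

theorem mul_loop_runs (x y z : List (InSym Γ L R)) (c k m : ℕ) :
    Runs (.loop .t fun _ => addStep)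
      (preStore [] x [] y z [] (List.replicate k sep) (List.replicate c sep)
        (List.replicate m sep))
      (preStore [] x [] y z [] [] (List.replicate c sep) (List.replicate (k * c + m) sep))
      (k * (5 * c + 3) + 1) := by
  induction k generalizing m with
  | zero => exact (Runs.loop_nil rfl).congr (by simp) (by simp)
  | succ k ih =>
    have hstep : Runs addStep (update (preStore [] x [] y z [] (List.replicate (k + 1) sep)
          (List.replicate c sep) (List.replicate m sep)) .t (List.replicate k sep))
        (preStore [] x [] y z [] (List.replicate k sep) (List.replicate c sep)
          (List.replicate (c + m) sep)) (5 * c + 2) := by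
      refine (Runs.seq (Prog.move_runs (by simp) _)
        (Prog.dup_runs (by simp) (by simp) (by simp) _)).congr ?_ ?_
      · funext j
        cases j <;> simp [preStore]
      · simp [preStore]; omega
    refine (Runs.loop_cons (k := Reg.t) (c := fun _ => addStep) rfl hstep (ih (c + m))).congr ?_ ?_
    · rw [show k * c + (c + m) = (k + 1) * c + m by ring]
    · rw [Nat.add_mul k 1 (5 * c + 3)]; omega

/-- Write the `k`-th power of the number on `q` on `m`, in unary. -/
def pow : ℕ → Prog Reg (InSym Γ L R)
  | 0 => .push .m sep
  | k + 1 => .seq (pow k) mul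

theorem pow_runs (x y z : List (InSym Γ L R)) (c k : ℕ) (hc : 1 ≤ c) :
    Runs (pow k) (preStore [] x [] y z [] [] (List.replicate c sep) [])
      (preStore [] x [] y z [] [] (List.replicate c sep) (List.replicate (c ^ k) sep))
      (12 * k * c ^ k + 1) := by
  induction k with
  | zero =>
    refine Runs.push.congr ?_ (by simp)
    funext j
    cases j <;> simp [preStore]
  | succ k ih =>
    refine (Runs.seq ih (Runs.seq ((Prog.move_runs (by simp) _).congr
      (s'' := preStore [] x [] y z [] (List.replicate (c ^ k) sep) (List.replicate c sep)
        (List.replicate 0 sep)) ?_ le_rfl)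
      (mul_loop_runs x y z c (c ^ k) 0))).congr ?_ ?_
    · funext j
      cases j <;> simp [preStore]
    · rw [pow_succ]; simp
    · have h1 : 1 ≤ c ^ k := Nat.one_le_pow _ _ hc
      have h2 : c ^ k ≤ c ^ k * c := Nat.le_mul_of_pos_right _ hc
      have h3 : 12 * k * c ^ k ≤ 12 * k * (c ^ k * c) := Nat.mul_le_mul le_rfl h2
      have h4 : c ^ k * (5 * c + 3) = 5 * (c ^ k * c) + 3 * c ^ k := by ring
      have h5 : 12 * (k + 1) * (c ^ k * c) = 12 * k * (c ^ k * c) + 12 * (c ^ k * c) := by ring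
      simp only [preStore, List.length_replicate]
      rw [pow_succ, h4, h5]
      omega

/-- Replace all symbols other than the mark of an inner node by the leaf `nl`. -/
def normSym (nl : L) : CertSym L R → CertSym L R
  | .inl none => .inl none
  | _ => .inl (some nl)

/-- `normSym` on the symbols of the stacks. -/
def normIn (nl : L) : InSym Γ L R → InSym Γ L R
  | .inr (.inl c) => ce (normSym nl c)
  | c => c

/-- Move a symbol from `y` to `o`, normalizing it. -/
def truncStep (nl : L) : Prog Reg (InSym Γ L R) :=
  .cases .y .skip fun c => .push .o (normIn nl c)

/-- Move as many symbols from `y` to `o` as there are on `m`, normalizing them. -/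
def truncate (nl : L) : Prog Reg (InSym Γ L R) := .loop .m fun _ => truncStep nl

theorem truncate_runs (nl : L) (x z q : List (InSym Γ L R)) (y : List (CertSym L R))
    (o : List (InSym Γ L R)) (m : ℕ) :
    Runs (truncate nl) (preStore [] x [] (y.map ce) z o [] q (List.replicate m sep))
      (preStore [] x [] ((y.drop m).map ce) z ((((y.take m).map (normSym nl)).map ce).reverse ++ o)
        [] q []) (3 * m + 1) := by
  induction m generalizing y o with
  | zero => exact (Runs.loop_nil rfl).congr (by simp) (by simp)
  | succ m ih =>
    rcases y with - | ⟨c, y⟩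
    · have hstep : Runs (truncStep nl) (update (preStore [] x [] (List.map ce []) z o [] q
            (List.replicate (m + 1) sep)) .m (List.replicate m sep))
          (preStore [] x [] [] z o [] q (List.replicate m sep)) 2 := by
        refine Runs.cases_nil rfl (Runs.skip.congr ?_ le_rfl)
        funext j
        cases j <;> simp [preStore]
      exact (Runs.loop_cons (k := Reg.m) (c := fun _ => truncStep nl) rfl hstep
        (ih [] o)).congr (by simp) (by omega)
    · have hstep : Runs (truncStep nl) (update (preStore [] x [] ((c :: y).map ce) z o [] q
            (List.replicate (m + 1) sep)) .m (List.replicate m sep))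
          (preStore [] x [] (y.map ce) z (ce (normSym nl c) :: o) [] q (List.replicate m sep))
          2 := by
        refine Runs.cases_cons (k := Reg.y) (a := ce c) (l := y.map ce)
          (c := fun c => .push .o (normIn nl c)) rfl (Runs.push.congr ?_ le_rfl)
        funext j
        cases j <;> simp [preStore, normIn, ce]
      exact (Runs.loop_cons (k := Reg.m) (c := fun _ => truncStep nl) rfl hstep
        (ih y (ce (normSym nl c) :: o))).congr (by simp) (by omega)

/-- Turn the input into the store from which the certificate is processed. -/
def prepare (nl : L) (tok : Γ → L) (k : ℕ) : Prog Reg (InSym Γ L R) :=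
  .seq splitInput (.seq (Prog.move .t .z) (.seq (Prog.move .o .y) (.seq (.push .q sep)
    (.seq (.push .q sep) (.seq (writeInput nl tok) (.seq (pow k) (.seq (truncate nl)
      (.seq (Prog.clear .q) (.seq (Prog.clear .y) (.seq (Prog.move .o .y)
        (.seq (readTree nl .y .u) (Prog.clear .y))))))))))))

/-- The string of the tree of the universally quantified string. -/
def quantStr (nl : L) (N : ℕ) (y : List (CertSym L R)) : List (Option L) :=
  (readN nl ((y.take N).map (normSym nl)) 1).1

/-- Only the first `(x.length + 2) ^ k` symbols of the quantified string `y` are used, since the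
certificate has to be longer than the tree that is read from `y`, but obeys the same bound. -/
theorem prepare_runs (nl : L) (tok : Γ → L) (k : ℕ) (x : List Γ) (y z : List (CertSym L R)) :
    Runs (prepare nl tok k) (update (fun _ => []) .inp
        (x.map Sum.inl ++ (y.map Sum.inl ++ z.map Sum.inr).map Sum.inr))
      (mainStore ((inputTree nl tok x).enc.map sy)
        ((quantStr nl ((x.length + 2) ^ k) y).map sy) z (fun _ => []) [] [])
      (100 * (x.length + y.length + z.length + 2) + (12 * k + 3) * (x.length + 2) ^ k) := by
  have e0 : (update (fun _ => []) .inp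
      (x.map Sum.inl ++ (y.map Sum.inl ++ z.map Sum.inr).map Sum.inr) :
      Store Reg (InSym Γ L R)) =
      preStore (x.map Sum.inl ++ (y.map Sum.inl ++ z.map Sum.inr).map Sum.inr)
        [] [] [] [] [] [] [] [] := by
    funext j
    cases j <;> simp [preStore]
  rw [e0]
  have h1 := splitInput_runs (R := R) (L := L)
    (x.map Sum.inl ++ (y.map Sum.inl ++ z.map Sum.inr).map Sum.inr : List (InSym Γ L R)) [] [] []
  have hx : (x.map Sum.inl ++ (y.map Sum.inl ++ z.map Sum.inr).map Sum.inr :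
      List (InSym Γ L R)).filterMap Sum.getLeft? = x := by
    simp [List.filterMap_map, Function.comp_def]
  have hy : ((x.map Sum.inl ++ (y.map Sum.inl ++ z.map Sum.inr).map Sum.inr :
      List (InSym Γ L R)).filterMap fun c => c.getRight?.bind Sum.getLeft?) = y := by
    simp [List.filterMap_map, Function.comp_def]
  have hz : ((x.map Sum.inl ++ (y.map Sum.inl ++ z.map Sum.inr).map Sum.inr :
      List (InSym Γ L R)).filterMap fun c => c.getRight?.bind Sum.getRight?) = z := by
    simp [List.filterMap_map, Function.comp_def]
  rw [hx, hy, hz] at h1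
  have h2 : Runs (Prog.move .t .z) (preStore [] [] ((x.map .inl).reverse ++ []) [] []
      ((y.map ce).reverse ++ []) ((z.map ce).reverse ++ []) [] [])
      (preStore [] [] (x.reverse.map .inl) [] (z.map ce) (y.map ce).reverse [] [] [] :
        Store Reg (InSym Γ L R)) (2 * z.length + 1) := by
    refine (Prog.move_runs (by simp) _).congr ?_ (by simp [preStore])
    funext j
    cases j <;> simp [preStore]
  have h3 : Runs (Prog.move .o .y)
      (preStore [] [] (x.reverse.map .inl) [] (z.map ce) (y.map ce).reverse [] [] [])
      (preStore [] [] (x.reverse.map .inl) (y.map ce) (z.map ce) [] [] [] [] :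
        Store Reg (InSym Γ L R)) (2 * y.length + 1) := by
    refine (Prog.move_runs (by simp) _).congr ?_ (by simp [preStore])
    funext j
    cases j <;> simp [preStore]
  have h4 : ∀ q, Runs (.push .q sep)
      (preStore [] [] (x.reverse.map .inl) (y.map ce) (z.map ce) [] [] q [])
      (preStore [] [] (x.reverse.map .inl) (y.map ce) (z.map ce) [] [] (sep :: q) [] :
        Store Reg (InSym Γ L R)) 1 := fun q => by
    refine Runs.push.congr ?_ le_rfl
    funext j
    cases j <;> simp [preStore]
  have h5 := writeInput_runs nl tok x (y.map ce) (z.map ce : List (InSym Γ L R)) [sep, sep]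
  rw [show List.replicate x.length (sep : InSym Γ L R) ++ [sep, sep] =
    List.replicate (x.length + 2) sep from
      (List.replicate_append_replicate (n := x.length) (m := 2))] at h5
  have h6 := pow_runs ((inputTree nl tok x).enc.map sy) (y.map ce)
    (z.map ce : List (InSym Γ L R)) (x.length + 2) k (by omega)
  have h7 := truncate_runs nl ((inputTree nl tok x).enc.map sy)
    (z.map ce : List (InSym Γ L R)) (List.replicate (x.length + 2) sep) y []
    ((x.length + 2) ^ k)
  generalize hN : (x.length + 2) ^ k = N at *
  generalize hX : ((inputTree nl tok x).enc.map sy : List (InSym Γ L R)) = X at *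
  set y' := (y.take N).map (normSym nl)
  have hly : y'.length ≤ y.length := by simp [y']
  have h8 : Runs (Prog.clear .q)
      (preStore [] X [] ((y.drop N).map ce) (z.map ce) ((y'.map ce).reverse ++ []) []
        (List.replicate (x.length + 2) sep) [])
      (preStore [] X [] ((y.drop N).map ce) (z.map ce) (y'.map ce).reverse [] [] [])
      (2 * (x.length + 2) + 1) := by
    refine (Prog.clear_runs _ _).congr ?_ (by simp [preStore])
    funext j
    cases j <;> simp [preStore]
  have h9 : Runs (Prog.clear .y)
      (preStore [] X [] ((y.drop N).map ce) (z.map ce) (y'.map ce).reverse [] [] [])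
      (preStore [] X [] [] (z.map ce) (y'.map ce).reverse [] [] []) (2 * y.length + 1) := by
    refine (Prog.clear_runs _ _).congr ?_ (by simp [preStore])
    funext j
    cases j <;> simp [preStore]
  have h10 : Runs (Prog.move .o .y)
      (preStore [] X [] [] (z.map ce) (y'.map ce).reverse [] [] [])
      (preStore [] X [] (y'.map ce) (z.map ce) [] [] [] []) (2 * y.length + 1) := by
    refine (Prog.move_runs (by simp) _).congr ?_ (by simp [preStore]; omega)
    funext j
    cases j <;> simp [preStore]
  have h11 := (readTree_runs nl (src := .y) (dst := .u) (by simp) (by simp) (by simp) (by simp)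
    (by simp) y' (preStore [] X [] (y'.map ce) (z.map ce) [] [] [] []) rfl rfl rfl rfl).congr
    (s'' := preStore [] X ((readN nl y' 1).1.map sy) ((readN nl y' 1).2.map ce) (z.map ce)
      [] [] [] []) (by funext j; cases j <;> simp [preStore]) le_rfl
  have hr := length_readN nl y' 1
  have h12 : Runs (Prog.clear .y) (preStore [] X ((readN nl y' 1).1.map sy)
      ((readN nl y' 1).2.map ce) (z.map ce) [] [] [] [])
      (mainStore X ((readN nl y' 1).1.map sy) z (fun _ => []) [] []) (2 * (y.length + 1) + 1) := by
    refine (Prog.clear_runs _ _).congr ?_ (by simp [preStore]; omega)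
    funext j
    cases j <;> simp [preStore, mainStore, facts]
  refine (Runs.seq h1 (Runs.seq h2 (Runs.seq h3 (Runs.seq (h4 _) (Runs.seq (h4 _) (Runs.seq h5
    (Runs.seq h6 (Runs.seq h7 (Runs.seq h8 (Runs.seq h9 (Runs.seq h10
      (Runs.seq h11 h12)))))))))))).mono ?_
  have : (12 * k + 3) * N = 12 * k * N + 3 * N := by ring
  simp only [List.length_append, List.length_map]
  rw [this]
  omega

end

/-! ### Languages given by Horn clauses -/

section

variable {Γ L R : Type}

/-- The fact that the verifier looks for: the leaf `g` with the two trees given by the input and by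
the universally quantified string. -/
def goalPat (g : L) : Pat L := .node (.leaf g) (.node (.var 0) (.var 1))

/-- The values of the variables in the goal. -/
def goalStrs (X U : List (Option L)) : Fin numVars → List (Option L) :=
  update (update (fun _ => []) 0 X) 1 U

/-- The test that the verifier performs. -/
def verify [DecidableEq L] (nl : L) (tok : Γ → L) (rules : R → Clause L) (k : ℕ) (g : L)
    (a : List Γ × List (CertSym L R) × List (CertSym L R)) : Bool :=
  !(scan nl rules a.2.2.length a.2.2 [] false).2 &&
    decide ((goalPat g).substStr (goalStrs (inputTree nl tok a.1).enc
      (quantStr nl ((a.1.length + 2) ^ k) a.2.1)) ∈ (scan nl rules a.2.2.length a.2.2 [] false).1)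

variable [DecidableEq Γ] [DecidableEq L] [DecidableEq R]

/-- Look for the goal among the facts proved, and empty the stacks. -/
def finish (g : L) : Prog Reg (InSym Γ L R) :=
  .seq (Prog.move .x .t) (.seq (Prog.move .t (.v 0)) (.seq (Prog.move .u .t)
    (.seq (Prog.move .t (.v 1)) (.seq (build .p (goalPat g)) (.seq lookup
      (.seq (.cases .b (.push .r sep) fun _ => Prog.clear .b) (.seq (Prog.clear (.v 0))
        (.seq (Prog.clear (.v 1)) (Prog.clear .f)))))))))

/-- The output is nonempty if and only if no premise was missing and the goal is a fact. -/
theorem finish_runs (g : L) (X U : List (Option L)) (ws : List (List (Option L)))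
    (b : List (InSym Γ L R)) (M F : ℕ) (hX : X.length ≤ M) (hU : U.length ≤ M)
    (hF : (facts ws : List (InSym Γ L R)).length ≤ F) :
    Runs (finish g) (mainStore (X.map sy) (U.map sy) [] (fun _ => []) ws b)
      (update (fun _ => []) .r
        (if b = [] ∧ (goalPat g).substStr (goalStrs X U) ∈ ws then [sep] else []))
      (100 * (M + 1) * (F + 1) + 2 * b.length) := by
  have h1 : Runs (Prog.move .x .t) (mainStore (X.map sy) (U.map sy) [] (fun _ => []) ws b)
      (update (mainStore [] (U.map sy) [] (fun _ => []) ws b) .t (X.map sy).reverse)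
      (2 * M + 1) := by
    refine (Prog.move_runs (by simp) _).congr ?_ (by simp [mainStore]; omega)
    funext j
    cases j <;> simp [mainStore]
  have h2 : Runs (Prog.move .t (.v 0))
      (update (mainStore [] (U.map sy) [] (fun _ => []) ws b) .t (X.map sy).reverse)
      (mainStore [] (U.map sy) [] (update (fun _ => []) 0 X) ws b) (2 * M + 1) := by
    refine (Prog.move_runs (by simp) _).congr ?_ (by simp; omega)
    funext j
    cases j with
    | v j => by_cases h : j = 0 <;> simp [mainStore, h]
    | _ => simp [mainStore]
  have h3 : Runs (Prog.move .u .t) (mainStore [] (U.map sy) [] (update (fun _ => []) 0 X) ws b)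
      (update (mainStore [] [] [] (update (fun _ => []) 0 X) ws b) .t (U.map sy).reverse)
      (2 * M + 1) := by
    refine (Prog.move_runs (by simp) _).congr ?_ (by simp [mainStore]; omega)
    funext j
    cases j <;> simp [mainStore]
  have h4 : Runs (Prog.move .t (.v 1))
      (update (mainStore [] [] [] (update (fun _ => []) 0 X) ws b) .t (U.map sy).reverse)
      (mainStore [] [] [] (goalStrs X U) ws b) (2 * M + 1) := by
    refine (Prog.move_runs (by simp) _).congr ?_ (by simp; omega)
    funext j
    cases j with
    | v j => by_cases h : j = 1 <;> simp [mainStore, h, goalStrs]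
    | _ => simp [mainStore]
  have hM : ∀ i, (goalStrs X U i).length ≤ M := by
    intro i
    simp only [goalStrs, Function.update_apply]
    split_ifs <;> simp [hX, hU]
  have hw : (goalPat g).weight = 5 := rfl
  have hl := Pat.length_substStr_le _ M hM (goalPat g)
  rw [hw] at hl
  generalize hp : (goalPat g).substStr (goalStrs X U) = w at hl
  have h5 := build_runs (dst := .p) (by simp) (by simp) (goalStrs X U) M hM (goalPat g)
    (mainStore [] [] [] (goalStrs X U) ws b : Store Reg (InSym Γ L R)) (fun i => rfl) rfl
  have h6 := lookup_runs (R := R) (Γ := Γ) w ws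
    (update (mainStore [] [] [] (goalStrs X U) ws b) .p (w.map sy)) rfl (by simp) rfl rfl rfl rfl
  rw [hp, hw] at h5
  have h7 : ∀ b' : List (InSym Γ L R), Runs (.cases .b (.push .r sep) fun _ => Prog.clear .b)
      (mainStore [] [] [] (goalStrs X U) ws b')
      (update (mainStore [] [] [] (goalStrs X U) ws []) .r (if b' = [] then [sep] else []))
      (2 * b'.length + 2) := fun b' => by
    rcases b' with - | ⟨c, b'⟩
    · refine (Runs.cases_nil rfl (Runs.push.congr ?_ le_rfl)).mono (by simp)
      funext j
      cases j <;> simp [mainStore]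
    · refine (Runs.cases_cons (k := Reg.b) (c := fun _ => Prog.clear .b) (a := c) (l := b') rfl
        ((Prog.clear_runs _ _).congr ?_ le_rfl)).mono (by simp)
      funext j
      cases j <;> simp [mainStore]
  refine (Runs.seq h1 (Runs.seq h2 (Runs.seq h3 (Runs.seq h4 (Runs.seq (h5.congr ?_ le_rfl)
    (Runs.seq (h6.congr ?_ le_rfl) (Runs.seq (h7 (if w ∈ ws then b else sep :: b))
      (Runs.seq (Prog.clear_runs (.v 0) _) (Runs.seq (Prog.clear_runs (.v 1) _)
        (Prog.clear_runs .f _)))))))))).congr ?_ ?_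
  · simp [mainStore]
  · funext j
    cases j <;> simp [mainStore]
  · funext j
    cases j with
    | v j =>
      by_cases h0 : j = 0
      · subst h0; simp
      · by_cases h1 : j = 1
        · subst h1; simp
        · simp [mainStore, goalStrs, h0, h1]
    | r => by_cases h : w ∈ ws <;> simp [h]
    | _ => simp [mainStore]
  · have h0 := hM 0
    have h1 := hM 1
    have hb : (if w ∈ ws then b else sep :: b).length ≤ b.length + 1 := by
      split_ifs <;> simp
    simp only [mainStore, ne_eq, reduceCtorEq, not_false_eq_true, Function.update_of_ne,
      List.length_map, Reg.v.injEq, Fin.reduceEq]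
    have e1 : (14 + 2 * w.length) * ((facts ws : List (InSym Γ L R)).length + 1) ≤
        (24 * (M + 1)) * (F + 1) := Nat.mul_le_mul (by omega) (by omega)
    have e2 : M + 1 ≤ (M + 1) * (F + 1) := Nat.le_mul_of_pos_right _ (by omega)
    have e3 : F + 1 ≤ (M + 1) * (F + 1) := Nat.le_mul_of_pos_left _ (by omega)
    have e4 : 100 * (M + 1) * (F + 1) = 100 * ((M + 1) * (F + 1)) := by ring
    have e5 : 24 * (M + 1) * (F + 1) = 24 * ((M + 1) * (F + 1)) := by ring
    omega

/-- The verifier. -/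
def verifier (nl : L) (tok : Γ → L) (rules : R → Clause L) (k : ℕ) (g : L) :
    Prog Reg (InSym Γ L R) :=
  .seq (prepare nl tok k) (.seq (mainLoop nl rules) (finish g))

omit [DecidableEq L] [DecidableEq R] in
theorem length_quantStr_le (nl : L) (N : ℕ) (y : List (CertSym L R)) :
    (quantStr nl N y).length ≤ 2 * min N y.length + 1 := by
  have := length_readN nl ((y.take N).map (normSym nl)) 1
  simp only [List.length_map, List.length_take] at this
  simp only [quantStr]
  omega

/-- A bound for the running time of the verifier, in terms of the length `n` of the input and the
size `W` of the clauses. -/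
def timeBound (k W n : ℕ) : ℕ :=
  100 * (n + 2) + (12 * k + 3) * (n + 2) ^ k +
    ((n * ((W + 20) * (25 * (2 * n + 2) * (n * (W * (2 * n + 2) + 1) + 1)) + 1) + 1) +
      (100 * (2 * n + 2) * (n * (W * (2 * n + 2) + 1) + 1) + 2 * (n * W)))

/-- The verifier computes `verify` in polynomial time. -/
theorem verifier_runs (nl : L) (tok : Γ → L) (rules : R → Clause L) (k : ℕ) (g : L) (W : ℕ)
    (hW : ∀ r, weights ((rules r).concl :: (rules r).prems) ≤ W)
    (a : List Γ × List (CertSym L R) × List (CertSym L R)) :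
    Runs (verifier nl tok rules k g) (update (fun _ => []) .inp
        (a.1.map Sum.inl ++ (a.2.1.map Sum.inl ++ a.2.2.map Sum.inr).map Sum.inr))
      (update (fun _ => []) .r (if verify nl tok rules k g a then [sep] else []))
      (timeBound k W (a.1.length + a.2.1.length + a.2.2.length)) := by
  obtain ⟨x, y, z⟩ := a
  simp only
  generalize hn : x.length + y.length + z.length = n
  have h1 := prepare_runs nl tok k x y z
  obtain ⟨b, hb, hbl, hF, h2⟩ := mainLoop_runs (Γ := Γ) nl rules ((inputTree nl tok x).enc.map sy)
    ((quantStr nl ((x.length + 2) ^ k) y).map sy) (2 * n + 1) (n * (W * (2 * n + 2) + 1)) W hW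
    z.length z [] [] false (by simp) le_rfl (by omega)
    (by simp only [facts, List.flatMap_nil, List.length_nil, zero_add]
        exact Nat.mul_le_mul (by omega) le_rfl)
  have hU := length_quantStr_le nl ((x.length + 2) ^ k) y
  have h3 := finish_runs g (inputTree nl tok x).enc (quantStr nl ((x.length + 2) ^ k) y) _ b
    (2 * n + 1) (n * (W * (2 * n + 2) + 1)) (by rw [LTree.length_enc, size_inputTree]; omega)
    (by omega) hF
  refine (Runs.seq h1 (Runs.seq h2 h3)).congr ?_ ?_
  · congr 1
    simp only [hb, verify, Bool.and_eq_true, Bool.not_eq_true', decide_eq_true_eq]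
  · rw [hn, timeBound]
    have e1 : (x.length + 2) ^ k ≤ (n + 2) ^ k := Nat.pow_le_pow_left (by omega) k
    have e2 : z.length * W ≤ n * W := Nat.mul_le_mul (by omega) le_rfl
    have e3 : b.length ≤ z.length * W := by simpa using hbl
    refine Nat.add_le_add (Nat.add_le_add le_rfl (Nat.mul_le_mul le_rfl e1)) (Nat.add_le_add
      (Nat.add_le_add (Nat.mul_le_mul (by omega) le_rfl) le_rfl)
      (Nat.add_le_add le_rfl (Nat.mul_le_mul le_rfl (e3.trans e2))))

end

namespace LTree

variable {L : Type}

/-- Put the label `c` on all leaves. -/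
def fill (c : L) : LTree Unit → LTree L
  | leaf _ => leaf c
  | node a b => node (a.fill c) (b.fill c)

theorem size_fill (c : L) (t : LTree Unit) : (t.fill c).size = t.size := by
  induction t with
  | leaf _ => rfl
  | node a b iha ihb => simp [fill, size, iha, ihb]

end LTree

section

variable {Γ L R : Type}

theorem exists_forest_readN_normSym (nl : L) (l : List (CertSym L R)) (n : ℕ) :
    ∃ ts : List (LTree Unit), ts.length = n ∧
      (readN nl (l.map (normSym nl)) n).1 = ts.flatMap fun t => (t.fill nl).enc := by
  induction l generalizing n with
  | nil =>
    refine ⟨List.replicate n (.leaf ()), by simp, ?_⟩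
    cases n with
    | zero => rfl
    | succ n =>
      rw [List.map_nil, readN]
      generalize n + 1 = k
      induction k with
      | zero => rfl
      | succ k ih => simpa [List.replicate_succ, LTree.enc, LTree.fill] using ih
  | cons c l ih =>
    cases n with
    | zero => exact ⟨[], rfl, by simp [readN]⟩
    | succ n =>
      have key : normSym nl c = .inl none ∨ normSym nl c = .inl (some nl) := by
        rcases c with (- | c) | c <;> simp [normSym]
      rcases key with h | h
      · obtain ⟨ts, h1, h2⟩ := ih (n + 2)
        match ts, h1 with
        | a :: b :: ts, h1 =>
          exact ⟨.node a b :: ts, by simpa using h1, by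
            simp [h, readN, h2, LTree.enc, LTree.fill]⟩
      · obtain ⟨ts, h1, h2⟩ := ih n
        exact ⟨.leaf () :: ts, by simpa using h1, by simp [h, readN, h2, LTree.enc, LTree.fill]⟩

theorem exists_quantStr (nl : L) (N : ℕ) (y : List (CertSym L R)) :
    ∃ t : LTree Unit, quantStr nl N y = (t.fill nl).enc ∧ t.size ≤ 2 * N + 1 := by
  obtain ⟨ts, h1, h2⟩ := exists_forest_readN_normSym nl (y.take N) 1
  obtain ⟨t, rfl⟩ := List.length_eq_one_iff.1 h1
  have h3 : quantStr nl N y = (t.fill nl).enc := by simpa [quantStr] using h2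
  refine ⟨t, h3, ?_⟩
  have h4 := length_quantStr_le nl N y
  rw [h3, LTree.length_enc, LTree.size_fill] at h4
  omega

theorem quantStr_fill (nl : L) (N : ℕ) (t : LTree Unit) (h : t.size ≤ N) :
    quantStr nl N ((t.fill nl).enc.map (.inl : Option L → CertSym L R)) = (t.fill nl).enc := by
  have hl : ((t.fill nl).enc.map (.inl : Option L → CertSym L R)).length ≤ N := by
    rwa [List.length_map, LTree.length_enc, LTree.size_fill]
  have hn : ((t.fill nl).enc.map (.inl : Option L → CertSym L R)).map (normSym nl) =
      (t.fill nl).enc.map .inl := by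
    clear h hl
    induction t with
    | leaf _ => rfl
    | node a b iha ihb =>
      simp only [LTree.fill, LTree.enc, List.map_cons, List.map_append, iha, ihb]
      rfl
  rw [quantStr, List.take_of_length_le hl, hn]
  have := readN_enc (R := R) nl (t.fill nl) [] 0
  simp only [List.append_nil] at this
  rw [this]
  simp [readN]

/-- The goal for an input string and a tree. -/
def goalTree (nl : L) (tok : Γ → L) (g : L) (x : List Γ) (t : LTree Unit) : LTree L :=
  .node (.leaf g) (.node (inputTree nl tok x) (t.fill nl))

/-- A language is in `Π₂ᵖ` if membership of `x` means that for all trees `t` of at most polynomial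
size a certain fact about `x` and `t` has a derivation of polynomial size from a finite system of
Horn clauses over trees. -/
theorem inPi2P_of_horn [Finite Γ] [Finite L] [Finite R] (nl : L) (tok : Γ → L)
    (rules : R → Clause L) (k : ℕ) (g : L) (q : Polynomial ℕ) (S : Set (List Γ))
    (sound : ∀ x, (∀ t : LTree Unit, t.size ≤ (x.length + 2) ^ k →
      Derivable rules (goalTree nl tok g x t)) → x ∈ S)
    (complete : ∀ x ∈ S, ∀ t : LTree Unit, t.size ≤ 2 * (x.length + 2) ^ k + 1 →
      ∃ ss : List (Line L R), IsProof rules ss ∧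
        goalTree nl tok g x t ∈ ss.map (Line.fact rules) ∧
        (ss.flatMap Line.enc).length ≤ q.eval x.length) : InPi2P S := by
  classical
  have := Fintype.ofFinite Γ
  have := Fintype.ofFinite L
  have := Fintype.ofFinite R
  have hgoal : ∀ X U : LTree L, (goalPat g).substStr (goalStrs X.enc U.enc) =
      (LTree.node (.leaf g) (.node X U)).enc := fun X U => by
    simp [goalPat, Pat.substStr, goalStrs, LTree.enc]
  refine ⟨CertSym L R, inferInstance, (Polynomial.X + 2) ^ k + q, verify nl tok rules k g, ?_, ?_⟩
  · set W := Finset.univ.sup fun r => weights ((rules r).concl :: (rules r).prems)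
    have hW : ∀ r, weights ((rules r).concl :: (rules r).prems) ≤ W := fun r =>
      Finset.le_sup (f := fun r => weights ((rules r).concl :: (rules r).prems))
        (Finset.mem_univ r)
    refine (verifier nl tok rules k g).polyTime_of_exec .inp .r _ _
      (100 * (Polynomial.X + 2) + (12 * Polynomial.C k + 3) * (Polynomial.X + 2) ^ k +
        ((Polynomial.X * ((Polynomial.C W + 20) * (25 * (2 * Polynomial.X + 2) *
          (Polynomial.X * (Polynomial.C W * (2 * Polynomial.X + 2) + 1) + 1)) + 1) + 1) +
        (100 * (2 * Polynomial.X + 2) * (Polynomial.X * (Polynomial.C W *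
          (2 * Polynomial.X + 2) + 1) + 1) + 2 * (Polynomial.X * Polynomial.C W)))) fun a => ?_
    obtain ⟨t, ht, h⟩ := verifier_runs nl tok rules k g W hW a
    refine ⟨_, t, ?_, h, fun j hj => (Function.update_of_ne hj ..).trans rfl, ?_⟩
    · have hl : ((Computability.encodingProd (Computability.encodingList Γ)
          (Computability.encodingProd (Computability.encodingList (CertSym L R))
            (Computability.encodingList (CertSym L R)))).encode a).length =
          a.1.length + a.2.1.length + a.2.2.length := by
        simp [Computability.encodingProd, Computability.encodingList, add_assoc]
      rw [hl]
      refine ht.trans (le_of_eq ?_)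
      simp [timeBound]
    · rw [Function.update_self]
      cases verify nl tok rules k g a <;> simp
  · intro x
    constructor
    · intro hx y hy
      obtain ⟨t, h1, h2⟩ := exists_quantStr nl ((x.length + 2) ^ k) y
      obtain ⟨ss, h3, h4, h5⟩ := complete x hx t h2
      refine ⟨ss.reverse.flatMap Line.enc, ?_, ?_⟩
      · have : (ss.reverse.flatMap Line.enc).length = (ss.flatMap Line.enc).length := by
          simp [List.length_flatMap]
        refine this.le.trans (h5.trans ?_)
        simp
      · have h6 := scan_proof nl rules ss.reverse [] (by simpa using h3) _ le_rfl
        simp only [List.map_nil, List.reverse_reverse, List.append_nil] at h6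
        simp only [verify, h6, h1, hgoal, Bool.not_false, Bool.true_and, decide_eq_true_eq]
        exact List.mem_map_of_mem h4
    · intro h
      refine sound x fun t ht => ?_
      obtain ⟨z, -, hz⟩ := h ((t.fill nl).enc.map .inl) (by
        rw [List.length_map, LTree.length_enc, LTree.size_fill]
        simp
        omega)
      simp only [verify, quantStr_fill nl _ t ht, hgoal, Bool.and_eq_true, Bool.not_eq_true',
        decide_eq_true_eq] at hz
      obtain ⟨t', h1, h2⟩ := derivable_of_scan nl rules _ _ _ _ (by simp) hz.1 _ hz.2
      rwa [← LTree.enc_injective h1] at h2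

end

end CRPQContainment

namespace CRPQContainment

/-! ### Words with wildcards -/

/-- A word that may contain wildcards, written `none`. -/
abbrev PWord : Type := List (Option Label)

/-- The letters that a letter or wildcard stands for. -/
def Fits (o : Option Label) (a : Label) : Prop := o = none ∨ o = some a

/-- The words that a word with wildcards stands for. -/
def Matches : PWord → List Label → Prop := List.Forall₂ Fits

theorem Matches.append {u u' : PWord} {w w' : List Label} (h : Matches u w) (h' : Matches u' w') :
    Matches (u ++ u') (w ++ w') := List.rel_append h h'

theorem Matches.exists_append {u u' : PWord} {w : List Label} (h : Matches (u ++ u') w) :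
    ∃ w₁ w₂, w = w₁ ++ w₂ ∧ Matches u w₁ ∧ Matches u' w₂ := by
  induction u generalizing w with
  | nil => exact ⟨[], w, rfl, .nil, h⟩
  | cons o u ih =>
    obtain ⟨a, w, ha, h', rfl⟩ := List.forall₂_cons_left_iff.1 h
    obtain ⟨w₁, w₂, rfl, h1, h2⟩ := ih h'
    exact ⟨a :: w₁, w₂, rfl, .cons ha h1, h2⟩

/-- The language of a regular expression, with the wildcard as a letter of its own. -/
def Regex.plang : Regex → Language (Option Label)
  | empty => 0
  | eps => 1
  | label a => {[some a]}
  | any => {[none]}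
  | plus R S => R.plang + S.plang
  | comp R S => R.plang * S.plang
  | star R => KStar.kstar R.plang

/-- A wildcard is a letter that may be replaced by any label. -/
theorem Regex.mem_lang_iff (r : Regex) (w : List Label) :
    w ∈ r.lang ↔ ∃ u ∈ r.plang, Matches u w := by
  induction r generalizing w with
  | empty => simp [lang, plang, Language.notMem_zero]
  | eps =>
    simp only [lang, plang, Language.mem_one]
    constructor
    · rintro rfl; exact ⟨[], rfl, .nil⟩
    · rintro ⟨u, rfl, h⟩; exact List.forall₂_nil_left_iff.1 h
  | label a =>
    constructor
    · rintro rfl; exact ⟨[some a], rfl, .cons (.inr rfl) .nil⟩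
    · rintro ⟨u, rfl, h⟩
      obtain ⟨b, w, hb, h', rfl⟩ := List.forall₂_cons_left_iff.1 h
      obtain rfl := List.forall₂_nil_left_iff.1 h'
      obtain rfl : a = b := by simpa [Fits] using hb
      rfl
  | any =>
    constructor
    · rintro ⟨a, rfl⟩; exact ⟨[none], rfl, .cons (.inl rfl) .nil⟩
    · rintro ⟨u, rfl, h⟩
      obtain ⟨b, w, hb, h', rfl⟩ := List.forall₂_cons_left_iff.1 h
      obtain rfl := List.forall₂_nil_left_iff.1 h'
      exact ⟨b, rfl⟩
  | plus R S ihR ihS =>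
    simp only [lang, plang, Language.mem_add, ihR, ihS]
    constructor
    · rintro (⟨u, h1, h2⟩ | ⟨u, h1, h2⟩)
      exacts [⟨u, .inl h1, h2⟩, ⟨u, .inr h1, h2⟩]
    · rintro ⟨u, h1 | h1, h2⟩
      exacts [.inl ⟨u, h1, h2⟩, .inr ⟨u, h1, h2⟩]
  | comp R S ihR ihS =>
    simp only [lang, plang, Language.mem_mul, ihR, ihS]
    constructor
    · rintro ⟨w₁, ⟨u₁, h1, h2⟩, w₂, ⟨u₂, h3, h4⟩, rfl⟩
      exact ⟨u₁ ++ u₂, ⟨u₁, h1, u₂, h3, rfl⟩, h2.append h4⟩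
    · rintro ⟨u, ⟨u₁, h1, u₂, h3, rfl⟩, h⟩
      obtain ⟨w₁, w₂, rfl, h2, h4⟩ := h.exists_append
      exact ⟨w₁, ⟨u₁, h1, h2⟩, w₂, ⟨u₂, h3, h4⟩, rfl⟩
  | star R ih =>
    simp only [lang, plang, Language.mem_kstar]
    constructor
    · rintro ⟨L, rfl, h⟩
      induction L with
      | nil => exact ⟨[], ⟨[], rfl, by simp⟩, .nil⟩
      | cons w L ihL =>
        obtain ⟨_, ⟨M, rfl, h1⟩, h2⟩ := ihL fun y hy => h y (List.mem_cons_of_mem _ hy)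
        obtain ⟨u, h3, h4⟩ := (ih w).1 (h w List.mem_cons_self)
        refine ⟨u ++ M.flatten, ⟨u :: M, rfl, ?_⟩, h4.append h2⟩
        simpa using ⟨h3, h1⟩
    · rintro ⟨_, ⟨M, rfl, h⟩, h2⟩
      induction M generalizing w with
      | nil =>
        obtain rfl := List.forall₂_nil_left_iff.1 h2
        exact ⟨[], rfl, by simp⟩
      | cons u M ihM =>
        obtain ⟨w₁, w₂, rfl, h3, h4⟩ := Matches.exists_append h2
        obtain ⟨L, rfl, h5⟩ := ihM w₂ (fun y hy => h y (List.mem_cons_of_mem _ hy)) h4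
        refine ⟨w₁ :: L, rfl, ?_⟩
        have := (ih w₁).2 ⟨u, h u List.mem_cons_self, h3⟩
        simpa using ⟨this, h5⟩

/-! ### The automaton of a regular expression -/

/-- Steps without reading of the automaton whose states are stacks of expressions. -/
inductive EpsStep : List Regex → List Regex → Prop
  | eps (k) : EpsStep (.eps :: k) k
  | plusLeft (r s k) : EpsStep (.plus r s :: k) (r :: k)
  | plusRight (r s k) : EpsStep (.plus r s :: k) (s :: k)
  | comp (r s k) : EpsStep (.comp r s :: k) (r :: s :: k)
  | starNil (r k) : EpsStep (.star r :: k) k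
  | starCons (r k) : EpsStep (.star r :: k) (r :: .star r :: k)

/-- Steps that read a letter or a wildcard. -/
inductive LetterStep : List Regex → Option Label → List Regex → Prop
  | label (a k) : LetterStep (.label a :: k) (some a) k
  | any (o k) : LetterStep (.any :: k) o k

/-- `Run p w q`: the automaton can go from `p` to `q` reading `w`. -/
inductive Run : List Regex → PWord → List Regex → Prop
  | refl (p) : Run p [] p
  | eps {p q r w} : EpsStep p q → Run q w r → Run p w r
  | letter {p q r o w} : LetterStep p o q → Run q w r → Run p (o :: w) r

theorem Run.trans {p q r : List Regex} {u v : PWord} (h : Run p u q) (h' : Run q v r) :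
    Run p (u ++ v) r := by
  induction h with
  | refl => exact h'
  | eps h _ ih => exact .eps h (ih h')
  | letter h _ ih => exact .letter h (ih h')

theorem Run.of_eps {p q : List Regex} (h : EpsStep p q) : Run p [] q := .eps h (.refl q)

theorem Run.of_letter {p q : List Regex} {o : Option Label} (h : LetterStep p o q) :
    Run p [o] q := .letter h (.refl q)

theorem Run.exists_of_append {p r : List Regex} {u v : PWord} (h : Run p (u ++ v) r) :
    ∃ q, Run p u q ∧ Run q v r := by
  generalize hw : u ++ v = w at h
  induction h generalizing u with
  | refl p =>
    obtain ⟨rfl, rfl⟩ := List.append_eq_nil_iff.1 hw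
    exact ⟨p, .refl p, .refl p⟩
  | eps h _ ih =>
    obtain ⟨q, h1, h2⟩ := ih hw
    exact ⟨q, .eps h h1, h2⟩
  | @letter p p' r o w h h' ih =>
    rcases u with - | ⟨o', u⟩
    · exact ⟨p, .refl p, by rw [List.nil_append] at hw; rw [hw]; exact .letter h h'⟩
    · rw [List.cons_append, List.cons.injEq] at hw
      obtain ⟨q, h1, h2⟩ := ih hw.2
      exact ⟨q, hw.1 ▸ .letter h h1, h2⟩

/-- The language of a stack: the product of the languages of its entries. -/
def stackLang : List Regex → Language Label
  | [] => 1
  | r :: k => r.lang * stackLang k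

theorem EpsStep.mem_stackLang {p q : List Regex} (h : EpsStep p q) {w : List Label}
    (hw : w ∈ stackLang q) : w ∈ stackLang p := by
  cases h with
  | eps => simpa [stackLang, Regex.lang] using hw
  | plusLeft r s k =>
    simp only [stackLang, Regex.lang, add_mul, Language.mem_add]
    exact .inl hw
  | plusRight r s k =>
    simp only [stackLang, Regex.lang, add_mul, Language.mem_add]
    exact .inr hw
  | comp r s k => simpa [stackLang, Regex.lang, mul_assoc] using hw
  | starNil r k =>
    refine ⟨[], ?_, w, hw, rfl⟩
    exact Language.nil_mem_kstar _
  | starCons r k =>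
    simp only [stackLang, Regex.lang] at hw ⊢
    rw [← Language.one_add_self_mul_kstar_eq_kstar, add_mul, mul_assoc, Language.mem_add]
    exact .inr hw

theorem Run.mem_stackLang {p q : List Regex} {u : PWord} (h : Run p u q) {w w' : List Label}
    (hu : Matches u w) (hw : w' ∈ stackLang q) : w ++ w' ∈ stackLang p := by
  induction h generalizing w with
  | refl =>
    obtain rfl := List.forall₂_nil_left_iff.1 hu
    exact hw
  | eps h _ ih => exact h.mem_stackLang (ih hu hw)
  | letter h _ ih =>
    obtain ⟨a, w, ha, hu', rfl⟩ := List.forall₂_cons_left_iff.1 hu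
    cases h with
    | label b k =>
      obtain rfl : b = a := by simpa [Fits] using ha
      exact Language.mem_mul.2 ⟨[b], rfl, _, ih hu' hw, rfl⟩
    | any => exact Language.mem_mul.2 ⟨[a], ⟨a, rfl⟩, _, ih hu' hw, rfl⟩

/-- An upper bound for the labels in an expression. -/
def Regex.bound : Regex → ℕ
  | label a => a
  | plus R S => max R.bound S.bound
  | comp R S => max R.bound S.bound
  | star R => R.bound
  | _ => 0

/-- The automaton reads every word of the language, even if labels that do not occur in the
expression are replaced by wildcards. -/
theorem Run.of_mem_lang {f : Label → Option Label} (r : Regex) (hf : ∀ a ≤ r.bound, f a = some a)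
    {w : List Label} (hw : w ∈ r.lang) (k : List Regex) : Run (r :: k) (w.map f) k := by
  induction r generalizing w k with
  | empty => exact absurd hw (Language.notMem_zero _)
  | eps =>
    obtain rfl := (Language.mem_one _).1 hw
    exact .of_eps (.eps k)
  | label a =>
    obtain rfl : w = [a] := hw
    rw [List.map_singleton, hf a le_rfl]
    exact .of_letter (.label a k)
  | any =>
    obtain ⟨a, rfl⟩ := hw
    exact .of_letter (.any _ k)
  | plus R S ihR ihS =>
    rcases (Language.mem_add _ _ _).1 hw with hw | hw
    · exact .eps (.plusLeft R S k) (ihR (fun a ha => hf a (ha.trans (le_max_left _ _))) hw k)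
    · exact .eps (.plusRight R S k) (ihS (fun a ha => hf a (ha.trans (le_max_right _ _))) hw k)
  | comp R S ihR ihS =>
    obtain ⟨w₁, h1, w₂, h2, rfl⟩ := Language.mem_mul.1 hw
    rw [List.map_append]
    exact .eps (.comp R S k)
      ((ihR (fun a ha => hf a (ha.trans (le_max_left _ _))) h1 (S :: k)).trans
        (ihS (fun a ha => hf a (ha.trans (le_max_right _ _))) h2 k))
  | star R ih =>
    obtain ⟨L, rfl, h⟩ := Language.mem_kstar.1 hw
    clear hw
    induction L with
    | nil => exact .of_eps (.starNil R k)
    | cons u L ihL =>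
      rw [List.flatten_cons, List.map_append]
      exact .eps (.starCons R k) ((ih hf (h u List.mem_cons_self) _).trans
        (ihL fun y hy => h y (List.mem_cons_of_mem _ hy)))

/-! ### Paths labeled with words with wildcards -/

/-- There is a path from `u` to `v` labeled with a word that `w` stands for. -/
def KnowledgeBase.PPath (K : KnowledgeBase) (u : K.V) (w : PWord) (v : K.V) : Prop :=
  ∃ w', Matches w w' ∧ K.Path u w' v

theorem KnowledgeBase.Path.eq_of_nil {K : KnowledgeBase} {u v : K.V} (h : K.Path u [] v) :
    u = v := by
  cases h
  rfl

theorem KnowledgeBase.Path.exists_of_cons {K : KnowledgeBase} {u v : K.V} {a : Label}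
    {w : List Label} (h : K.Path u (a :: w) v) : ∃ t, (u, a, t) ∈ K.E ∧ K.Path t w v := by
  cases h with
  | cons e h => exact ⟨_, e, h⟩

theorem KnowledgeBase.Path.append {K : KnowledgeBase} {u v t : K.V} {w w' : List Label}
    (h : K.Path u w v) (h' : K.Path v w' t) : K.Path u (w ++ w') t := by
  induction h with
  | nil => exact h'
  | cons e _ ih => exact .cons e (ih h')

theorem KnowledgeBase.Path.exists_of_append {K : KnowledgeBase} {u t : K.V} {w w' : List Label}
    (h : K.Path u (w ++ w') t) : ∃ v, K.Path u w v ∧ K.Path v w' t := by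
  induction w generalizing u with
  | nil => exact ⟨u, .nil u, h⟩
  | cons a w ih =>
    cases h with
    | cons e h =>
      obtain ⟨v, h1, h2⟩ := ih h
      exact ⟨v, .cons e h1, h2⟩

theorem KnowledgeBase.PPath.exists_of_append {K : KnowledgeBase} {u t : K.V} {w w' : PWord}
    (h : K.PPath u (w ++ w') t) : ∃ v, K.PPath u w v ∧ K.PPath v w' t := by
  obtain ⟨x, h1, h2⟩ := h
  obtain ⟨x₁, x₂, rfl, h3, h4⟩ := h1.exists_append
  obtain ⟨v, h5, h6⟩ := h2.exists_of_append
  exact ⟨v, ⟨x₁, h3, h5⟩, x₂, h4, h6⟩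

theorem KnowledgeBase.PPath.eq_of_nil {K : KnowledgeBase} {u t : K.V} (h : K.PPath u [] t) :
    u = t := by
  obtain ⟨x, h1, h2⟩ := h
  obtain rfl := List.forall₂_nil_left_iff.1 h1
  cases h2
  rfl

/-! ### Graphs with edges labeled by words -/

/-- `Good Q h E`: whenever a map sends the edges of `E` to paths of a knowledge base, the image
of `h` is an answer to `Q`. -/
def Good {V : Type} (Q : CRPQ) (h : List V) (E : List (V × PWord × V)) : Prop :=
  ∀ (K : KnowledgeBase) (μ : V → K.V), (∀ e ∈ E, K.PPath (μ e.1) e.2.1 (μ e.2.2)) →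
    ∃ μ' : Var → K.V, Q.Satisfies K μ' ∧ h.map μ = Q.head.map μ'

/-- Graphs whose edges are labeled with lists of pieces, each of which stands for a word. -/
abbrev PGraph (V P : Type) := List (V × List P × V)

/-- The nodes of the graph that results from dividing the edges into their pieces: the original
nodes; and the points on the edges. The point `at g l` lies on the first edge of `g`, which is
a suffix of the list of edges; the list `l` holds the pieces between the point and the end of the
edge. -/
inductive GNode (V P : Type) where
  | var (x : V) : GNode V P
  | at (g : PGraph V P) (l : List P) : GNode V P

section

variable {V P : Type}

/-- The points that exist in a graph. -/
def GNode.Valid (G : PGraph V P) : GNode V P → Prop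
  | var _ => True
  | .at g l => g <:+ G ∧ ∃ e g', g = e :: g' ∧ l <:+ e.2.1

/-- `PReach ω G p u q v`: the automaton can go from the state `p` at the point `u` to the state `q`
at `v`, reading the words on the pieces. -/
inductive PReach (ω : P → PWord) (G : PGraph V P) (p : List Regex) (u : GNode V P) :
    List Regex → GNode V P → Prop
  | refl : u.Valid G → PReach ω G p u p u
  | eps {q q' v} : PReach ω G p u q v → EpsStep q q' → PReach ω G p u q' v
  | piece {q q' g c l} : PReach ω G p u q (.at g (c :: l)) → Run q (ω c) q' →
      PReach ω G p u q' (.at g l)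
  | fromStart {q x l y g} : PReach ω G p u q (.var x) → (x, l, y) :: g <:+ G →
      PReach ω G p u q (.at ((x, l, y) :: g) l)
  | toStart {q x l y g} : PReach ω G p u q (.at ((x, l, y) :: g) l) → PReach ω G p u q (.var x)
  | fromEnd {q x l y g} : PReach ω G p u q (.var y) → (x, l, y) :: g <:+ G →
      PReach ω G p u q (.at ((x, l, y) :: g) [])
  | toEnd {q x l y g} : PReach ω G p u q (.at ((x, l, y) :: g) []) → PReach ω G p u q (.var y)

/-- The query `Q` can be mapped into the graph `G` such that its head goes to `h`. -/
def PMaps (ω : P → PWord) (G : PGraph V P) (Q : CRPQ) (h : List V) : Prop :=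
  ∃ A : Var → GNode V P, (∀ a ∈ Q.body, PReach ω G [a.re] (A a.src) [] (A a.tgt)) ∧
    List.Forall₂ (fun x y => PReach ω G [] (A y) [] (.var x)) h Q.head

/-- Forget how the edges are divided into pieces. -/
def flatten (ω : P → PWord) (G : PGraph V P) : List (V × PWord × V) :=
  G.map fun e => (e.1, e.2.1.flatMap ω, e.2.2)

/-- A path for a concatenation of pieces has intermediate points, one for each suffix of the list of
pieces. -/
theorem exists_points {K : KnowledgeBase} (ω : P → PWord) (l : List P) {u v : K.V}
    (h : K.PPath u (l.flatMap ω) v) : ∃ f : List P → K.V, f l = u ∧ f [] = v ∧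
      ∀ c l', c :: l' <:+ l → K.PPath (f (c :: l')) (ω c) (f l') := by
  induction l generalizing u with
  | nil =>
    obtain rfl := h.eq_of_nil
    exact ⟨fun _ => u, rfl, rfl, fun c l' h' => by simp at h'⟩
  | cons c l ih =>
    rw [List.flatMap_cons] at h
    obtain ⟨t, h1, h2⟩ := h.exists_of_append
    obtain ⟨f, h3, h4, h5⟩ := ih h2
    classical
    refine ⟨fun l' => if l' = c :: l then u else f l', by simp, by simp [h4], ?_⟩
    intro c' l' h'
    rcases List.suffix_cons_iff.1 h' with h' | h'
    · obtain ⟨rfl, rfl⟩ := List.cons.inj h'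
      have : l' ≠ c' :: l' := fun h => by simpa using congrArg List.length h
      simpa [this, h3] using h1
    · have hlen := h'.length_le
      have e1 : c' :: l' ≠ c :: l := fun h => by
        have := congrArg List.length h
        simp at this hlen
        omega
      have e2 : l' ≠ c :: l := fun h => by
        have := congrArg List.length h
        simp at this hlen
        omega
      simpa only [e1, e2, if_false] using h5 c' l' h'

theorem exists_interpretation {K : KnowledgeBase} (ω : P → PWord) (G : PGraph V P) (μ : V → K.V)
    (h : ∀ e ∈ flatten ω G, K.PPath (μ e.1) e.2.1 (μ e.2.2)) : ∃ ν : GNode V P → K.V,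
      (∀ x, ν (.var x) = μ x) ∧ ∀ x l y g, (x, l, y) :: g <:+ G →
        ν (.at ((x, l, y) :: g) l) = μ x ∧ ν (.at ((x, l, y) :: g) []) = μ y ∧
        ∀ c l', c :: l' <:+ l → K.PPath (ν (.at ((x, l, y) :: g) (c :: l'))) (ω c)
          (ν (.at ((x, l, y) :: g) l')) := by
  have h' : ∀ g : PGraph V P, ∃ f : List P → K.V, ∀ x l y g', g = (x, l, y) :: g' → g <:+ G →
      f l = μ x ∧ f [] = μ y ∧
        ∀ c l', c :: l' <:+ l → K.PPath (f (c :: l')) (ω c) (f l') := by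
    intro g
    rcases g with - | ⟨⟨x, l, y⟩, g⟩
    · exact ⟨fun _ => K.nonempty_V.some, by simp⟩
    · by_cases hg : (x, l, y) :: g <:+ G
      · have : (x, l, y) ∈ G := hg.subset List.mem_cons_self
        obtain ⟨f, hf⟩ := exists_points ω l (h _ (List.mem_map_of_mem this))
        refine ⟨f, fun x' l' y' g' e _ => ?_⟩
        cases e
        exact hf
      · exact ⟨fun _ => K.nonempty_V.some, fun x' l' y' g' _ h => absurd h hg⟩
  choose f hf using h'
  exact ⟨fun v => match v with
    | .var x => μ x
    | .at g l => f g l, fun x => rfl, fun x l y g hg => hf _ x l y g rfl hg⟩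

theorem PReach.valid {ω : P → PWord} {G : PGraph V P} {p q : List Regex} {u v : GNode V P}
    (h : PReach ω G p u q v) : v.Valid G := by
  induction h with
  | refl h => exact h
  | eps _ _ ih => exact ih
  | piece _ _ ih =>
    obtain ⟨h1, e, g', h2, h3⟩ := ih
    exact ⟨h1, e, g', h2, (List.suffix_cons _ _).trans h3⟩
  | fromStart _ h => exact ⟨h, _, _, rfl, List.suffix_rfl⟩
  | toStart => trivial
  | fromEnd _ h => exact ⟨h, _, _, rfl, List.nil_suffix⟩
  | toEnd => trivial

/-- A query that can be mapped into `G` has an answer wherever `G` can be mapped to. -/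
theorem good_of_pMaps {ω : P → PWord} {G : PGraph V P} {Q : CRPQ} {h : List V}
    (H : PMaps ω G Q h) : Good Q h (flatten ω G) := by
  intro K μ hμ
  obtain ⟨ν, hν, hν'⟩ := exists_interpretation ω G μ hμ
  have key : ∀ {p q : List Regex} {u v : GNode V P}, PReach ω G p u q v →
      ∃ w, K.Path (ν u) w (ν v) ∧ ∀ w' ∈ stackLang q, w ++ w' ∈ stackLang p := by
    intro p q u v h
    induction h with
    | refl => exact ⟨[], .nil _, fun w' h => h⟩
    | eps _ he ih =>
      obtain ⟨w, h1, h2⟩ := ih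
      exact ⟨w, h1, fun w' hw' => h2 w' (he.mem_stackLang hw')⟩
    | @piece q q' g c l hr hrun ih =>
      obtain ⟨w, h1, h2⟩ := ih
      obtain ⟨hg, ⟨x, l₀, y⟩, g', rfl, hl⟩ := hr.valid
      obtain ⟨w₁, h3, h4⟩ := (hν' x l₀ y g' hg).2.2 c l hl
      refine ⟨w ++ w₁, h1.append h4, fun w' hw' => ?_⟩
      rw [List.append_assoc]
      exact h2 _ (hrun.mem_stackLang h3 hw')
    | fromStart _ hg ih => rwa [(hν' _ _ _ _ hg).1, ← hν]
    | toStart hr ih => rwa [(hν' _ _ _ _ hr.valid.1).1, ← hν] at ih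
    | fromEnd _ hg ih => rwa [(hν' _ _ _ _ hg).2.1, ← hν]
    | toEnd hr ih => rwa [(hν' _ _ _ _ hr.valid.1).2.1, ← hν] at ih
  obtain ⟨A, h1, h2⟩ := H
  refine ⟨fun x => ν (A x), fun a ha => ?_, ?_⟩
  · obtain ⟨w, h3, h4⟩ := key (h1 a ha)
    refine ⟨w, ?_, h3⟩
    simpa [stackLang] using h4 [] rfl
  · clear h1
    generalize Q.head = h' at h2
    induction h2 with
    | nil => rfl
    | @cons x y l l' hxy _ ih =>
      obtain ⟨w, h3, h4⟩ := key hxy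
      have : w = [] := by simpa [stackLang, Language.mem_one] using h4 [] rfl
      subst this
      rw [List.map_cons, List.map_cons, ih, ← hν x]
      generalize ν (.var x) = a at h3 ⊢
      generalize ν (A y) = b at h3 ⊢
      cases h3
      rfl

end

/-! ### The canonical knowledge base of a graph -/

/-- The points of the graph with edges `E`: the nodes, and the point after `j` letters on the `i`-th
edge. -/
inductive CNode where
  | var (x : Var) : CNode
  | pos (i j : ℕ) : CNode

section

variable (M : ℕ) (E : List (Var × PWord × Var))

/-- The points that exist, if all nodes are at most `M`. -/
def CNode.Ok : CNode → Prop
  | var x => x ≤ M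
  | pos i j => ∃ e, E[i]? = some e ∧ j ≤ e.2.1.length

/-- The ends of an edge are to be identified with its nodes. -/
inductive CNode.Glue : CNode → CNode → Prop
  | start {i x w y} : E[i]? = some (x, w, y) → Glue (pos i 0) (var x)
  | finish {i x w y} : E[i]? = some (x, w, y) → Glue (pos i w.length) (var y)

/-- The points up to identification. -/
abbrev CPoint : Type := Quot fun a b : {n : CNode // n.Ok M E} => CNode.Glue E a.1 b.1

theorem finite_cPoint : Finite (CPoint M E) := by
  have : {n : CNode | n.Ok M E}.Finite := by
    have hf : (CNode.var '' Set.Iic M ∪ (fun p : ℕ × ℕ => CNode.pos p.1 p.2) ''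
        (Set.Iio E.length ×ˢ Set.Iic (E.map fun e => e.2.1.length).sum)).Finite :=
      ((Set.finite_Iic M).image _).union
        (((Set.finite_Iio _).prod (Set.finite_Iic _)).image _)
    refine hf.subset ?_
    rintro (x | ⟨i, j⟩) h
    · exact .inl ⟨x, h, rfl⟩
    · obtain ⟨e, h1, h2⟩ := h
      obtain ⟨hi, rfl⟩ := List.getElem?_eq_some_iff.1 h1
      exact .inr ⟨(i, j), ⟨hi, h2.trans (List.single_le_sum (by simp) _
        (List.mem_map_of_mem (List.getElem_mem hi)))⟩, rfl⟩
  have : Finite {n : CNode // n.Ok M E} := this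
  infer_instance

/-- The knowledge base that consists of the edges `E`, in which `F` is used as the label for
wildcards. -/
def canonicalKB (F : Label) (hF : ∀ e ∈ E, ∀ a, some a ∈ e.2.1 → a < F) : KnowledgeBase where
  V := CPoint M E
  finite_V := finite_cPoint M E
  nonempty_V := ⟨Quot.mk _ ⟨.var 0, Nat.zero_le _⟩⟩
  E := {t | ∃ a b : {n : CNode // n.Ok M E}, t.1 = Quot.mk _ a ∧ t.2.2 = Quot.mk _ b ∧
    ∃ i j e o, E[i]? = some e ∧ e.2.1[j]? = some o ∧ a.1 = .pos i j ∧ b.1 = .pos i (j + 1) ∧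
      t.2.1 = o.getD F}
  finite_E := by
    have := finite_cPoint M E
    refine (Set.finite_univ.prod ((Set.finite_Iic F).prod Set.finite_univ)).subset ?_
    rintro ⟨s, l, t⟩ ⟨a, b, -, -, i, j, e, o, h1, h2, -, -, h3⟩
    refine ⟨trivial, ?_, trivial⟩
    simp only at h3
    rw [h3, Set.mem_Iic]
    cases o with
    | none => exact le_rfl
    | some c => exact (hF e (List.mem_of_getElem? h1) c (List.mem_of_getElem? h2)).le

variable {M E} {F : Label} {hF : ∀ e ∈ E, ∀ a, some a ∈ e.2.1 → a < F}

theorem canonicalKB_path {i : ℕ} {x : Var} {w : PWord} {y : Var} (h : E[i]? = some (x, w, y))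
    (u v : PWord) (hw : w = u ++ v) :
    (canonicalKB M E F hF).Path (Quot.mk _ ⟨.pos i u.length, _, h, by simp [hw]⟩)
      (v.map (Option.getD · F)) (Quot.mk _ ⟨.pos i w.length, _, h, le_rfl⟩) := by
  induction v generalizing u with
  | nil =>
    rw [List.append_nil] at hw
    subst hw
    exact .nil _
  | cons o v ih =>
    refine .cons ?_ ((ih (u ++ [o]) (by simp [hw])))
    refine ⟨⟨.pos i u.length, _, h, by simp [hw]⟩, ⟨.pos i (u ++ [o]).length, _, h, ?_⟩, rfl, rfl,
      i, u.length, _, o, h, by simp [hw], rfl, by simp, rfl⟩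
    simp [hw]

theorem matches_map_getD (w : PWord) (F : Label) : Matches w (w.map (Option.getD · F)) := by
  induction w with
  | nil => exact .nil
  | cons o w ih =>
    refine .cons ?_ ih
    cases o with
    | none => exact .inl rfl
    | some a => exact .inr rfl

variable {P : Type} {ω : P → PWord} {G : PGraph Var P}

/-- The node of the graph `G` is the given point. -/
def IsPoint (ω : P → PWord) (G : PGraph Var P) : CNode → GNode Var P → Prop
  | .var x, v => v = .var x
  | .pos i j, v => ∃ e l₁ l₂, G[i]? = some e ∧ e.2.1 = l₁ ++ l₂ ∧ (l₁.flatMap ω).length = j ∧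
      v = .at (G.drop i) l₂

/-- The invariant in the translation of paths of the canonical knowledge base: the automaton can go
from `p` at `u` to `q` at the given point. If this point lies inside of a piece, then the automaton
is about to read the rest of the piece. -/
def Inv (ω : P → PWord) (G : PGraph Var P) (p : List Regex) (u : GNode Var P) (q : List Regex) :
    CNode → Prop
  | .var x => PReach ω G p u q (.var x)
  | .pos i j => ∃ e l₁ l₂ q₀ w, G[i]? = some e ∧ e.2.1 = l₁ ++ l₂ ∧
      (l₁.flatMap ω).length + w.length = j ∧ PReach ω G p u q₀ (.at (G.drop i) l₂) ∧
      Run q₀ w q ∧ (w = [] ∨ ∃ c l₃ w', l₂ = c :: l₃ ∧ w' ≠ [] ∧ ω c = w ++ w')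

theorem drop_eq_cons {α : Type} {l : List α} {i : ℕ} {e : α} (h : l[i]? = some e) :
    l.drop i = e :: l.drop (i + 1) := by
  obtain ⟨hi, rfl⟩ := List.getElem?_eq_some_iff.1 h
  exact List.drop_eq_getElem_cons hi

theorem PReach.of_run_nil {V : Type} {G : PGraph V P} {p q r : List Regex} {u v : GNode V P}
    (h : PReach ω G p u q v) (h' : Run q [] r) : PReach ω G p u r v := by
  generalize hw : ([] : PWord) = w at h'
  induction h' with
  | refl => exact h
  | eps he _ ih => exact ih (h.eps he) hw
  | letter => cases hw

theorem IsPoint.inv {n : CNode} {u : GNode Var P} (h : IsPoint ω G n u) (p : List Regex) :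
    Inv ω G p u p n := by
  cases n with
  | var x => subst h; exact .refl trivial
  | pos i j =>
    obtain ⟨e, l₁, l₂, h1, h2, h3, rfl⟩ := h
    refine ⟨e, l₁, l₂, p, [], h1, h2, by simpa using h3, .refl ⟨List.drop_suffix _ _, e, _,
      drop_eq_cons h1, ?_⟩, .refl p, .inl rfl⟩
    rw [h2]; exact List.suffix_append _ _

theorem Inv.eps {p q q' : List Regex} {u : GNode Var P} {n : CNode} (h : Inv ω G p u q n)
    (he : EpsStep q q') : Inv ω G p u q' n := by
  cases n with
  | var x => exact PReach.eps h he
  | pos i j =>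
    obtain ⟨e, l₁, l₂, q₀, w, h1, h2, h3, h4, h5, h6⟩ := h
    exact ⟨e, l₁, l₂, q₀, w, h1, h2, h3, h4, by simpa using h5.trans (.of_eps he), h6⟩

variable (hne : ∀ e ∈ G, ∀ c ∈ e.2.1, ω c ≠ [])

include hne

/-- At a point on a boundary between pieces the invariant says that the point is reached: since no
piece is empty, the position determines the remaining pieces. -/
theorem Inv.pReach {p q : List Regex} {u v : GNode Var P} {n : CNode} (h : Inv ω G p u q n)
    (hv : IsPoint ω G n v) : PReach ω G p u q v := by
  cases n with
  | var x => subst hv; exact h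
  | pos i j =>
    obtain ⟨e, l₁, l₂, q₀, w, h1, h2, h3, h4, h5, h6⟩ := h
    obtain ⟨e', m₁, m₂, h1', h2', h3', rfl⟩ := hv
    obtain rfl : e = e' := by rw [h1] at h1'; simpa using h1'
    have hmem : ∀ c ∈ l₁ ++ l₂, ω c ≠ [] := fun c hc =>
      hne e (List.mem_of_getElem? h1) c (by rw [h2]; exact hc)
    have key : w = [] ∧ l₂ = m₂ := by
      rw [h2] at h2'
      rcases List.append_eq_append_iff.1 h2' with ⟨m, rfl, rfl⟩ | ⟨m, rfl, rfl⟩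
      · rcases m with - | ⟨c, m⟩
        · simp [-List.length_flatMap] at h3'
          exact ⟨List.eq_nil_of_length_eq_zero (by omega), rfl⟩
        · exfalso
          have hc : 0 < (ω c).length := List.length_pos_iff.2 (hmem c (by simp))
          simp only [List.flatMap_append, List.flatMap_cons, List.length_append] at h3'
          rcases h6 with rfl | ⟨c', l₃, w', h7, h8, h9⟩
          · simp [-List.length_flatMap] at h3; omega
          · obtain ⟨rfl, -⟩ := List.cons.inj h7
            have := List.length_pos_iff.2 h8
            have := congrArg List.length h9
            simp only [List.length_append] at this
            omega
      · rcases m with - | ⟨c, m⟩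
        · simp [-List.length_flatMap] at h3 h3'
          exact ⟨List.eq_nil_of_length_eq_zero (by omega), rfl⟩
        · exfalso
          have hc : 0 < (ω c).length := List.length_pos_iff.2 (hmem c (by simp))
          simp only [List.flatMap_append, List.flatMap_cons, List.length_append] at h3
          omega
    obtain ⟨rfl, rfl⟩ := key
    exact h4.of_run_nil h5

omit hne in
theorem getElem?_flatten {i : ℕ} {x y : Var} {w : PWord}
    (h : (flatten ω G)[i]? = some (x, w, y)) : ∃ l, G[i]? = some (x, l, y) ∧ w = l.flatMap ω := by
  rw [flatten, List.getElem?_map, Option.map_eq_some_iff] at h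
  obtain ⟨⟨x', l, y'⟩, h1, h2⟩ := h
  simp only [Prod.mk.injEq] at h2
  obtain ⟨rfl, rfl, rfl⟩ := h2
  exact ⟨l, h1, rfl⟩

/-- The invariant respects the identification of the ends of an edge with its nodes. -/
theorem Inv.glue_iff {p q : List Regex} {u : GNode Var P} {a b : CNode}
    (h : CNode.Glue (flatten ω G) a b) : Inv ω G p u q a ↔ Inv ω G p u q b := by
  cases h with
  | @start i x w y h =>
    obtain ⟨l, h1, rfl⟩ := getElem?_flatten h
    have hd := drop_eq_cons h1
    constructor
    · intro H
      have := H.pReach hne (v := .at (G.drop i) l) ⟨_, [], l, h1, rfl, rfl, rfl⟩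
      rw [hd] at this
      exact this.toStart
    · intro H
      refine ⟨_, [], l, q, [], h1, rfl, rfl, ?_, .refl q, .inl rfl⟩
      rw [hd]
      exact PReach.fromStart H (hd ▸ List.drop_suffix _ _)
  | @finish i x w y h =>
    obtain ⟨l, h1, rfl⟩ := getElem?_flatten h
    have hd := drop_eq_cons h1
    constructor
    · intro H
      have := H.pReach hne (v := .at (G.drop i) []) ⟨_, l, [], h1, by simp, rfl, rfl⟩
      rw [hd] at this
      exact this.toEnd
    · intro H
      refine ⟨_, l, [], q, [], h1, by simp, rfl, ?_, .refl q, .inl rfl⟩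
      rw [hd]
      exact PReach.fromEnd H (hd ▸ List.drop_suffix _ _)

/-- Reading a letter of an edge; if it is the last letter of a piece, then the run on the whole
piece becomes a step of `PReach`. -/
theorem Inv.letter {p q q' : List Regex} {u : GNode Var P} {i j : ℕ} {o : Option Label}
    {e : Var × PWord × Var} (h : Inv ω G p u q (.pos i j)) (he : (flatten ω G)[i]? = some e)
    (ho : e.2.1[j]? = some o) (hq : LetterStep q o q') : Inv ω G p u q' (.pos i (j + 1)) := by
  obtain ⟨x, w₀, y⟩ := e
  obtain ⟨l, hl, rfl⟩ := getElem?_flatten he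
  obtain ⟨e', l₁, l₂, q₀, w, h1, h2, h3, h4, h5, h6⟩ := h
  obtain rfl : (x, l, y) = e' := by rw [hl] at h1; simpa using h1
  simp only at h2
  subst h2
  have hmem : ∀ c ∈ l₁ ++ l₂, ω c ≠ [] := hne _ (List.mem_of_getElem? h1)
  simp only [List.flatMap_append] at ho
  rw [List.getElem?_append_right (by omega), show j - (l₁.flatMap ω).length = w.length by omega]
    at ho
  have key : ∃ c l₃ w', l₂ = c :: l₃ ∧ ω c = w ++ o :: w' := by
    rcases h6 with rfl | ⟨c, l₃, w', rfl, hw', hc⟩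
    · rcases l₂ with - | ⟨c, l₃⟩
      · simp at ho
      · have := hmem c (by simp)
        rcases hc : ω c with - | ⟨o', w'⟩
        · exact absurd hc this
        · simp [hc] at ho
          exact ⟨c, l₃, w', rfl, by simp [hc, ho]⟩
    · rcases w' with - | ⟨o', w'⟩
      · exact absurd rfl hw'
      · refine ⟨c, l₃, w', rfl, ?_⟩
        simp [hc] at ho
        rw [hc, ho]
  obtain ⟨c, l₃, w', rfl, hc⟩ := key
  rcases w' with - | ⟨o', w'⟩
  · refine ⟨_, l₁ ++ [c], l₃, q', [], h1, by simp, ?_, h4.piece ?_, .refl _, .inl rfl⟩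
    · simp [hc, -List.length_flatMap]; omega
    · rw [hc]
      exact h5.trans (.of_letter hq)
  · refine ⟨_, l₁, c :: l₃, q₀, w ++ [o], h1, rfl, by simp [-List.length_flatMap]; omega, h4,
        h5.trans (.of_letter hq),
      .inr ⟨c, l₃, o' :: w', rfl, by simp, by simp [hc]⟩⟩

omit hne

/-- Query answers in the canonical knowledge base give maps into all graphs that divide the edges
into nonempty pieces such that the images of the variables of `Q` are not inside of pieces. -/
theorem exists_cuts_of_good {Q : CRPQ} {h : List Var} {E : List (Var × PWord × Var)}
    (hE : ∀ x ∈ h, ∃ e ∈ E, x = e.1 ∨ x = e.2.2) (H : Good Q h E) :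
    ∃ C : List (ℕ × ℕ), C.length ≤ 2 * Q.body.length ∧
      (∀ c ∈ C, ∃ e, E[c.1]? = some e ∧ c.2 ≤ e.2.1.length) ∧
      ∀ (P : Type) (ω : P → PWord) (G : PGraph Var P), flatten ω G = E →
        (∀ e ∈ G, ∀ c ∈ e.2.1, ω c ≠ []) →
        (∀ c ∈ C, ∃ e l₁ l₂, G[c.1]? = some e ∧ e.2.1 = l₁ ++ l₂ ∧
          (l₁.flatMap ω).length = c.2) → PMaps ω G Q h := by
  -- All vertices are at most `M`. The label `F`, which replaces the wildcards, occurs neither in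
  -- `E` nor in `Q`, hence an expression of `Q` can read it by wildcards only.
  set M := (E.map fun e => e.1 + e.2.2).sum with hM
  have hM' : ∀ e ∈ E, e.1 ≤ M ∧ e.2.2 ≤ M := fun e he => by
    have := List.single_le_sum (l := E.map fun e => e.1 + e.2.2) (by simp) _
      (List.mem_map_of_mem he)
    exact ⟨(Nat.le_add_right _ _).trans this, (Nat.le_add_left _ _).trans this⟩
  set F := (E.map fun e => (e.2.1.map fun o => ((o.getD 0 : ℕ) + 1 : ℕ)).sum).sum +
    (Q.body.map fun A => A.re.bound + 1).sum with hFdef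
  have hF : ∀ e ∈ E, ∀ a, some a ∈ e.2.1 → a < F := fun e he a ha => by
    have h1 := List.single_le_sum
      (l := E.map fun e => (e.2.1.map fun o => ((o.getD 0 : ℕ) + 1 : ℕ)).sum) (by simp) _
      (List.mem_map_of_mem he)
    have h2 := List.single_le_sum (l := e.2.1.map fun o => ((o.getD 0 : ℕ) + 1 : ℕ))
      (by simp) _ (List.mem_map_of_mem ha)
    simp only [Option.getD_some] at h2
    exact Nat.lt_of_lt_of_le (Nat.lt_succ_self a) ((h2.trans h1).trans (Nat.le_add_right _ _))
  have hFQ : ∀ A ∈ Q.body, A.re.bound < F := fun A hA => by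
    have h1 := List.single_le_sum (l := Q.body.map fun A => A.re.bound + 1)
      (by simp) _ (List.mem_map_of_mem hA)
    exact Nat.lt_of_lt_of_le (Nat.lt_succ_self _) (h1.trans (Nat.le_add_left _ _))
  classical
  set K := canonicalKB M E F hF
  set μ : Var → K.V := fun x => if hx : x ≤ M then Quot.mk _ ⟨.var x, hx⟩ else
    Quot.mk _ ⟨.var 0, Nat.zero_le _⟩ with hμ
  have hμ' : ∀ x (hx : x ≤ M), μ x = Quot.mk _ ⟨.var x, hx⟩ := fun x hx => dif_pos hx
  obtain ⟨μ', h1, h2⟩ := H K μ fun ⟨x, w, y⟩ he => by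
    obtain ⟨i, hi⟩ := List.getElem?_of_mem he
    refine ⟨_, matches_map_getD w F, ?_⟩
    have := canonicalKB_path (M := M) (F := F) (hF := hF) hi [] w rfl
    rw [hμ' x (hM' _ he).1, hμ' y (hM' _ he).2]
    have e1 : (Quot.mk _ ⟨.pos i 0, _, hi, by simp⟩ : CPoint M E) =
      Quot.mk _ ⟨.var x, (hM' _ he).1⟩ := Quot.sound (.start hi)
    have e2 : (Quot.mk _ ⟨.pos i w.length, _, hi, le_rfl⟩ : CPoint M E) =
      Quot.mk _ ⟨.var y, (hM' _ he).2⟩ := Quot.sound (.finish hi)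
    rw [← e1, ← e2]
    exact this
  -- The cuts are the images of the variables of `Q` in the interior or at the ends of edges.
  choose rep hrep using fun z => Quot.exists_rep (μ' z)
  refine ⟨(Q.body.flatMap fun A => [A.src, A.tgt]).filterMap fun z => match (rep z).1 with
    | .var _ => none
    | .pos i j => some (i, j), ?_, ?_, ?_⟩
  · refine (List.length_filterMap_le _ _).trans ?_
    simp [List.length_flatMap, mul_comm]
  · intro c hc
    obtain ⟨z, -, hz⟩ := List.mem_filterMap.1 hc
    rcases hr : rep z with ⟨x | ⟨i, j⟩, hok⟩
    · simp [hr] at hz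
    · simp only [hr, Option.some.injEq] at hz
      subst hz
      exact hok
  · rintro P ω G rfl hne hcut
    have hA : ∀ z, ∃ v, z ∈ (Q.body.flatMap fun A => [A.src, A.tgt]) →
        IsPoint ω G (rep z).1 v := by
      intro z
      by_cases hz : z ∈ (Q.body.flatMap fun A => [A.src, A.tgt])
      · rcases hr : rep z with ⟨x | ⟨i, j⟩, hok⟩
        · exact ⟨.var x, fun _ => rfl⟩
        · obtain ⟨e, l₁, l₂, h3, h4, h5⟩ := hcut (i, j) (List.mem_filterMap.2 ⟨z, hz, by simp [hr]⟩)
          exact ⟨.at (G.drop i) l₂, fun _ => ⟨e, l₁, l₂, h3, h4, h5, rfl⟩⟩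
      · exact ⟨.var 0, fun h => absurd h hz⟩
    choose A hA using hA
    have heqv : ∀ {p q : List Regex} {u : GNode Var P}
        {a b : {n : CNode // n.Ok M (flatten ω G)}},
        (Quot.mk _ a : CPoint M (flatten ω G)) = Quot.mk _ b →
        (Inv ω G p u q a.1 ↔ Inv ω G p u q b.1) := by
      intro p q u a b hab
      have := Quot.eqvGen_exact hab
      clear hab
      induction this with
      | rel a b h => exact Inv.glue_iff hne h
      | refl => rfl
      | symm _ _ _ ih => exact ih.symm
      | trans _ _ _ _ _ ih ih' => exact ih.trans ih'
    have hfo : ∀ e ∈ flatten ω G, ∀ o ∈ e.2.1,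
        (fun a : Label => if a = F then none else some a) (o.getD F) = o := by
      intro e he o ho
      cases o with
      | none => simp
      | some a =>
        have := hF e he a ho
        simp [this.ne]
    have hrun : ∀ {p q q' : List Regex} {u : GNode Var P} {w : PWord}, Run q w q' →
        ∀ (w' : List Label) (a b : {n : CNode // n.Ok M (flatten ω G)}),
        w = w'.map (fun a : Label => if a = F then none else some a) →
        K.Path (Quot.mk _ a) w' (Quot.mk _ b) → Inv ω G p u q a.1 → Inv ω G p u q' b.1 := by
      intro p q q' u w hr
      induction hr with
      | refl =>
        intro w' a b hw hp hI
        obtain rfl : w' = [] := by simpa using hw.symm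
        refine (heqv ?_).1 hI
        exact hp.eq_of_nil
      | eps he _ ih => exact fun w' a b hw hp hI => ih w' a b hw hp (hI.eps he)
      | letter hl _ ih =>
        intro w' a b hw hp hI
        rcases w' with - | ⟨c, w'⟩
        · simp at hw
        · rw [List.map_cons, List.cons.injEq] at hw
          obtain ⟨t, hedge, hp⟩ := hp.exists_of_cons
          obtain ⟨a', b', e1, e2, i, j, e, o, h3, h4, h5, h6, h7⟩ := hedge
          simp only at e1 e2 h7
          subst e2
          refine ih w' b' b hw.2 hp ?_
          have hI' := (heqv e1).1 hI
          rw [h5] at hI'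
          rw [h6]
          have ho := hfo e (List.mem_of_getElem? h3) o (List.mem_of_getElem? h4)
          rw [← h7] at ho
          refine hI'.letter hne h3 h4 ?_
          rw [← ho]
          beta_reduce
          rw [← hw.1]
          exact hl
    refine ⟨A, fun a ha => ?_, ?_⟩
    · obtain ⟨w, h3, h4⟩ := h1 a ha
      have hs := hA a.src (List.mem_flatMap.2 ⟨a, ha, by simp⟩)
      have ht := hA a.tgt (List.mem_flatMap.2 ⟨a, ha, by simp⟩)
      rw [← hrep, ← hrep a.tgt] at h4
      refine (hrun (Run.of_mem_lang (f := fun a : Label => if a = F then none else some a) a.re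
        (fun c hc => ?_) h3 []) w _ _ rfl h4 (hs.inv _)).pReach hne ht
      have := hFQ a ha
      exact if_neg (hc.trans_lt this).ne
    · have hocc := Q.head_occurs
      generalize Q.head = h' at h2 hocc
      clear H
      induction h generalizing h' with
      | nil =>
        obtain rfl : h' = [] := by simpa using h2.symm
        exact .nil
      | cons x h ih =>
        rcases h' with - | ⟨y, h'⟩
        · simp at h2
        · simp only [List.map_cons, List.cons.injEq] at h2
          refine .cons ?_ (ih (fun x hx => hE x (List.mem_cons_of_mem _ hx)) h' h2.2
            fun x hx => hocc x (List.mem_cons_of_mem _ hx))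
          obtain ⟨e, he, hx⟩ := hE x List.mem_cons_self
          have hxM : x ≤ M := by
            rcases hx with rfl | rfl
            exacts [(hM' e he).1, (hM' e he).2]
          obtain ⟨a, ha, hy⟩ := hocc y List.mem_cons_self
          have hy' := hA y (List.mem_flatMap.2 ⟨a, ha, by simpa using hy⟩)
          have h3 := h2.1
          rw [hμ' x hxM, ← hrep] at h3
          exact (heqv h3.symm).1 (hy'.inv [])

end

/-! ### The states of the automaton -/

/-- The number of nodes of an expression. -/
def Regex.size : Regex → ℕ
  | plus R S => R.size + S.size + 1
  | comp R S => R.size + S.size + 1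
  | star R => R.size + 1
  | _ => 1

/-- The stacks that the automaton can reach from `r :: k` before it reaches `k`. -/
def Regex.stackList : Regex → List Regex → List (List Regex)
  | plus R S, k => (plus R S :: k) :: (R.stackList k ++ S.stackList k)
  | comp R S, k => (comp R S :: k) :: (R.stackList (S :: k) ++ S.stackList k)
  | star R, k => (star R :: k) :: R.stackList (star R :: k)
  | empty, k => [empty :: k]
  | eps, k => [eps :: k]
  | label a, k => [label a :: k]
  | any, k => [any :: k]

theorem Regex.length_stackList (r : Regex) (k : List Regex) : (r.stackList k).length = r.size := by
  induction r generalizing k with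
  | plus R S ihR ihS => simp [stackList, size, ihR, ihS]
  | comp R S ihR ihS => simp [stackList, size, ihR, ihS]
  | star R ih => simp [stackList, size, ih]
  | _ => rfl

theorem Regex.cons_mem_stackList (r : Regex) (k : List Regex) : r :: k ∈ r.stackList k := by
  cases r <;> simp [stackList]

/-- A step of the automaton, reading or not. -/
def AnyStep (p q : List Regex) : Prop := EpsStep p q ∨ ∃ o, LetterStep p o q

/-- The states in `stackList` are closed under steps, up to the continuation `k`. -/
theorem Regex.stackList_closed (r : Regex) (k : List Regex) {p q : List Regex}
    (hp : p ∈ r.stackList k) (h : AnyStep p q) : q = k ∨ q ∈ r.stackList k := by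
  induction r generalizing k with
  | empty =>
    simp only [stackList, List.mem_singleton] at hp
    subst hp
    rcases h with h | ⟨o, h⟩ <;> cases h
  | eps =>
    simp only [stackList, List.mem_singleton] at hp
    subst hp
    rcases h with h | ⟨o, h⟩ <;> cases h
    exact .inl rfl
  | label a =>
    simp only [stackList, List.mem_singleton] at hp
    subst hp
    rcases h with h | ⟨o, h⟩ <;> cases h
    exact .inl rfl
  | any =>
    simp only [stackList, List.mem_singleton] at hp
    subst hp
    rcases h with h | ⟨o, h⟩ <;> cases h
    exact .inl rfl
  | plus R S ihR ihS =>
    simp only [stackList, List.mem_cons, List.mem_append] at hp ⊢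
    rcases hp with rfl | hp | hp
    · rcases h with h | ⟨o, h⟩ <;> cases h
      · exact .inr (.inr (.inl (R.cons_mem_stackList k)))
      · exact .inr (.inr (.inr (S.cons_mem_stackList k)))
    · rcases ihR k hp with h | h
      exacts [.inl h, .inr (.inr (.inl h))]
    · rcases ihS k hp with h | h
      exacts [.inl h, .inr (.inr (.inr h))]
  | comp R S ihR ihS =>
    simp only [stackList, List.mem_cons, List.mem_append] at hp ⊢
    rcases hp with rfl | hp | hp
    · rcases h with h | ⟨o, h⟩ <;> cases h
      exact .inr (.inr (.inl (R.cons_mem_stackList _)))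
    · rcases ihR (S :: k) hp with h | h
      · exact .inr (.inr (.inr (h ▸ S.cons_mem_stackList k)))
      · exact .inr (.inr (.inl h))
    · rcases ihS k hp with h | h
      exacts [.inl h, .inr (.inr (.inr h))]
  | star R ih =>
    simp only [stackList, List.mem_cons] at hp ⊢
    rcases hp with rfl | hp
    · rcases h with h | ⟨o, h⟩ <;> cases h
      · exact .inl rfl
      · exact .inr (.inr (R.cons_mem_stackList _))
    · rcases ih (.star R :: k) hp with h | h
      exacts [.inr (.inl h), .inr (.inr h)]

/-- All states of the automata of the expressions in a query. -/
def CRPQ.states (Q : CRPQ) : List (List Regex) :=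
  [] :: Q.body.flatMap fun a => a.re.stackList []

theorem CRPQ.nil_mem_states (Q : CRPQ) : [] ∈ Q.states := List.mem_cons_self

theorem CRPQ.singleton_mem_states {Q : CRPQ} {a : Atom} (ha : a ∈ Q.body) : [a.re] ∈ Q.states :=
  List.mem_cons_of_mem _ (List.mem_flatMap.2 ⟨a, ha, a.re.cons_mem_stackList []⟩)

theorem CRPQ.states_closed {Q : CRPQ} {p q : List Regex} (hp : p ∈ Q.states) (h : AnyStep p q) :
    q ∈ Q.states := by
  rcases List.mem_cons.1 hp with rfl | hp
  · rcases h with h | ⟨o, h⟩ <;> cases h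
  · obtain ⟨a, ha, hp⟩ := List.mem_flatMap.1 hp
    rcases a.re.stackList_closed [] hp h with rfl | h
    · exact Q.nil_mem_states
    · exact List.mem_cons_of_mem _ (List.mem_flatMap.2 ⟨a, ha, h⟩)

theorem Run.mem_states {Q : CRPQ} {p q : List Regex} {w : PWord} (h : Run p w q)
    (hp : p ∈ Q.states) : q ∈ Q.states := by
  induction h with
  | refl => exact hp
  | eps h _ ih => exact ih (CRPQ.states_closed hp (.inl h))
  | letter h _ ih => exact ih (CRPQ.states_closed hp (.inr ⟨_, h⟩))

theorem PReach.mem_states {V P : Type} {ω : P → PWord} {G : PGraph V P} {Q : CRPQ}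
    {p q : List Regex} {u v : GNode V P} (h : PReach ω G p u q v) (hp : p ∈ Q.states) :
    q ∈ Q.states := by
  induction h with
  | refl => exact hp
  | eps _ h ih => exact CRPQ.states_closed ih (.inl h)
  | piece _ h ih => exact h.mem_states ih
  | fromStart _ _ ih => exact ih
  | toStart _ ih => exact ih
  | fromEnd _ _ ih => exact ih
  | toEnd _ ih => exact ih

theorem PMaps.congr {V P : Type} {ω ω' : P → PWord} {G : PGraph V P} {Q : CRPQ} {h : List V}
    (H : PMaps ω G Q h) (hω : ∀ c, ∀ p ∈ Q.states, ∀ q, Run p (ω c) q → Run p (ω' c) q) :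
    PMaps ω' G Q h := by
  have key : ∀ {p q : List Regex} {u v : GNode V P}, p ∈ Q.states → PReach ω G p u q v →
      PReach ω' G p u q v := by
    intro p q u v hp h
    induction h with
    | refl h => exact .refl h
    | eps _ h ih => exact ih.eps h
    | piece h h' ih => exact ih.piece (hω _ _ (h.mem_states hp) _ h')
    | fromStart _ h ih => exact ih.fromStart h
    | toStart _ ih => exact ih.toStart
    | fromEnd _ h ih => exact ih.fromEnd h
    | toEnd _ ih => exact ih.toEnd
  obtain ⟨A, h1, h2⟩ := H
  exact ⟨A, fun a ha => key (CRPQ.singleton_mem_states ha) (h1 a ha),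
    h2.imp fun _ _ h => key Q.nil_mem_states h⟩

/-! ### Pumping -/

/-- The `n`-fold repetition of a word. -/
def wpow (S : PWord) (n : ℕ) : PWord := (List.replicate n S).flatten

theorem wpow_add (S : PWord) (m n : ℕ) : wpow S (m + n) = wpow S m ++ wpow S n := by
  rw [wpow, List.replicate_add, List.flatten_append, wpow, wpow]

theorem length_wpow (S : PWord) (n : ℕ) : (wpow S n).length = n * S.length := by
  simp [wpow]

/-- Two powers of a word have the same effect on the automaton. -/
theorem exists_run_wpow_iff (Q : CRPQ) (S : PWord) : ∃ i j, 1 ≤ i ∧ i < j ∧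
    j ≤ 2 ^ (Q.states.length ^ 2) + 1 ∧
    ∀ p ∈ Q.states, ∀ q, Run p (wpow S i) q ↔ Run p (wpow S j) q := by
  classical
  set A := Q.states.toFinset ×ˢ Q.states.toFinset
  have hA : A.card ≤ Q.states.length ^ 2 := by
    rw [Finset.card_product, sq]
    exact Nat.mul_le_mul (List.toFinset_card_le _) (List.toFinset_card_le _)
  have hc : A.powerset.card < (Finset.Icc 1 (2 ^ (Q.states.length ^ 2) + 1)).card := by
    rw [Finset.card_powerset, Nat.card_Icc]
    have := Nat.pow_le_pow_right (n := 2) (by omega) hA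
    omega
  obtain ⟨i, hi, j, hj, hij, he⟩ := Finset.exists_ne_map_eq_of_card_lt_of_maps_to hc
    (f := fun i => A.filter fun pq => Run pq.1 (wpow S i) pq.2)
    (fun i _ => Finset.mem_coe.2 (Finset.mem_powerset.2 (Finset.filter_subset _ _)))
  have key : ∀ p ∈ Q.states, ∀ q, Run p (wpow S i) q ↔ Run p (wpow S j) q := by
    intro p hp q
    by_cases hq : q ∈ Q.states
    · have := Finset.ext_iff.1 he (p, q)
      simpa [A, hp, hq] using this
    · exact ⟨fun h => absurd (h.mem_states hp) hq, fun h => absurd (h.mem_states hp) hq⟩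
  rw [Finset.mem_Icc] at hi hj
  rcases Nat.lt_or_gt_of_ne hij with h | h
  · exact ⟨i, j, hi.1, h, hj.2, key⟩
  · exact ⟨j, i, hj.1, h, hi.2, fun p hp q => (key p hp q).symm⟩

/-- The exponents from which on a power of a word can be shortened. -/
def CRPQ.pumpBound (Q : CRPQ) : ℕ :=
  (2 * Q.body.length + 2) * (2 ^ (Q.states.length ^ 2) + 1)

theorem flatMap_map_some {S : PWord} (w : PWord) :
    (w.map some).flatMap (fun c : Option (Option Label) => c.elim S fun o => [o]) = w := by
  induction w with
  | nil => rfl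
  | cons o w ih => simpa using ih

theorem getElem?_append_cons {α : Type} {A B : List α} {m e : α} {i : ℕ}
    (h : (A ++ m :: B)[i]? = some e) : (i = A.length ∧ e = m) ∨ e ∈ A ∨ e ∈ B := by
  rcases lt_trichotomy i A.length with hi | hi | hi
  · rw [List.getElem?_append_left hi] at h
    exact .inr (.inl (List.mem_of_getElem? h))
  · subst hi
    rw [List.getElem?_append_right le_rfl] at h
    exact .inl ⟨rfl, by simpa using h.symm⟩
  · rw [List.getElem?_append_right hi.le] at h
    obtain ⟨j, hj⟩ : ∃ j, i - A.length = j + 1 := ⟨i - A.length - 1, by omega⟩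
    rw [hj, List.getElem?_cons_succ] at h
    exact .inr (.inr (List.mem_of_getElem? h))

/-- In a graph with a long power of a word on an edge, this power can be shortened in such a way
that `Good` does not become true. The reason is that if it is true after shortening, then some part
of the power that is long enough contains no image of a variable of the query, so that a power with
the same effect on the automaton can be put in its place. -/
theorem exists_pump (Q : CRPQ) (h : List Var) {S : PWord} (hS : S ≠ []) : ∃ D, 1 ≤ D ∧
    D ≤ Q.pumpBound ∧ ∀ n, Q.pumpBound ≤ n → ∀ (E₁ E₂ : List (Var × PWord × Var)) (x y : Var)
    (a b : PWord),
    (∀ z ∈ h, ∃ e ∈ E₁ ++ (x, a ++ wpow S (n - D) ++ b, y) :: E₂, z = e.1 ∨ z = e.2.2) →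
    Good Q h (E₁ ++ (x, a ++ wpow S (n - D) ++ b, y) :: E₂) →
    Good Q h (E₁ ++ (x, a ++ wpow S n ++ b, y) :: E₂) := by
  obtain ⟨i, j, hi, hij, hj, hrun⟩ := exists_run_wpow_iff Q S
  have hT : (2 * Q.body.length + 2) * (2 ^ (Q.states.length ^ 2) + 1) =
    (2 * Q.body.length + 1) * (2 ^ (Q.states.length ^ 2) + 1) +
      (2 ^ (Q.states.length ^ 2) + 1) := by ring
  refine ⟨j - i, by omega, by rw [CRPQ.pumpBound]; omega, ?_⟩
  intro n hn E₁ E₂ x y a b hz hg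
  rw [CRPQ.pumpBound] at hn
  obtain ⟨C, hC1, hC2, hC3⟩ := exists_cuts_of_good hz hg
  have hn' : (2 * Q.body.length + 1) * i ≤ n - (j - i) := by
    have : (2 * Q.body.length + 1) * i ≤
        (2 * Q.body.length + 1) * (2 ^ (Q.states.length ^ 2) + 1) :=
      Nat.mul_le_mul le_rfl (by omega)
    omega
  -- Among the first `2 * Q.body.length + 1` blocks of `i` copies of `S` there is one without a cut
  -- inside, as there are fewer cuts than blocks.
  obtain ⟨m, hm, hmC⟩ := Finset.exists_mem_notMem_of_card_lt_card
    (s := (C.map fun c => (c.2 - a.length) / (i * S.length)).toFinset)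
    (t := Finset.range (2 * Q.body.length + 1)) (by
      rw [Finset.card_range]
      have := List.toFinset_card_le (C.map fun c => (c.2 - a.length) / (i * S.length))
      rw [List.length_map] at this
      omega)
  rw [Finset.mem_range] at hm
  have hSl := List.length_pos_iff.2 hS
  have hL : 0 < i * S.length := Nat.mul_pos hi hSl
  have hmi : (m + 1) * i ≤ n - (j - i) := le_trans (Nat.mul_le_mul (by omega) le_rfl) hn'
  have hmi' : (m + 1) * i = m * i + i := by ring
  -- The pieces are single letters, and `none` for the chosen block, which has the word `wpow S t`:
  -- `t = i` gives the shorter power and `t = j` the longer one.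
  set ω : ℕ → Option (Option Label) → PWord := fun t c => c.elim (wpow S t) fun o => [o] with hω
  set G : PGraph Var (Option (Option Label)) := E₁.map (fun e => (e.1, e.2.1.map some, e.2.2)) ++
    (x, (a ++ wpow S (m * i)).map some ++ none ::
      (wpow S (n - (j - i) - (m + 1) * i) ++ b).map some,
      y) :: E₂.map (fun e => (e.1, e.2.1.map some, e.2.2)) with hG
  have hfl : ∀ t, flatten (ω t) G = E₁ ++ (x, a ++ wpow S (m * i) ++ (wpow S t ++
      (wpow S (n - (j - i) - (m + 1) * i) ++ b)), y) :: E₂ := by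
    intro t
    have hE : ∀ E : List (Var × PWord × Var),
        flatten (ω t) (E.map (fun e => (e.1, e.2.1.map some, e.2.2))) = E := by
      intro E
      induction E with
      | nil => rfl
      | cons e E ih =>
        simp only [flatten, List.map_cons] at ih ⊢
        rw [ih]
        simp only [hω, flatMap_map_some]
    have := hE E₁
    have := hE E₂
    simp only [flatten] at *
    rw [hG, List.map_append, List.map_cons, hE, hE]
    simp only [hω, List.flatMap_append, List.flatMap_cons, flatMap_map_some, Option.elim_none]
  have e1 : flatten (ω i) G = E₁ ++ (x, a ++ wpow S (n - (j - i)) ++ b, y) :: E₂ := by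
    rw [hfl, show n - (j - i) = m * i + (i + (n - (j - i) - (m + 1) * i)) by omega]
    simp only [wpow_add, List.append_assoc]
    rw [show m * i + (i + (n - (j - i) - (m + 1) * i)) - (m + 1) * i =
      n - (j - i) - (m + 1) * i by omega]
  have e2 : flatten (ω j) G = E₁ ++ (x, a ++ wpow S n ++ b, y) :: E₂ := by
    rw [hfl]
    conv_rhs => rw [show n = m * i + (j + (n - (j - i) - (m + 1) * i)) by omega]
    simp only [wpow_add, List.append_assoc]
  rw [← e2]
  refine good_of_pMaps ((hC3 _ (ω i) G e1 ?_ ?_).congr (fun c p hp q hr => ?_))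
  · intro e _ c _
    cases c with
    | none =>
      rw [← List.length_pos_iff]
      simpa [hω, length_wpow] using ⟨hi, hSl⟩
    | some o => simp [hω]
  · rintro ⟨k, t⟩ hc
    obtain ⟨e, h1, h2⟩ := hC2 _ hc
    rw [← e1] at h1
    obtain ⟨l, h3, h4⟩ := getElem?_flatten (show (flatten (ω i) G)[k]? = some (e.1, e.2.1, e.2.2)
      from h1)
    rw [h4] at h2
    have hsome : ∀ w : PWord, l = w.map some → ∃ e l₁ l₂, G[k]? = some e ∧ e.2.1 = l₁ ++ l₂ ∧
        (l₁.flatMap (ω i)).length = t := by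
      rintro w rfl
      rw [show (w.map some).flatMap (ω i) = w from flatMap_map_some w] at h2
      refine ⟨_, (w.take t).map some, (w.drop t).map some, h3, ?_, ?_⟩
      · rw [← List.map_append, List.take_append_drop]
      · rw [show ((w.take t).map some).flatMap (ω i) = w.take t from flatMap_map_some _]
        simpa using h2
    rcases getElem?_append_cons (hG ▸ h3) with ⟨h5, h6⟩ | h5 | h5
    · simp only [Prod.mk.injEq] at h6
      obtain ⟨-, rfl, -⟩ := h6
      rcases Nat.lt_or_ge (a.length + m * (i * S.length)) t with ht | ht
      · have ht2 : a.length + (m + 1) * (i * S.length) ≤ t := by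
          by_contra hlt
          apply hmC
          rw [List.mem_toFinset, List.mem_map]
          refine ⟨(k, t), hc, ?_⟩
          rw [Nat.div_eq_iff hL]
          have : (m + 1) * (i * S.length) = m * (i * S.length) + i * S.length := by ring
          constructor <;> simp only <;> omega
        set b' := wpow S (n - (j - i) - (m + 1) * i) ++ b
        have hlen : ((a ++ wpow S (m * i)).map some ++ [none]).flatMap (ω i) =
            a ++ wpow S (m * i) ++ wpow S i := by
          rw [List.flatMap_append,
            show ((a ++ wpow S (m * i)).map some).flatMap (ω i) = _ from flatMap_map_some _]
          simp [hω]
        have hlen' : (a ++ wpow S (m * i) ++ wpow S i).length =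
            a.length + (m + 1) * (i * S.length) := by
          simp only [List.length_append, length_wpow]; ring
        have h2' : t ≤ (a ++ wpow S (m * i) ++ wpow S i).length + b'.length := by
          rw [show (a ++ wpow S (m * i)).map some ++ none :: b'.map some =
            ((a ++ wpow S (m * i)).map some ++ [none]) ++ b'.map some by simp,
            List.flatMap_append, hlen,
            show (b'.map some).flatMap (ω i) = b' from flatMap_map_some _] at h2
          simpa [-List.length_flatMap, add_assoc] using h2
        refine ⟨_, (a ++ wpow S (m * i)).map some ++ [none] ++
          (b'.take (t - (a ++ wpow S (m * i) ++ wpow S i).length)).map some,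
          (b'.drop (t - (a ++ wpow S (m * i) ++ wpow S i).length)).map some, h3, ?_, ?_⟩
        · simp only [List.append_assoc, ← List.map_append, List.take_append_drop]
          simp
        · rw [List.flatMap_append, hlen,
            show ((b'.take _).map some).flatMap (ω i) = _ from flatMap_map_some _,
            List.length_append, List.length_take]
          omega
      · have hlen : (a ++ wpow S (m * i)).length = a.length + m * (i * S.length) := by
          simp only [List.length_append, length_wpow]; ring
        refine ⟨_, ((a ++ wpow S (m * i)).take t).map some, ((a ++ wpow S (m * i)).drop t).map some
          ++ none :: (wpow S (n - (j - i) - (m + 1) * i) ++ b).map some, h3, ?_, ?_⟩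
        · rw [← List.append_assoc, ← List.map_append, List.take_append_drop]
        · rw [show (((a ++ wpow S (m * i)).take t).map some).flatMap (ω i) = _ from
            flatMap_map_some _, List.length_take]
          omega
    · obtain ⟨e', -, h6⟩ := List.mem_map.1 h5
      simp only [Prod.mk.injEq] at h6
      exact hsome _ h6.2.1.symm
    · obtain ⟨e', -, h6⟩ := List.mem_map.1 h5
      simp only [Prod.mk.injEq] at h6
      exact hsome _ h6.2.1.symm
  · cases c with
    | none => exact (hrun p hp q).1 hr
    | some o => exact hr

/-! ### Succinct descriptions of words -/

/-- The power of the word `u` whose exponent is `2 ^ i` times the number with binary digits `y`,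
least significant digit first. The digits are the left subtrees along the right spine of `y`; the
digit is `1` if the subtree is not a leaf. -/
def powWord (u : PWord) : ℕ → LTree Unit → PWord
  | _, .leaf _ => []
  | i, .node (.leaf _) y => powWord u (i + 1) y
  | i, .node (.node _ _) y => wpow u (2 ^ i) ++ powWord u (i + 1) y

/-- The word of an expression of the W-fragment that results from the choices `y`: these determine
which part of a union is used, and how often strings under a star are repeated. -/
def Regex.word : Regex → LTree Unit → PWord
  | label a, _ => [some a]
  | any, _ => [none]
  | plus R _, .leaf _ => R.word (.leaf ())
  | plus R _, .node (.leaf _) y => R.word y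
  | plus _ S, .node (.node _ _) y => S.word y
  | comp R S, .leaf _ => R.word (.leaf ()) ++ S.word (.leaf ())
  | comp R S, .node y z => R.word y ++ S.word z
  | star S, y => powWord (S.word (.leaf ())) 0 y
  | empty, _ => []
  | eps, _ => []

theorem powWord_eq (u : PWord) (i : ℕ) (y : LTree Unit) : ∃ n, powWord u i y = wpow u n := by
  fun_induction powWord u i y with
  | case1 => exact ⟨0, rfl⟩
  | case2 i _ y ih => exact ih
  | case3 i _ _ y ih =>
    obtain ⟨n, hn⟩ := ih
    exact ⟨2 ^ i + n, by rw [hn, wpow_add]⟩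

theorem exists_powWord_eq (u : PWord) (K i n : ℕ) (hn : n < 2 ^ K) :
    ∃ y : LTree Unit, y.size ≤ 4 * K + 1 ∧ powWord u i y = wpow u (2 ^ i * n) := by
  induction K generalizing i n with
  | zero =>
    obtain rfl : n = 0 := by simpa using hn
    exact ⟨.leaf (), by simp [LTree.size], rfl⟩
  | succ K ih =>
    obtain ⟨y, h1, h2⟩ := ih (i + 1) (n / 2) (by rw [pow_succ] at hn; omega)
    rcases Nat.even_or_odd' n with ⟨m, rfl | rfl⟩
    · refine ⟨.node (.leaf ()) y, by simp [LTree.size]; omega, ?_⟩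
      rw [powWord, h2]
      congr 1
      rw [show 2 * m / 2 = m by omega]
      ring
    · refine ⟨.node (.node (.leaf ()) (.leaf ())) y, by simp [LTree.size]; omega, ?_⟩
      rw [powWord, h2, ← wpow_add]
      congr 1
      rw [show (2 * m + 1) / 2 = m by omega]
      ring

theorem Regex.IsString.isW {r : Regex} (h : r.IsString) : r.IsW := by
  induction h with
  | label a => exact .label a
  | any => exact .any
  | comp _ _ ihR ihS => exact .comp ihR ihS

theorem Regex.IsString.eq_word {r : Regex} (h : r.IsString) {w : PWord} (hw : w ∈ r.plang)
    (y : LTree Unit) : w = r.word y := by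
  induction h generalizing w y with
  | label a => cases y <;> exact hw
  | any => cases y <;> exact hw
  | comp _ _ ihR ihS =>
    obtain ⟨w₁, h1, w₂, h2, rfl⟩ := Language.mem_mul.1 hw
    cases y with
    | leaf => exact congrArg₂ _ (ihR h1 _) (ihS h2 _)
    | node y z => exact congrArg₂ _ (ihR h1 _) (ihS h2 _)

theorem Regex.IsString.word_ne_nil {r : Regex} (h : r.IsString) (y : LTree Unit) :
    r.word y ≠ [] := by
  induction h generalizing y with
  | label a => cases y <;> simp [word]
  | any => cases y <;> simp [word]
  | comp _ _ ihR ihS => cases y <;> simp [word, ihR]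

theorem wpow_mem_kstar {l : Language (Option Label)} {u : PWord} (h : u ∈ l) (n : ℕ) :
    wpow u n ∈ KStar.kstar l :=
  Language.mem_kstar.2 ⟨_, rfl, fun _ hy => (List.eq_of_mem_replicate hy) ▸ h⟩

theorem Regex.IsW.word_mem {r : Regex} (h : r.IsW) (y : LTree Unit) : r.word y ∈ r.plang := by
  induction r generalizing y with
  | empty => cases h
  | eps => cases h
  | label a => cases y <;> rfl
  | any => cases y <;> rfl
  | plus R S ihR ihS =>
    cases h with
    | plus hR hS =>
      rcases y with _ | ⟨_ | _, y⟩
      · exact .inl (ihR hR _)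
      · exact .inl (ihR hR _)
      · exact .inr (ihS hS _)
  | comp R S ihR ihS =>
    cases h with
    | comp hR hS =>
      cases y with
      | leaf => exact Language.mem_mul.2 ⟨_, ihR hR _, _, ihS hS _, rfl⟩
      | node y z => exact Language.mem_mul.2 ⟨_, ihR hR _, _, ihS hS _, rfl⟩
  | star S ih =>
    cases h with
    | star hS =>
      have : (Regex.star S).word y = powWord (S.word (.leaf ())) 0 y := by cases y <;> rfl
      obtain ⟨n, hn⟩ := powWord_eq (S.word (.leaf ())) 0 y
      rw [this, hn]
      exact wpow_mem_kstar (ih hS.isW _) n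

/-- A word of an expression of the W-fragment either is given by few choices, or contains a large
power of a word whose exponent can be changed. -/
theorem Regex.IsW.small_or_pow {r : Regex} (h : r.IsW) (K : ℕ) {w : PWord} (hw : w ∈ r.plang) :
    (∃ y, y.size ≤ (4 * K + 5) * r.size ∧ r.word y = w) ∨
    ∃ a S n b, w = a ++ wpow S n ++ b ∧ S ≠ [] ∧ 2 ^ K ≤ n ∧
      ∀ n', a ++ wpow S n' ++ b ∈ r.plang := by
  induction h generalizing w with
  | label a =>
    exact .inl ⟨.leaf (), by simp [LTree.size, size], (hw : w = _).symm⟩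
  | any => exact .inl ⟨.leaf (), by simp [LTree.size, size], (hw : w = _).symm⟩
  | @star S hS =>
    obtain ⟨L, rfl, hL⟩ := Language.mem_kstar.1 hw
    have hL' : L = List.replicate L.length (S.word (.leaf ())) :=
      List.eq_replicate_length.2 fun u hu => hS.eq_word (hL u hu) _
    have hf : L.flatten = wpow (S.word (.leaf ())) L.length := by
      conv_lhs => rw [hL']
      rfl
    rw [hf]
    rcases Nat.lt_or_ge L.length (2 ^ K) with hlt | hge
    · obtain ⟨y, h1, h2⟩ := exists_powWord_eq (S.word (.leaf ())) K 0 _ hlt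
      refine .inl ⟨y, h1.trans ?_, ?_⟩
      · simp only [size]; nlinarith
      · rw [pow_zero, one_mul] at h2
        rw [← h2]
        cases y <;> rfl
    · refine .inr ⟨[], _, _, [], by simp, hS.word_ne_nil (.leaf ()), hge, fun n' => ?_⟩
      rw [List.nil_append, List.append_nil]
      exact wpow_mem_kstar (hS.isW.word_mem (.leaf ())) n'
  | @comp R S _ _ ihR ihS =>
    obtain ⟨w₁, h1, w₂, h2, rfl⟩ := Language.mem_mul.1 hw
    rcases ihR h1 with ⟨y, h3, rfl⟩ | ⟨a, u, n, b, rfl, h4, h5, h6⟩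
    · rcases ihS h2 with ⟨z, h7, rfl⟩ | ⟨a, u, n, b, rfl, h4, h5, h6⟩
      · exact .inl ⟨.node y z, by simp only [LTree.size, size]; nlinarith, rfl⟩
      · refine .inr ⟨R.word y ++ a, u, n, b, by simp, h4, h5, fun n' => ?_⟩
        exact Language.mem_mul.2 ⟨_, h1, _, h6 n', by simp⟩
    · refine .inr ⟨a, u, n, b ++ w₂, by simp, h4, h5, fun n' => ?_⟩
      exact Language.mem_mul.2 ⟨_, h6 n', _, h2, by simp⟩
  | @plus R S _ _ ihR ihS =>
    rcases (Language.mem_add _ _ _).1 hw with hw | hw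
    · rcases ihR hw with ⟨y, h3, rfl⟩ | ⟨a, u, n, b, rfl, h4, h5, h6⟩
      · exact .inl ⟨.node (.leaf ()) y, by simp only [LTree.size, size]; nlinarith, rfl⟩
      · exact .inr ⟨a, u, n, b, rfl, h4, h5, fun n' => .inl (h6 n')⟩
    · rcases ihS hw with ⟨y, h3, rfl⟩ | ⟨a, u, n, b, rfl, h4, h5, h6⟩
      · exact .inl ⟨.node (.node (.leaf ()) (.leaf ())) y,
          by simp only [LTree.size, size]; nlinarith, rfl⟩
      · exact .inr ⟨a, u, n, b, rfl, h4, h5, fun n' => .inr (h6 n')⟩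

/-- Assign choices to atoms; the choices are the left subtrees along the right spine of a tree. -/
def choices : List Atom → LTree Unit → List (Var × (Regex × LTree Unit) × Var)
  | [], _ => []
  | A :: B, .leaf _ => (A.src, (A.re, .leaf ()), A.tgt) :: choices B (.leaf ())
  | A :: B, .node y Y => (A.src, (A.re, y), A.tgt) :: choices B Y

/-- The graph that results from a list of atoms and choices. -/
def choiceGraph (B : List Atom) (Y : LTree Unit) : List (Var × PWord × Var) :=
  (choices B Y).map fun e => (e.1, e.2.1.1.word e.2.1.2, e.2.2)

theorem exists_mem_choiceGraph {B : List Atom} {A : Atom} (hA : A ∈ B) (Y : LTree Unit) :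
    ∃ y, (A.src, A.re.word y, A.tgt) ∈ choiceGraph B Y := by
  induction B generalizing Y with
  | nil => simp at hA
  | cons A' B ih =>
    rcases List.mem_cons.1 hA with rfl | hA
    · cases Y with
      | leaf => exact ⟨_, List.mem_cons_self⟩
      | node y Y => exact ⟨_, List.mem_cons_self⟩
    · cases Y with
      | leaf =>
        obtain ⟨y, hy⟩ := ih hA (.leaf ())
        exact ⟨y, List.mem_cons_of_mem _ hy⟩
      | node y Y =>
        obtain ⟨y, hy⟩ := ih hA Y
        exact ⟨y, List.mem_cons_of_mem _ hy⟩

theorem good_choiceGraph {Q₁ Q₂ : CRPQ} (hW : Q₁ ∈ CRPQ.W) (h : Q₁.ContainedIn Q₂)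
    (Y : LTree Unit) : Good Q₂ Q₁.head (choiceGraph Q₁.body Y) := by
  intro K μ hμ
  refine h K ⟨μ, fun A hA => ?_, rfl⟩
  obtain ⟨y, hy⟩ := exists_mem_choiceGraph hA Y
  obtain ⟨w, h1, h2⟩ := hμ _ hy
  exact ⟨w, (A.re.mem_lang_iff w).2 ⟨_, (hW A hA).word_mem y, h1⟩, h2⟩

/-- A choice of words for the atoms in a list. -/
def IsChoice : List Atom → List (Var × PWord × Var) → Prop :=
  List.Forall₂ fun A e => e.1 = A.src ∧ e.2.1 ∈ A.re.plang ∧ e.2.2 = A.tgt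

theorem exists_choiceGraph_or_pow (K : ℕ) {B : List Atom} (hB : ∀ A ∈ B, A.re.IsW)
    {E : List (Var × PWord × Var)} (hE : IsChoice B E) :
    (∃ Y : LTree Unit, Y.size ≤ 1 + (B.map fun A => (4 * K + 5) * A.re.size + 1).sum ∧
      E = choiceGraph B Y) ∨
    ∃ E₁ x a S n b y E₂, E = E₁ ++ (x, a ++ wpow S n ++ b, y) :: E₂ ∧ S ≠ [] ∧ 2 ^ K ≤ n ∧
      ∀ n', IsChoice B (E₁ ++ (x, a ++ wpow S n' ++ b, y) :: E₂) := by
  induction hE with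
  | nil => exact .inl ⟨.leaf (), by simp [LTree.size], rfl⟩
  | @cons A e B E he hE ih =>
    obtain ⟨x, w, y⟩ := e
    obtain ⟨rfl, hw, rfl⟩ := he
    rcases (hB A List.mem_cons_self).small_or_pow K hw with ⟨c, h1, rfl⟩ |
      ⟨a, S, n, b, rfl, h2, h3, h4⟩
    · rcases ih fun A hA => hB A (List.mem_cons_of_mem _ hA) with ⟨Y, h2, rfl⟩ |
        ⟨E₁, x, a, S, n, b, y, E₂, rfl, h2, h3, h4⟩
      · refine .inl ⟨.node c Y, ?_, rfl⟩
        simp only [LTree.size, List.map_cons, List.sum_cons]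
        omega
      · exact .inr ⟨_ :: E₁, x, a, S, n, b, y, E₂, rfl, h2, h3, fun n' =>
          .cons ⟨rfl, hw, rfl⟩ (h4 n')⟩
    · exact .inr ⟨[], _, a, S, n, b, _, E, rfl, h2, h3, fun n' => .cons ⟨rfl, h4 n', rfl⟩ hE⟩

theorem IsChoice.exists_of_head {Q : CRPQ} {E : List (Var × PWord × Var)}
    (h : IsChoice Q.body E) : ∀ z ∈ Q.head, ∃ e ∈ E, z = e.1 ∨ z = e.2.2 := by
  intro z hz
  obtain ⟨A, hA, hz⟩ := Q.head_occurs z hz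
  have : ∀ B : List Atom, A ∈ B → IsChoice B E → ∃ e ∈ E, e.1 = A.src ∧ e.2.2 = A.tgt := by
    intro B hA hB
    clear h
    induction hB with
    | nil => simp at hA
    | cons he _ ih =>
      rcases List.mem_cons.1 hA with rfl | hA
      · exact ⟨_, List.mem_cons_self, he.1, he.2.2⟩
      · obtain ⟨e, h1, h2⟩ := ih hA
        exact ⟨e, List.mem_cons_of_mem _ h1, h2⟩
  obtain ⟨e, h1, h2, h3⟩ := this _ hA h
  exact ⟨e, h1, by rw [h2, h3]; exact hz⟩

theorem CRPQ.pumpBound_le (Q : CRPQ) :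
    Q.pumpBound ≤ 2 ^ (2 * Q.body.length + Q.states.length ^ 2 + 2) := by
  have h1 : 2 * Q.body.length + 2 ≤ 2 ^ (2 * Q.body.length + 1) :=
    Nat.lt_two_pow_self
  have h2 : 2 ^ (Q.states.length ^ 2) + 1 ≤ 2 ^ (Q.states.length ^ 2 + 1) := by
    have := Nat.one_le_two_pow (n := Q.states.length ^ 2)
    rw [pow_succ 2]; omega
  calc _ ≤ 2 ^ (2 * Q.body.length + 1) * 2 ^ (Q.states.length ^ 2 + 1) := Nat.mul_le_mul h1 h2
    _ = _ := by rw [← pow_add]; congr 1; omega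

/-- For the containment of queries it suffices to consider words given by few choices. -/
theorem containedIn_of_good {Q₁ Q₂ : CRPQ} (hW : Q₁ ∈ CRPQ.W)
    (h : ∀ Y : LTree Unit, Y.size ≤ 1 + (Q₁.body.map fun A =>
        (4 * (2 * Q₂.body.length + Q₂.states.length ^ 2 + 2) + 5) * A.re.size + 1).sum →
      Good Q₂ Q₁.head (choiceGraph Q₁.body Y)) : Q₁.ContainedIn Q₂ := by
  -- Induction on the total length of the words: if they are not given by few choices, then one of
  -- them contains a power that can be shortened.
  have key : ∀ N E, (E.map fun e : Var × PWord × Var => e.2.1.length).sum = N →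
      IsChoice Q₁.body E → Good Q₂ Q₁.head E := by
    intro N
    induction N using Nat.strong_induction_on with
    | _ N ih =>
      intro E hN hE
      rcases exists_choiceGraph_or_pow (2 * Q₂.body.length + Q₂.states.length ^ 2 + 2) hW hE with
        ⟨Y, h1, rfl⟩ | ⟨E₁, x, a, S, n, b, y, E₂, rfl, h1, h2, h3⟩
      · exact h Y h1
      · obtain ⟨D, hD, hDn, hD'⟩ := exists_pump Q₂ Q₁.head h1
        have hn := Q₂.pumpBound_le.trans h2
        refine hD' n hn E₁ E₂ x y a b (h3 _).exists_of_head (ih _ ?_ _ rfl (h3 _))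
        rw [← hN]
        simp only [List.map_append, List.map_cons, List.sum_append, List.sum_cons,
          List.length_append, length_wpow]
        have hS := List.length_pos_iff.2 h1
        have : (n - D) * S.length < n * S.length := Nat.mul_lt_mul_of_pos_right (by omega) hS
        omega
  intro K d hd
  obtain ⟨μ, hμ, rfl⟩ := hd
  have : ∀ B : List Atom, (∀ A ∈ B, A ∈ Q₁.body) → ∃ E, IsChoice B E ∧
      ∀ e ∈ E, K.PPath (μ e.1) e.2.1 (μ e.2.2) := by
    intro B hB
    induction B with
    | nil => exact ⟨[], .nil, by simp⟩
    | cons A B ih =>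
      obtain ⟨E, h1, h2⟩ := ih fun A hA => hB A (List.mem_cons_of_mem _ hA)
      obtain ⟨w, h3, h4⟩ := hμ A (hB A List.mem_cons_self)
      obtain ⟨u, h5, h6⟩ := (A.re.mem_lang_iff w).1 h3
      refine ⟨(A.src, u, A.tgt) :: E, .cons ⟨rfl, h5, rfl⟩ h1, fun e he => ?_⟩
      rcases List.mem_cons.1 he with rfl | he
      · exact ⟨w, h6, h4⟩
      · exact h2 e he
  obtain ⟨E, h1, h2⟩ := this Q₁.body fun _ h => h
  obtain ⟨μ', h3, h4⟩ := key _ E rfl h1 K μ h2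
  exact ⟨μ', h3, h4⟩

end CRPQContainment

namespace CRPQContainment

/-! ### Codes of queries, words and graphs as trees -/

/-- The kinds of facts. -/
inductive Tag where
  | pos | num | re | body | head | occ | occs | str | isW | expand | run | runs | eps | flat | flats
  | graph | suf | valid | reach | neq | look | maps | heads
  deriving DecidableEq

instance : Finite Tag :=
  .of_surjective (fun n : Fin 24 => Tag.ofNat n)
    fun T => ⟨⟨T.ctorIdx, by cases T <;> decide⟩, by cases T <;> rfl⟩

/-- The labels of the leaves of the trees that the Horn clauses speak about: `nl` ends lists; `exp`,
`dbl`, `pw` mark the three kinds of contents; `var`, `pt` mark the two kinds of points; `tk` embeds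
the input alphabet; `goal` and `tag` mark the facts. -/
inductive Lf where
  | nl | exp | dbl | pw | var | pt | goal
  | tk (t : Token)
  | tag (T : Tag)

instance : Finite Lf := by
  refine .of_surjective (fun x : Fin 7 ⊕ Token ⊕ Tag => Sum.elim
    ![Lf.nl, .exp, .dbl, .pw, .var, .pt, .goal] (Sum.elim .tk .tag) x) fun c => ?_
  cases c with
  | nl => exact ⟨.inl 0, rfl⟩
  | exp => exact ⟨.inl 1, rfl⟩
  | dbl => exact ⟨.inl 2, rfl⟩
  | pw => exact ⟨.inl 3, rfl⟩
  | var => exact ⟨.inl 4, rfl⟩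
  | pt => exact ⟨.inl 5, rfl⟩
  | goal => exact ⟨.inl 6, rfl⟩
  | tk t => exact ⟨.inr (.inl t), rfl⟩
  | tag T => exact ⟨.inr (.inr T), rfl⟩

/-- The trees that the Horn clauses speak about. -/
abbrev Tree : Type := LTree Lf

/-- The list of the left subtrees along the right spine. -/
def LTree.toList {L : Type} : LTree L → List (LTree L)
  | leaf _ => []
  | node a b => a :: b.toList

/-- A list of trees as a tree. -/
abbrev listCode (l : List Tree) : Tree := LTree.list .nl l

theorem toList_listCode (l : List Tree) : (listCode l).toList = l := by
  induction l with
  | nil => rfl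
  | cons a l ih => exact congrArg (a :: ·) ih

/-- A string as a tree. -/
abbrev str (s : List Token) : Tree := inputTree .nl .tk s

theorem str_injective : Function.Injective str := by
  intro s s' h
  have := congrArg LTree.toList h
  change (listCode (s.map fun c => .leaf (.tk c))).toList =
    (listCode (s'.map fun c => .leaf (.tk c))).toList at this
  rw [toList_listCode, toList_listCode] at this
  refine List.map_injective_iff.2 (fun a b h => ?_) this
  simpa using h

/-- A number as a tree: the string of its bits. -/
def numCode (n : ℕ) : Tree := str (encodeBits n)

theorem numCode_injective : Function.Injective numCode := by
  intro m n h
  refine (encodeBits_append_inj (l := []) (l' := []) ?_ ?_ ?_).1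
  · intro b; simp
  · intro b; simp
  · simpa using str_injective h

/-- An inverse of `numCode`. -/
noncomputable def decNum : Tree → ℕ := Function.invFun numCode

theorem decNum_numCode (n : ℕ) : decNum (numCode n) = n :=
  Function.leftInverse_invFun numCode_injective n

/-- An expression as a tree. -/
def Regex.code : Regex → Tree
  | empty => .leaf (.tk .empty)
  | eps => .leaf (.tk .eps)
  | any => .leaf (.tk .any)
  | label a => .node (.leaf (.tk .label)) (numCode a)
  | plus r s => .node (.leaf (.tk .plus)) (.node r.code s.code)
  | comp r s => .node (.leaf (.tk .comp)) (.node r.code s.code)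
  | star r => .node (.leaf (.tk .star)) r.code

/-- The expression with a given code; every tree is read as an expression. -/
noncomputable def decRe : Tree → Regex
  | .leaf (.tk .empty) => .empty
  | .leaf (.tk .any) => .any
  | .node (.leaf (.tk .label)) a => .label (decNum a)
  | .node (.leaf (.tk .plus)) (.node r s) => .plus (decRe r) (decRe s)
  | .node (.leaf (.tk .comp)) (.node r s) => .comp (decRe r) (decRe s)
  | .node (.leaf (.tk .star)) r => .star (decRe r)
  | _ => .eps

theorem decRe_code (r : Regex) : decRe r.code = r := by
  induction r <;> simp_all [Regex.code, decRe, decNum_numCode]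

/-- Forget the labels of the leaves. -/
def decChoice : Tree → LTree Unit
  | .leaf _ => .leaf ()
  | .node a b => .node (decChoice a) (decChoice b)

theorem decChoice_fill (y : LTree Unit) : decChoice (y.fill .nl) = y := by
  induction y <;> simp_all [LTree.fill, decChoice]

/-- A number in unary notation. -/
def natCode : ℕ → Tree
  | 0 => .leaf .nl
  | n + 1 => .node (.leaf .nl) (natCode n)

/-- The length of the right spine. -/
def decNat : Tree → ℕ
  | .leaf _ => 0
  | .node _ t => decNat t + 1

/-- Succinct descriptions of words: the word of an expression for given choices; the power of the
word of a string with exponent `2 ^ i`; and the power whose exponent is `2 ^ i` times the number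
with the binary digits `y`. -/
inductive Content where
  | exp (r : Regex) (y : LTree Unit)
  | dbl (i : ℕ) (s : Regex)
  | pw (i : ℕ) (s : Regex) (y : LTree Unit)

/-- The word described. -/
def Content.word : Content → PWord
  | exp r y => r.word y
  | dbl i s => wpow (s.word (.leaf ())) (2 ^ i)
  | pw i s y => powWord (s.word (.leaf ())) i y

/-- A description as a tree. -/
def Content.code : Content → Tree
  | exp r y => .node (.leaf .exp) (.node r.code (y.fill .nl))
  | dbl i s => .node (.leaf .dbl) (.node (natCode i) s.code)
  | pw i s y => .node (.leaf .pw) (.node (natCode i) (.node s.code (y.fill .nl)))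

/-- The description with a given code; every tree is read as a description. -/
noncomputable def decContent : Tree → Content
  | .node (.leaf .exp) (.node r y) => .exp (decRe r) (decChoice y)
  | .node (.leaf .dbl) (.node i s) => .dbl (decNat i) (decRe s)
  | .node (.leaf .pw) (.node i (.node s y)) => .pw (decNat i) (decRe s) (decChoice y)
  | _ => .exp .eps (.leaf ())

/-- The word that a tree describes. -/
noncomputable def codeWord (c : Tree) : PWord := (decContent c).word

/-- A state of the automaton as a tree. -/
def stCode (p : List Regex) : Tree := listCode (p.map Regex.code)

/-- The state with a given code. -/
noncomputable def decSt (p : Tree) : List Regex := p.toList.map decRe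

/-- An edge as a tree. -/
def edgeCode (e : Var × List Content × Var) : Tree :=
  .node (numCode e.1) (.node (listCode (e.2.1.map Content.code)) (numCode e.2.2))

/-- The edge with a given code. -/
def decEdge : Tree → Tree × List Tree × Tree
  | .node x (.node l y) => (x, l.toList, y)
  | t => (t, [], t)

/-- A graph as a tree. -/
def graphCode (G : PGraph Var Content) : Tree := listCode (G.map edgeCode)

/-- The graph with a given code. Its vertices and pieces are trees. -/
def decGraph (g : Tree) : PGraph Tree Tree := g.toList.map decEdge

/-- A point as a tree. -/
def nodeCode : GNode Var Content → Tree
  | .var x => .node (.leaf .var) (numCode x)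
  | .at g l => .node (.leaf .pt) (.node (graphCode g) (listCode (l.map Content.code)))

/-- The point with a given code. -/
def decNode : Tree → GNode Tree Tree
  | .node (.leaf .var) x => .var x
  | .node (.leaf .pt) (.node g l) => .at (decGraph g) l.toList
  | t => .var t

/-- An atom as a tree. -/
def Atom.code (A : Atom) : Tree := .node (numCode A.src) (.node A.re.code (numCode A.tgt))

/-- The atom with a given code. -/
noncomputable def decAtom : Tree → Atom
  | .node x (.node r y) => ⟨decNum x, decRe r, decNum y⟩
  | _ => ⟨0, .eps, 0⟩

theorem decAtom_code (A : Atom) : decAtom A.code = A := by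
  simp [Atom.code, decAtom, decNum_numCode, decRe_code]

/-- The body of a query as a tree. -/
def bodyCode (B : List Atom) : Tree := listCode (B.map Atom.code)

/-- The body with a given code. -/
noncomputable def decBody (b : Tree) : List Atom := b.toList.map decAtom

theorem decBody_bodyCode (B : List Atom) : decBody (bodyCode B) = B := by
  rw [decBody, bodyCode, toList_listCode, List.map_map]
  exact (List.map_congr_left fun r _ => decAtom_code r).trans B.map_id

/-- The head of a query as a tree. -/
def headCode (H : List Var) : Tree := listCode (H.map numCode)

/-- The head with a given code. -/
noncomputable def decHead (h : Tree) : List Var := h.toList.map decNum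

theorem decHead_headCode (H : List Var) : decHead (headCode H) = H := by
  rw [decHead, headCode, toList_listCode, List.map_map]
  exact (List.map_congr_left fun r _ => decNum_numCode r).trans H.map_id

open Classical in
/-- Look up a key in a list of pairs: the value of its first occurrence. -/
noncomputable def lookUp (x : Tree) : List Tree → Option Tree
  | [] => none
  | .leaf _ :: l => lookUp x l
  | .node y u :: l => if y = x then some u else lookUp x l

/-! ### The Horn clauses -/

infixr:67 " ⋈ " => Pat.node

/-- The fact with a given tag and given arguments. -/
def factCode (T : Tag) (l : List Tree) : Tree := .node (.leaf (.tag T)) (listCode l)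

/-- The pattern of a fact. -/
def Pat.fact (T : Tag) (l : List (Pat Lf)) : Pat Lf :=
  .node (.leaf (.tag T)) (l.foldr .node (.leaf .nl))

/-- The pattern of the end of a list. -/
def Pat.nl : Pat Lf := .leaf .nl

/-- The pattern of a letter. -/
def Pat.tk (t : Token) : Pat Lf := .leaf (.tk t)

/-- The pattern of an expression with choices. -/
def Pat.exp (r y : Pat Lf) : Pat Lf := .leaf .exp ⋈ r ⋈ y

/-- The pattern of a power with exponent `2 ^ i`. -/
def Pat.dbl (i s : Pat Lf) : Pat Lf := .leaf .dbl ⋈ i ⋈ s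

/-- The pattern of a power with the digits `y`. -/
def Pat.pw (i s y : Pat Lf) : Pat Lf := .leaf .pw ⋈ i ⋈ s ⋈ y

/-- The pattern of a vertex as a point. -/
def Pat.vx (x : Pat Lf) : Pat Lf := .leaf .var ⋈ x

/-- The pattern of a point on an edge. -/
def Pat.at (g l : Pat Lf) : Pat Lf := .leaf .pt ⋈ g ⋈ l

/-- The names of the clauses. -/
inductive Rule where
  | posOne | posTrue | posFalse | numNil | numPos
  | reEmpty | reEps | reAny | reLabel | rePlus | reComp | reStar
  | bodyNil | bodyCons | headNil | headCons
  | occSrc | occTgt | occTail | occsNil | occsCons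
  | strLabel | strAny | strComp
  | wLabel | wAny | wStar | wPlus | wComp
  | expComp | expCompLeaf | expPlusLeaf | expPlusLeft | expPlusRight | expStar
  | pwNil | pwZero | pwOne | dblZero | dblSucc
  | epsEps | epsPlusLeft | epsPlusRight | epsComp | epsStarNil | epsStarCons
  | runLabel | runAny | runAnyLabel | runExpand | runEpsLeft | runEpsRight | runsNil | runsCons
  | flatKeep | flatExpand | flatsNil | flatsCons
  | graphNil | graphCons | graphLeaf
  | sufRefl | sufTail | validVar | validStart | validTail
  | reachRefl | reachEpsVar | reachEpsAt | reachPiece | reachFromStart | reachToStart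
  | reachFromEnd | reachToEnd
  | neqLeft | neqRight | neqTrue | neqFalse | neqTail
  | lookHere | lookTail
  | mapsNil | mapsCons | headsNil | headsCons
  | goal
  deriving DecidableEq

instance : Finite Rule :=
  .of_surjective (fun n : Fin 90 => Rule.ofNat n)
    fun T => ⟨⟨T.ctorIdx, by cases T <;> decide⟩, by cases T <;> rfl⟩

open Pat (var nl tk exp dbl pw vx fact)

/-- The clause for a number whose lowest bit is `b`. -/
def posBit (b : Bool) : Clause Lf := ⟨[fact .pos [var 0, var 1, var 2]],
  fact .pos [tk (.bit b) ⋈ var 0, tk (.bit b) ⋈ var 1, var 2]⟩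

/-- The clause for an expression that is a letter. -/
def reLeaf (t : Token) : Clause Lf := ⟨[], fact .re [tk t ⋈ var 0, tk t, var 0]⟩

/-- The clause for an expression with a binary operation. -/
def reBin (t : Token) : Clause Lf :=
  ⟨[fact .re [var 0, var 1, var 2], fact .re [var 2, var 3, var 4]],
    fact .re [tk t ⋈ var 0, tk t ⋈ var 1 ⋈ var 3, var 4]⟩

/-- The clause for an expression of the W-fragment with a binary operation. -/
def wBin (t : Token) : Clause Lf :=
  ⟨[fact .isW [var 0], fact .isW [var 1]], fact .isW [tk t ⋈ var 0 ⋈ var 1]⟩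

/-- The clauses. -/
def rules : Rule → Clause Lf
  | .posOne => ⟨[], fact .pos [tk (.bit true) ⋈ var 0, tk (.bit true) ⋈ nl, var 0]⟩
  | .posTrue => posBit true
  | .posFalse => posBit false
  | .numNil => ⟨[], fact .num [var 0, nl, var 0]⟩
  | .numPos => ⟨[fact .pos [var 0, var 1, var 2]], fact .num [var 0, var 1, var 2]⟩
  | .reEmpty => reLeaf .empty
  | .reEps => reLeaf .eps
  | .reAny => reLeaf .any
  | .reLabel => ⟨[fact .num [var 0, var 1, var 2]],
      fact .re [tk .label ⋈ var 0, tk .label ⋈ var 1, var 2]⟩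
  | .rePlus => reBin .plus
  | .reComp => reBin .comp
  | .reStar => ⟨[fact .re [var 0, var 1, var 2]],
      fact .re [tk .star ⋈ var 0, tk .star ⋈ var 1, var 2]⟩
  | .bodyNil => ⟨[], fact .body [var 0, nl, var 0]⟩
  | .bodyCons => ⟨[fact .num [var 0, var 1, var 2], fact .re [var 2, var 3, tk .var ⋈ var 4],
      fact .num [var 4, var 5, var 6], fact .body [var 6, var 7, var 8]],
      fact .body [tk .atom ⋈ tk .var ⋈ var 0, (var 1 ⋈ var 3 ⋈ var 5) ⋈ var 7, var 8]⟩
  | .headNil => ⟨[], fact .head [var 0, nl, var 0]⟩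
  | .headCons => ⟨[fact .num [var 0, var 1, var 2], fact .head [var 2, var 3, var 4]],
      fact .head [tk .var ⋈ var 0, var 1 ⋈ var 3, var 4]⟩
  | .occSrc => ⟨[], fact .occ [var 0, (var 0 ⋈ var 1 ⋈ var 2) ⋈ var 3]⟩
  | .occTgt => ⟨[], fact .occ [var 2, (var 0 ⋈ var 1 ⋈ var 2) ⋈ var 3]⟩
  | .occTail => ⟨[fact .occ [var 0, var 2]], fact .occ [var 0, var 1 ⋈ var 2]⟩
  | .occsNil => ⟨[], fact .occs [nl, var 0]⟩
  | .occsCons => ⟨[fact .occ [var 0, var 2], fact .occs [var 1, var 2]],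
      fact .occs [var 0 ⋈ var 1, var 2]⟩
  | .strLabel => ⟨[], fact .str [tk .label ⋈ var 0]⟩
  | .strAny => ⟨[], fact .str [tk .any]⟩
  | .strComp => ⟨[fact .str [var 0], fact .str [var 1]], fact .str [tk .comp ⋈ var 0 ⋈ var 1]⟩
  | .wLabel => ⟨[], fact .isW [tk .label ⋈ var 0]⟩
  | .wAny => ⟨[], fact .isW [tk .any]⟩
  | .wStar => ⟨[fact .str [var 0]], fact .isW [tk .star ⋈ var 0]⟩
  | .wPlus => wBin .plus
  | .wComp => wBin .comp
  | .expComp => ⟨[], fact .expand [exp (tk .comp ⋈ var 0 ⋈ var 1) (var 2 ⋈ var 3),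
      exp (var 0) (var 2) ⋈ exp (var 1) (var 3) ⋈ nl]⟩
  | .expCompLeaf => ⟨[], fact .expand [exp (tk .comp ⋈ var 0 ⋈ var 1) nl,
      exp (var 0) nl ⋈ exp (var 1) nl ⋈ nl]⟩
  | .expPlusLeaf => ⟨[], fact .expand [exp (tk .plus ⋈ var 0 ⋈ var 1) nl, exp (var 0) nl ⋈ nl]⟩
  | .expPlusLeft => ⟨[], fact .expand [exp (tk .plus ⋈ var 0 ⋈ var 1) (nl ⋈ var 2),
      exp (var 0) (var 2) ⋈ nl]⟩
  | .expPlusRight => ⟨[], fact .expand [exp (tk .plus ⋈ var 0 ⋈ var 1) ((var 2 ⋈ var 3) ⋈ var 4),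
      exp (var 1) (var 4) ⋈ nl]⟩
  | .expStar => ⟨[], fact .expand [exp (tk .star ⋈ var 0) (var 1), pw nl (var 0) (var 1) ⋈ nl]⟩
  | .pwNil => ⟨[], fact .expand [pw (var 0) (var 1) nl, nl]⟩
  | .pwZero => ⟨[], fact .expand [pw (var 0) (var 1) (nl ⋈ var 2),
      pw (nl ⋈ var 0) (var 1) (var 2) ⋈ nl]⟩
  | .pwOne => ⟨[], fact .expand [pw (var 0) (var 1) ((var 2 ⋈ var 3) ⋈ var 4),
      dbl (var 0) (var 1) ⋈ pw (nl ⋈ var 0) (var 1) (var 4) ⋈ nl]⟩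
  | .dblZero => ⟨[], fact .expand [dbl nl (var 0), exp (var 0) nl ⋈ nl]⟩
  | .dblSucc => ⟨[], fact .expand [dbl (nl ⋈ var 0) (var 1),
      dbl (var 0) (var 1) ⋈ dbl (var 0) (var 1) ⋈ nl]⟩
  | .epsEps => ⟨[], fact .eps [tk .eps ⋈ var 0, var 0]⟩
  | .epsPlusLeft => ⟨[], fact .eps [(tk .plus ⋈ var 0 ⋈ var 1) ⋈ var 2, var 0 ⋈ var 2]⟩
  | .epsPlusRight => ⟨[], fact .eps [(tk .plus ⋈ var 0 ⋈ var 1) ⋈ var 2, var 1 ⋈ var 2]⟩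
  | .epsComp => ⟨[], fact .eps [(tk .comp ⋈ var 0 ⋈ var 1) ⋈ var 2, var 0 ⋈ var 1 ⋈ var 2]⟩
  | .epsStarNil => ⟨[], fact .eps [(tk .star ⋈ var 0) ⋈ var 1, var 1]⟩
  | .epsStarCons => ⟨[], fact .eps [(tk .star ⋈ var 0) ⋈ var 1,
      var 0 ⋈ (tk .star ⋈ var 0) ⋈ var 1]⟩
  | .runLabel => ⟨[], fact .run [(tk .label ⋈ var 0) ⋈ var 1, exp (tk .label ⋈ var 0) (var 2),
      var 1]⟩
  | .runAny => ⟨[], fact .run [tk .any ⋈ var 0, exp (tk .any) (var 1), var 0]⟩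
  | .runAnyLabel => ⟨[], fact .run [tk .any ⋈ var 0, exp (tk .label ⋈ var 1) (var 2), var 0]⟩
  | .runExpand => ⟨[fact .expand [var 1, var 3], fact .runs [var 0, var 3, var 2]],
      fact .run [var 0, var 1, var 2]⟩
  | .runEpsLeft => ⟨[fact .eps [var 0, var 3], fact .run [var 3, var 1, var 2]],
      fact .run [var 0, var 1, var 2]⟩
  | .runEpsRight => ⟨[fact .run [var 0, var 1, var 3], fact .eps [var 3, var 2]],
      fact .run [var 0, var 1, var 2]⟩
  | .runsNil => ⟨[], fact .runs [var 0, nl, var 0]⟩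
  | .runsCons => ⟨[fact .run [var 0, var 1, var 4], fact .runs [var 4, var 2, var 3]],
      fact .runs [var 0, var 1 ⋈ var 2, var 3]⟩
  | .flatKeep => ⟨[], fact .flat [var 0, var 1, var 0 ⋈ var 1]⟩
  | .flatExpand => ⟨[fact .expand [var 0, var 3], fact .flats [var 3, var 1, var 2]],
      fact .flat [var 0, var 1, var 2]⟩
  | .flatsNil => ⟨[], fact .flats [nl, var 0, var 0]⟩
  | .flatsCons => ⟨[fact .flats [var 1, var 2, var 4], fact .flat [var 0, var 4, var 3]],
      fact .flats [var 0 ⋈ var 1, var 2, var 3]⟩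
  | .graphNil => ⟨[], fact .graph [nl, var 0, nl]⟩
  | .graphCons => ⟨[fact .isW [var 1], fact .flat [exp (var 1) (var 3), nl, var 5],
      fact .graph [var 4, var 6, var 7]], fact .graph [(var 0 ⋈ var 1 ⋈ var 2) ⋈ var 4,
        var 3 ⋈ var 6, (var 0 ⋈ var 5 ⋈ var 2) ⋈ var 7]⟩
  | .graphLeaf => ⟨[fact .isW [var 1], fact .flat [exp (var 1) nl, nl, var 5],
      fact .graph [var 4, nl, var 7]], fact .graph [(var 0 ⋈ var 1 ⋈ var 2) ⋈ var 4,
        nl, (var 0 ⋈ var 5 ⋈ var 2) ⋈ var 7]⟩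
  | .sufRefl => ⟨[], fact .suf [var 0, var 0]⟩
  | .sufTail => ⟨[fact .suf [var 0, var 1 ⋈ var 2]], fact .suf [var 0, var 2]⟩
  | .validVar => ⟨[], fact .valid [var 0, vx (var 1)]⟩
  | .validStart => ⟨[fact .suf [var 0, (var 1 ⋈ var 2 ⋈ var 3) ⋈ var 4]],
      fact .valid [var 0, .at ((var 1 ⋈ var 2 ⋈ var 3) ⋈ var 4) (var 2)]⟩
  | .validTail => ⟨[fact .valid [var 0, .at (var 1) (var 2 ⋈ var 3)]],
      fact .valid [var 0, .at (var 1) (var 3)]⟩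
  | .reachRefl => ⟨[fact .valid [var 0, var 2]], fact .reach [var 0, var 1, var 2, var 1, var 2]⟩
  | .reachEpsVar => ⟨[fact .reach [var 0, var 1, var 2, var 3, vx (var 4)],
      fact .eps [var 3, var 5]], fact .reach [var 0, var 1, var 2, var 5, vx (var 4)]⟩
  | .reachEpsAt => ⟨[fact .reach [var 0, var 1, var 2, var 3, .at (var 4) (var 6)],
      fact .eps [var 3, var 5]], fact .reach [var 0, var 1, var 2, var 5, .at (var 4) (var 6)]⟩
  | .reachPiece => ⟨[fact .reach [var 0, var 1, var 2, var 3, .at (var 4) (var 5 ⋈ var 6)],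
      fact .run [var 3, var 5, var 7]],
      fact .reach [var 0, var 1, var 2, var 7, .at (var 4) (var 6)]⟩
  | .reachFromStart => ⟨[fact .reach [var 0, var 1, var 2, var 3, vx (var 4)],
      fact .suf [var 0, (var 4 ⋈ var 5 ⋈ var 6) ⋈ var 7]],
      fact .reach [var 0, var 1, var 2, var 3, .at ((var 4 ⋈ var 5 ⋈ var 6) ⋈ var 7) (var 5)]⟩
  | .reachToStart => ⟨[fact .reach [var 0, var 1, var 2, var 3,
      .at ((var 4 ⋈ var 5 ⋈ var 6) ⋈ var 7) (var 5)]],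
      fact .reach [var 0, var 1, var 2, var 3, vx (var 4)]⟩
  | .reachFromEnd => ⟨[fact .reach [var 0, var 1, var 2, var 3, vx (var 6)],
      fact .suf [var 0, (var 4 ⋈ var 5 ⋈ var 6) ⋈ var 7]],
      fact .reach [var 0, var 1, var 2, var 3, .at ((var 4 ⋈ var 5 ⋈ var 6) ⋈ var 7) nl]⟩
  | .reachToEnd => ⟨[fact .reach [var 0, var 1, var 2, var 3,
      .at ((var 4 ⋈ var 5 ⋈ var 6) ⋈ var 7) nl]],
      fact .reach [var 0, var 1, var 2, var 3, vx (var 6)]⟩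
  | .neqLeft => ⟨[], fact .neq [nl, var 0 ⋈ var 1]⟩
  | .neqRight => ⟨[], fact .neq [var 0 ⋈ var 1, nl]⟩
  | .neqTrue => ⟨[], fact .neq [tk (.bit true) ⋈ var 0, tk (.bit false) ⋈ var 1]⟩
  | .neqFalse => ⟨[], fact .neq [tk (.bit false) ⋈ var 0, tk (.bit true) ⋈ var 1]⟩
  | .neqTail => ⟨[fact .neq [var 1, var 2]], fact .neq [var 0 ⋈ var 1, var 0 ⋈ var 2]⟩
  | .lookHere => ⟨[], fact .look [(var 0 ⋈ var 1) ⋈ var 2, var 0, var 1]⟩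
  | .lookTail => ⟨[fact .neq [var 0, var 3], fact .look [var 2, var 3, var 4]],
      fact .look [(var 0 ⋈ var 1) ⋈ var 2, var 3, var 4]⟩
  | .mapsNil => ⟨[], fact .maps [var 0, var 1, nl]⟩
  | .mapsCons => ⟨[fact .look [var 1, var 2, var 5], fact .look [var 1, var 4, var 6],
      fact .reach [var 0, var 3 ⋈ nl, var 5, nl, var 6], fact .maps [var 0, var 1, var 7]],
      fact .maps [var 0, var 1, (var 2 ⋈ var 3 ⋈ var 4) ⋈ var 7]⟩
  | .headsNil => ⟨[], fact .heads [var 0, var 1, nl, nl]⟩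
  | .headsCons => ⟨[fact .look [var 1, var 3, var 4],
      fact .reach [var 0, nl, var 4, nl, vx (var 2)], fact .heads [var 0, var 1, var 5, var 6]],
      fact .heads [var 0, var 1, var 2 ⋈ var 5, var 3 ⋈ var 6]⟩
  | .goal => ⟨[fact .head [var 0, var 1, var 2], fact .body [var 2, var 3, tk .sep ⋈ var 4],
      fact .head [var 4, var 5, var 6], fact .body [var 6, var 7, nl], fact .occs [var 1, var 3],
      fact .occs [var 5, var 7], fact .graph [var 3, var 8, var 9],
      fact .maps [var 9, var 10, var 7], fact .heads [var 9, var 10, var 1, var 5]],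
      .leaf .goal ⋈ var 0 ⋈ var 8⟩

end CRPQContainment

namespace CRPQContainment

open Computability

/-! ### Soundness of the clauses -/

/-- What the facts with a tag mean. The facts `pos`, `num`, `re`, `body` and `head` say that the
string in the last argument results from the one in the first if the code of the object in the
second argument is removed. All other objects are read from their codes by total functions, such
that the clauses need not test whether a tree is a code. -/
def Sem : Tag → List Tree → Prop
  | .pos, [l, v, l'] => ∃ m : PosNum, v = str ((encodePosNum m).map .bit) ∧
      ∀ s, l' = str s → l = str ((encodePosNum m).map .bit ++ s)
  | .num, [l, v, l'] => ∃ n, v = numCode n ∧ ∀ s, l' = str s → l = str (encodeBits n ++ s)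
  | .re, [l, r, l'] => ∃ R : Regex, r = R.code ∧ ∀ s, l' = str s → l = str (R.encode ++ s)
  | .body, [l, b, l'] => ∃ B, b = bodyCode B ∧
      ∀ s, l' = str s → l = str (B.flatMap Atom.encode ++ s)
  | .head, [l, h, l'] => ∃ H, h = headCode H ∧ ∀ s, l' = str s → l = str (H.flatMap encodeVar ++ s)
  | .occ, [x, b] => ∃ A ∈ decBody b, decNum x = A.src ∨ decNum x = A.tgt
  | .occs, [h, b] => ∀ x ∈ decHead h, ∃ A ∈ decBody b, x = A.src ∨ x = A.tgt
  | .str, [r] => (decRe r).IsString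
  | .isW, [r] => (decRe r).IsW
  | .expand, [c, l] => l.toList.flatMap codeWord = codeWord c
  | .run, [p, c, q] => Run (decSt p) (codeWord c) (decSt q)
  | .runs, [p, l, q] => Run (decSt p) (l.toList.flatMap codeWord) (decSt q)
  | .eps, [p, q] => EpsStep (decSt p) (decSt q)
  | .flat, [c, l, l'] => l'.toList.flatMap codeWord = codeWord c ++ l.toList.flatMap codeWord
  | .flats, [c, l, l'] =>
      l'.toList.flatMap codeWord = c.toList.flatMap codeWord ++ l.toList.flatMap codeWord
  | .graph, [b, y, g] => (∀ A ∈ decBody b, A.re.IsW) ∧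
      (flatten codeWord (decGraph g)).map (fun e => (decNum e.1, e.2.1, decNum e.2.2)) =
        choiceGraph (decBody b) (decChoice y)
  | .suf, [G, g] => decGraph g <:+ decGraph G
  | .valid, [G, u] => (decNode u).Valid (decGraph G)
  | .reach, [G, p, u, q, v] =>
      PReach codeWord (decGraph G) (decSt p) (decNode u) (decSt q) (decNode v)
  | .neq, [x, y] => x ≠ y
  | .look, [a, x, u] => lookUp x a.toList = some u
  | .maps, [G, a, b] => ∀ B, b = bodyCode B → ∀ A ∈ B, ∃ u v,
      lookUp (numCode A.src) a.toList = some u ∧ lookUp (numCode A.tgt) a.toList = some v ∧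
      PReach codeWord (decGraph G) [A.re] (decNode u) [] (decNode v)
  | .heads, [G, a, h, h'] => ∀ H, h' = headCode H → List.Forall₂ (fun x y => ∃ u,
      lookUp (numCode y) a.toList = some u ∧
      PReach codeWord (decGraph G) [] (decNode u) [] (.var x)) h.toList H
  | _, _ => True

/-- What a fact means. -/
def Meaning : Tree → Prop
  | .node (.leaf (.tag T)) t => Sem T t.toList
  | .node (.leaf .goal) (.node x y) => ∃ Q₁ Q₂, x = str (encodePair Q₁ Q₂) ∧ Q₁ ∈ CRPQ.W ∧
      Good Q₂ Q₁.head (choiceGraph Q₁.body (decChoice y))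
  | _ => True

theorem Regex.word_label (a : Label) (y : LTree Unit) : (label a).word y = [some a] := by
  cases y <;> rfl

theorem Regex.word_any (y : LTree Unit) : any.word y = [none] := by
  cases y <;> rfl

theorem Regex.word_star (s : Regex) (y : LTree Unit) :
    (star s).word y = powWord (s.word (.leaf ())) 0 y := by
  cases y <;> rfl

/-- Queries may be mapped into a graph with other names for its vertices. -/
theorem Good.map {V V' : Type} (f : V → V') {Q : CRPQ} {h : List V} {E : List (V × PWord × V)}
    (H : Good Q h E) : Good Q (h.map f) (E.map fun e => (f e.1, e.2.1, f e.2.2)) := by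
  intro K μ hμ
  obtain ⟨μ', h1, h2⟩ := H K (μ ∘ f) fun e he => hμ _ (List.mem_map_of_mem he)
  exact ⟨μ', h1, by rw [List.map_map, h2]⟩

theorem headCode_toList_map (H : List Var) : (headCode H).toList.map decNum = H :=
  decHead_headCode H

theorem bodyCode_cons_eq {x r y b : Tree} {B : List Atom}
    (h : LTree.node (.node x (.node r y)) b = bodyCode B) :
    ∃ A B', B = A :: B' ∧ x = numCode A.src ∧ r = A.re.code ∧ y = numCode A.tgt ∧
      b = bodyCode B' := by
  cases B with
  | nil => cases h
  | cons A B =>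
    injection h with h1 h2
    injection h1 with h3 h4
    injection h4 with h5 h6
    exact ⟨A, B, rfl, h3, h5, h6, h2⟩

theorem headCode_cons_eq {x h : Tree} {H : List Var} (e : LTree.node x h = headCode H) :
    ∃ y H', H = y :: H' ∧ x = numCode y ∧ h = headCode H' := by
  cases H with
  | nil => cases e
  | cons y H =>
    injection e with h1 h2
    exact ⟨y, H, rfl, h1, h2⟩

theorem forall_mem_iff_foldr {α : Type} (l : List α) (P : α → Prop) :
    (∀ a ∈ l, P a) ↔ l.foldr (fun a Q => P a ∧ Q) True := by
  induction l with
  | nil => simp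
  | cons a l ih => simp [ih]

/-- The premises of the clause for the goal parse both queries, test that the variables of the heads
occur in the bodies, and give a map of the second query into a graph with the words of the choices.
-/
theorem meaning_goal {v : Fin numVars → Tree} (h1 : Sem .head [v 0, v 1, v 2])
    (h2 : Sem .body [v 2, v 3, .node (.leaf (.tk .sep)) (v 4)]) (h3 : Sem .head [v 4, v 5, v 6])
    (h4 : Sem .body [v 6, v 7, .leaf .nl]) (h5 : Sem .occs [v 1, v 3]) (h6 : Sem .occs [v 5, v 7])
    (h7 : Sem .graph [v 3, v 8, v 9]) (h8 : Sem .maps [v 9, v 10, v 7])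
    (h9 : Sem .heads [v 9, v 10, v 1, v 5]) :
    Meaning (.node (.leaf .goal) (.node (v 0) (v 8))) := by
  obtain ⟨H₁, e1, h1⟩ := h1
  obtain ⟨B₁, e2, h2⟩ := h2
  obtain ⟨H₂, e3, h3⟩ := h3
  obtain ⟨B₂, e4, h4⟩ := h4
  have h4 := h4 [] rfl
  have h3 := h3 _ h4
  have h2 := h2 (.sep :: _) (by rw [h3]; rfl)
  have h1 := h1 _ h2
  obtain ⟨h7, h10⟩ := h7
  simp only [Sem, e1, e2, e3, e4, decBody_bodyCode, decHead_headCode] at h5 h6 h7 h8 h9 h10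
  refine ⟨⟨H₁, B₁, h5⟩, ⟨H₂, B₂, h6⟩, ?_, h7, ?_⟩
  · rw [h1]
    simp [encodePair, CRPQ.encode]
  · have h8 := h8 B₂ rfl
    have h9 := h9 H₂ rfl
    have : PMaps codeWord (decGraph (v 9)) ⟨H₂, B₂, h6⟩ (headCode H₁).toList := by
      refine ⟨fun y => decNode ((lookUp (numCode y) (v 10).toList).getD (.leaf .nl)),
        fun A hA => ?_, h9.imp ?_⟩
      · obtain ⟨u, w, hu, hw, h⟩ := h8 A hA
        simpa only [hu, hw, Option.getD_some] using h
      · rintro x y ⟨u, hu, h⟩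
        simpa only [hu, Option.getD_some] using h
    have := (good_of_pMaps this).map decNum
    rwa [headCode_toList_map, h10] at this

/-- All derivable facts are true. -/
theorem Derivable.meaning {t : Tree} (h : Derivable rules t) : Meaning t := by
  induction h with
  | rule r v h ih =>
    clear h
    have h := (forall_mem_iff_foldr _ _).1 ih
    clear ih
    cases r with
    | posOne => exact ⟨1, rfl, fun s e => congrArg _ e⟩
    | posTrue =>
      obtain ⟨⟨m, h1, h2⟩, -⟩ := h
      exact ⟨.bit1 m, congrArg _ h1, fun s e => congrArg _ (h2 s e)⟩
    | posFalse =>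
      obtain ⟨⟨m, h1, h2⟩, -⟩ := h
      exact ⟨.bit0 m, congrArg _ h1, fun s e => congrArg _ (h2 s e)⟩
    | numNil => exact ⟨0, rfl, fun s e => e⟩
    | numPos =>
      obtain ⟨⟨m, h1, h2⟩, -⟩ := h
      have : encodeBits (m : ℕ) = (encodePosNum m).map .bit := by
        rw [encodeBits, encodeNat, show ((m : ℕ) : Num) = .pos m from Num.of_to_nat (.pos m)]
        rfl
      exact ⟨m, by rw [numCode, this]; exact h1, fun s e => by rw [this]; exact h2 s e⟩
    | reEmpty => exact ⟨.empty, rfl, fun s e => congrArg _ e⟩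
    | reEps => exact ⟨.eps, rfl, fun s e => congrArg _ e⟩
    | reAny => exact ⟨.any, rfl, fun s e => congrArg _ e⟩
    | reLabel =>
      obtain ⟨⟨n, h1, h2⟩, -⟩ := h
      exact ⟨.label n, congrArg _ h1, fun s e => congrArg _ (h2 s e)⟩
    | rePlus =>
      obtain ⟨⟨R, h1, h2⟩, ⟨S, h3, h4⟩, -⟩ := h
      refine ⟨.plus R S, congrArg₂ (fun a b => LTree.node _ (.node a b)) h1 h3, fun s e => ?_⟩
      rw [Regex.encode, List.cons_append, List.append_assoc]
      exact congrArg _ (h2 _ (h4 s e))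
    | reComp =>
      obtain ⟨⟨R, h1, h2⟩, ⟨S, h3, h4⟩, -⟩ := h
      refine ⟨.comp R S, congrArg₂ (fun a b => LTree.node _ (.node a b)) h1 h3, fun s e => ?_⟩
      rw [Regex.encode, List.cons_append, List.append_assoc]
      exact congrArg _ (h2 _ (h4 s e))
    | reStar =>
      obtain ⟨⟨R, h1, h2⟩, -⟩ := h
      exact ⟨.star R, congrArg _ h1, fun s e => congrArg _ (h2 s e)⟩
    | bodyNil => exact ⟨[], rfl, fun s e => e⟩
    | bodyCons =>
      obtain ⟨⟨m, h1, h2⟩, ⟨R, h3, h4⟩, ⟨n, h5, h6⟩, ⟨B, h7, h8⟩, -⟩ := h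
      refine ⟨⟨m, R, n⟩ :: B, ?_, fun s e => ?_⟩
      · change LTree.node (.node (v 1) (.node (v 3) (v 5))) (v 7) = _
        change v 1 = _ at h1
        change v 3 = _ at h3
        change v 5 = _ at h5
        change v 7 = _ at h7
        rw [h1, h3, h5, h7]
        rfl
      · have h6 := h6 _ (h8 s e)
        have h4 := h4 (.var :: (encodeBits n ++ (B.flatMap Atom.encode ++ s)))
          (by change LTree.node (.leaf (.tk .var)) (v 4) = _; change v 4 = _ at h6; rw [h6]; rfl)
        have h2 := h2 _ h4
        simp only [List.flatMap_cons, Atom.encode, encodeVar, List.cons_append, List.append_assoc]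
        exact congrArg (fun t => LTree.node (.leaf (.tk .atom)) (.node (.leaf (.tk .var)) t)) h2
    | headNil => exact ⟨[], rfl, fun s e => e⟩
    | headCons =>
      obtain ⟨⟨m, h1, h2⟩, ⟨H, h3, h4⟩, -⟩ := h
      refine ⟨m :: H, congrArg₂ LTree.node h1 h3, fun s e => ?_⟩
      simp only [List.flatMap_cons, encodeVar, List.cons_append, List.append_assoc]
      exact congrArg (LTree.node (.leaf (.tk .var))) (h2 _ (h4 s e))
    | occSrc => exact ⟨_, List.mem_cons_self, .inl rfl⟩
    | occTgt => exact ⟨_, List.mem_cons_self, .inr rfl⟩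
    | occTail =>
      obtain ⟨⟨A, h1, h2⟩, -⟩ := h
      exact ⟨A, List.mem_cons_of_mem _ h1, h2⟩
    | occsNil => exact fun x hx => absurd hx List.not_mem_nil
    | occsCons =>
      obtain ⟨h1, h2, -⟩ := h
      exact List.forall_mem_cons.2 ⟨h1, h2⟩
    | strLabel => exact Regex.IsString.label _
    | strAny => exact Regex.IsString.any
    | strComp => exact Regex.IsString.comp h.1 h.2.1
    | wLabel => exact Regex.IsW.label _
    | wAny => exact Regex.IsW.any
    | wStar => exact Regex.IsW.star h.1
    | wPlus => exact Regex.IsW.plus h.1 h.2.1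
    | wComp => exact Regex.IsW.comp h.1 h.2.1
    | expComp => exact congrArg (_ ++ ·) (List.append_nil _)
    | expCompLeaf => exact congrArg (_ ++ ·) (List.append_nil _)
    | expPlusLeaf => exact List.append_nil _
    | expPlusLeft => exact List.append_nil _
    | expPlusRight => exact List.append_nil _
    | expStar => exact (List.append_nil _).trans (Regex.word_star _ _).symm
    | pwNil => rfl
    | pwZero => exact List.append_nil _
    | pwOne => exact congrArg (_ ++ ·) (List.append_nil _)
    | dblZero =>
      refine (List.append_nil _).trans ?_
      change Regex.word _ _ = wpow _ 1
      simp [wpow]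
      rfl
    | dblSucc =>
      refine (congrArg (_ ++ ·) (List.append_nil _)).trans ?_
      change wpow _ (2 ^ decNat (v 0)) ++ wpow _ (2 ^ decNat (v 0)) =
        wpow _ (2 ^ (decNat (v 0) + 1))
      rw [← wpow_add, pow_succ, mul_two]
    | epsEps => exact EpsStep.eps _
    | epsPlusLeft => exact EpsStep.plusLeft _ _ _
    | epsPlusRight => exact EpsStep.plusRight _ _ _
    | epsComp => exact EpsStep.comp _ _ _
    | epsStarNil => exact EpsStep.starNil _ _
    | epsStarCons => exact EpsStep.starCons _ _
    | runLabel =>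
      change Run _ (Regex.word (.label (decNum (v 0))) (decChoice (v 2))) _
      rw [Regex.word_label]
      exact .of_letter (.label _ _)
    | runAny =>
      change Run _ (Regex.word .any (decChoice (v 1))) _
      rw [Regex.word_any]
      exact .of_letter (.any _ _)
    | runAnyLabel =>
      change Run _ (Regex.word (.label (decNum (v 1))) (decChoice (v 2))) _
      rw [Regex.word_label]
      exact .of_letter (.any _ _)
    | runExpand =>
      obtain ⟨h1, h2, -⟩ := h
      change (v 3).toList.flatMap codeWord = codeWord (v 1) at h1
      change Run (decSt (v 0)) (codeWord (v 1)) (decSt (v 2))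
      rw [← h1]
      exact h2
    | runEpsLeft => exact Run.eps h.1 h.2.1
    | runEpsRight =>
      have := Run.trans h.1 (.of_eps h.2.1)
      rw [List.append_nil] at this
      exact this
    | runsNil => exact Run.refl _
    | runsCons => exact Run.trans h.1 h.2.1
    | flatKeep => rfl
    | flatExpand =>
      obtain ⟨h1, h2, -⟩ := h
      change (v 3).toList.flatMap codeWord = codeWord (v 0) at h1
      refine Eq.trans h2 ?_
      exact congrArg (· ++ _) h1
    | flatsNil => rfl
    | flatsCons =>
      obtain ⟨h1, h2, -⟩ := h
      refine Eq.trans h2 ?_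
      change codeWord (v 0) ++ (v 4).toList.flatMap codeWord =
        codeWord (v 0) ++ (v 1).toList.flatMap codeWord ++ (v 2).toList.flatMap codeWord
      rw [List.append_assoc]
      exact congrArg _ h1
    | graphNil => exact ⟨fun A hA => absurd hA List.not_mem_nil, rfl⟩
    | graphCons =>
      obtain ⟨h1, h2, ⟨h3, h4⟩, -⟩ := h
      refine ⟨List.forall_mem_cons.2 ⟨h1, h3⟩, ?_⟩
      refine congrArg₂ (fun w E => (decNum (v 0), w, decNum (v 2)) :: E) ?_ h4
      exact h2.trans (List.append_nil _)
    | graphLeaf =>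
      obtain ⟨h1, h2, ⟨h3, h4⟩, -⟩ := h
      refine ⟨List.forall_mem_cons.2 ⟨h1, h3⟩, ?_⟩
      refine congrArg₂ (fun w E => (decNum (v 0), w, decNum (v 2)) :: E) ?_ h4
      exact h2.trans (List.append_nil _)
    | sufRefl => exact List.suffix_rfl
    | sufTail => exact (List.suffix_cons _ _).trans h.1
    | validVar => exact trivial
    | validStart => exact ⟨h.1, _, _, rfl, List.suffix_rfl⟩
    | validTail =>
      obtain ⟨⟨h1, e, g, h2, h3⟩, -⟩ := h
      exact ⟨h1, e, g, h2, (List.suffix_cons _ _).trans h3⟩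
    | reachRefl => exact PReach.refl h.1
    | reachEpsVar => exact PReach.eps h.1 h.2.1
    | reachEpsAt => exact PReach.eps h.1 h.2.1
    | reachPiece => exact PReach.piece h.1 h.2.1
    | reachFromStart => exact PReach.fromStart h.1 h.2.1
    | reachToStart => exact PReach.toStart h.1
    | reachFromEnd => exact PReach.fromEnd h.1 h.2.1
    | reachToEnd => exact PReach.toEnd h.1
    | neqLeft => exact fun e => by cases e
    | neqRight => exact fun e => by cases e
    | neqTrue => exact fun e => by cases e
    | neqFalse => exact fun e => by cases e
    | neqTail => exact fun e => h.1 (by injection e)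
    | lookHere => exact if_pos rfl
    | lookTail => exact (if_neg h.1).trans h.2.1
    | mapsNil =>
      intro B hB A hA
      cases B with
      | nil => exact absurd hA List.not_mem_nil
      | cons A' B => cases hB
    | mapsCons =>
      obtain ⟨h1, h2, h3, h4, -⟩ := h
      intro B hB A hA
      obtain ⟨A', B, rfl, h5, h6, h7, h8⟩ := bodyCode_cons_eq hB
      change lookUp (v 2) _ = _ at h1
      change lookUp (v 4) _ = _ at h2
      change v 3 = _ at h6
      change PReach _ _ [decRe (v 3)] _ _ _ at h3
      rcases List.mem_cons.1 hA with rfl | hA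
      · rw [h6, decRe_code] at h3
        exact ⟨_, _, h5 ▸ h1, h7 ▸ h2, h3⟩
      · exact h4 B h8 A hA
    | headsNil =>
      intro H hH
      cases H with
      | nil => exact .nil
      | cons y H => cases hH
    | headsCons =>
      obtain ⟨h1, h2, h3, -⟩ := h
      intro H hH
      obtain ⟨y, H, rfl, h4, h5⟩ := headCode_cons_eq hH
      exact .cons ⟨_, h4 ▸ h1, h2⟩ (h3 H h5)
    | goal =>
      obtain ⟨h1, h2, h3, h4, h5, h6, h7, h8, h9, -⟩ := h
      exact meaning_goal h1 h2 h3 h4 h5 h6 h7 h8 h9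

/-! ### Proofs with few trees are short -/

section

variable {L R : Type}

/-- Derivability by instances of the clauses in which all trees substituted are in `B`. -/
inductive BDer (rules : R → Clause L) (B : Set (LTree L)) : LTree L → Prop
  | rule (r : R) (σ : Fin numVars → LTree L) (hσ : ∀ i, σ i ∈ B)
      (h : ∀ p ∈ (rules r).prems, BDer rules B (p.subst σ)) :
      BDer rules B ((rules r).concl.subst σ)

theorem IsProof.append {rules : R → Clause L} {ss ss' : List (Line L R)} (h : IsProof rules ss)
    (h' : IsProof rules ss') : IsProof rules (ss ++ ss') := by
  induction ss with
  | nil => exact h'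
  | cons s ss ih =>
    refine ⟨fun p hp => ?_, ih h.2⟩
    change _ ∈ List.map _ (ss ++ ss')
    rw [List.map_append]
    exact List.mem_append_left _ (h.1 p hp)

theorem BDer.exists_isProof {rules : R → Clause L} {B : Set (LTree L)} {t : LTree L}
    (h : BDer rules B t) : ∃ ss, IsProof rules ss ∧ (∀ s ∈ ss, ∀ i, s.2 i ∈ B) ∧
      t ∈ ss.map (Line.fact rules) := by
  induction h with
  | rule r σ hσ h ih =>
    have : ∀ ps : List (Pat L), (∀ p ∈ ps, p ∈ (rules r).prems) → ∃ ss, IsProof rules ss ∧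
        (∀ s ∈ ss, ∀ i, s.2 i ∈ B) ∧ ∀ p ∈ ps, p.subst σ ∈ ss.map (Line.fact rules) := by
      intro ps hps
      induction ps with
      | nil => exact ⟨[], trivial, by simp, by simp⟩
      | cons p ps ihp =>
        obtain ⟨ss, h1, h2, h3⟩ := ihp fun p hp => hps p (List.mem_cons_of_mem _ hp)
        obtain ⟨ss', h4, h5, h6⟩ := ih p (hps p List.mem_cons_self)
        refine ⟨ss' ++ ss, h4.append h1, fun s hs => ?_, fun p' hp => ?_⟩
        · exact (List.mem_append.1 hs).elim (h5 s) (h2 s)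
        · rw [List.map_append]
          rcases List.mem_cons.1 hp with rfl | hp
          · exact List.mem_append_left _ h6
          · exact List.mem_append_right _ (h3 p' hp)
    obtain ⟨ss, h1, h2, h3⟩ := this _ fun _ hp => hp
    exact ⟨(r, σ) :: ss, ⟨h3, h1⟩, List.forall_mem_cons.2 ⟨hσ, h2⟩, List.mem_cons_self⟩

open Classical in
theorem IsProof.dedup {rules : R → Clause L} {ss : List (Line L R)} (h : IsProof rules ss) :
    IsProof rules ss.dedup := by
  induction ss with
  | nil => exact h
  | cons s ss ih =>
    by_cases hs : s ∈ ss
    · rw [List.dedup_cons_of_mem hs]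
      exact ih h.2
    · rw [List.dedup_cons_of_notMem hs]
      refine ⟨fun p hp => ?_, ih h.2⟩
      have := h.1 p hp
      rw [List.mem_map] at this ⊢
      simpa only [List.mem_dedup] using this

theorem Line.length_enc_le (s : Line L R) (M : ℕ) (h : ∀ i, (s.2 i).size ≤ M) :
    s.enc.length ≤ 1 + 12 * M := by
  have : ∀ l : List (Fin numVars), (l.flatMap fun i => (s.2 i).enc).length ≤ l.length * M := by
    intro l
    induction l with
    | nil => simp
    | cons i l ih =>
      rw [List.flatMap_cons, List.length_append, LTree.length_enc, List.length_cons, add_mul]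
      have := h i
      omega
  have : _ ≤ 12 * M := (this (List.finRange numVars)).trans_eq
    (congrArg (· * M) List.length_finRange)
  rw [Line.enc, List.length_cons, List.length_map]
  omega

/-- A fact that can be derived with few small trees has a short proof: a shortest proof does not
repeat lines. -/
theorem BDer.exists_short [Finite R] {rules : R → Clause L} (B : List (LTree L))
    (M : ℕ) (hM : ∀ b ∈ B, b.size ≤ M) {t : LTree L} (h : BDer rules {b | b ∈ B} t) :
    ∃ ss, IsProof rules ss ∧ t ∈ ss.map (Line.fact rules) ∧
      (ss.flatMap Line.enc).length ≤ Nat.card R * B.length ^ 12 * (1 + 12 * M) := by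
  classical
  have := Fintype.ofFinite R
  obtain ⟨ss, h1, h2, h3⟩ := h.exists_isProof
  refine ⟨ss.dedup, h1.dedup, ?_, ?_⟩
  · rw [List.mem_map] at h3 ⊢
    simpa only [List.mem_dedup] using h3
  · have hc : ss.dedup.length ≤ Nat.card R * B.length ^ 12 := by
      rw [← List.toFinset_card_of_nodup ss.nodup_dedup]
      have hsub : ss.dedup.toFinset ⊆
          (Finset.univ : Finset R) ×ˢ Fintype.piFinset fun _ : Fin numVars => B.toFinset := by
        intro s hs
        rw [List.mem_toFinset, List.mem_dedup] at hs
        simpa using h2 s hs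
      refine (Finset.card_le_card hsub).trans ?_
      rw [Finset.card_product, Fintype.card_piFinset_const, Finset.card_univ,
        Nat.card_eq_fintype_card]
      gcongr
      exact B.toFinset_card_le
    have hl : ∀ l : List (Line L R), (∀ s ∈ l, s ∈ ss) →
        (l.flatMap Line.enc).length ≤ l.length * (1 + 12 * M) := by
      intro l hl
      induction l with
      | nil => simp
      | cons s l ih =>
        have := ih fun s hs => hl s (List.mem_cons_of_mem _ hs)
        have := s.length_enc_le M fun i => hM _ (h2 s (hl s List.mem_cons_self) i)
        rw [List.flatMap_cons, List.length_append, List.length_cons, add_mul]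
        omega
    exact (hl _ fun s hs => List.mem_dedup.1 hs).trans (Nat.mul_le_mul_right _ hc)

/-- The list of the subtrees of a tree. -/
def LTree.subtrees : LTree L → List (LTree L)
  | leaf c => [leaf c]
  | node a b => node a b :: (a.subtrees ++ b.subtrees)

theorem LTree.length_subtrees (t : LTree L) : t.subtrees.length = t.size := by
  induction t with
  | leaf c => rfl
  | node a b iha ihb => simp [subtrees, size, iha, ihb]

theorem LTree.self_mem_subtrees (t : LTree L) : t ∈ t.subtrees := by
  cases t <;> exact List.mem_cons_self

theorem LTree.size_le_of_mem_subtrees {t u : LTree L} (h : u ∈ t.subtrees) : u.size ≤ t.size := by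
  induction t with
  | leaf c => rw [List.mem_singleton.1 h]
  | node a b iha ihb =>
    rcases List.mem_cons.1 h with rfl | h
    · exact le_rfl
    · rw [size]
      rcases List.mem_append.1 h with h | h
      · exact (iha h).trans (by omega)
      · exact (ihb h).trans (by omega)

theorem LTree.mem_subtrees_of_node {t a b : LTree L} (h : node a b ∈ t.subtrees) :
    a ∈ t.subtrees ∧ b ∈ t.subtrees := by
  induction t with
  | leaf c => exact absurd (List.mem_singleton.1 h) (by simp)
  | node c d ihc ihd =>
    rcases List.mem_cons.1 h with h | h
    · injection h with h1 h2
      subst h1 h2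
      exact ⟨List.mem_cons_of_mem _ (List.mem_append_left _ a.self_mem_subtrees),
        List.mem_cons_of_mem _ (List.mem_append_right _ b.self_mem_subtrees)⟩
    · rcases List.mem_append.1 h with h | h
      · exact ⟨List.mem_cons_of_mem _ (List.mem_append_left _ (ihc h).1),
          List.mem_cons_of_mem _ (List.mem_append_left _ (ihc h).2)⟩
      · exact ⟨List.mem_cons_of_mem _ (List.mem_append_right _ (ihd h).1),
          List.mem_cons_of_mem _ (List.mem_append_right _ (ihd h).2)⟩

end

/-- Sets of trees that contain the subtrees of their elements, and the empty list. -/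
structure IsClosed (B : Set Tree) : Prop where
  nil : .leaf .nl ∈ B
  sub : ∀ {a b}, LTree.node a b ∈ B → a ∈ B ∧ b ∈ B

theorem IsClosed.left {B : Set Tree} (hB : IsClosed B) {a b : Tree} (h : LTree.node a b ∈ B) :
    a ∈ B := (hB.sub h).1

theorem IsClosed.right {B : Set Tree} (hB : IsClosed B) {a b : Tree} (h : LTree.node a b ∈ B) :
    b ∈ B := (hB.sub h).2

/-- Apply a clause; the trees substituted for the variables are given as a list. -/
theorem IsClosed.der {B : Set Tree} (hB : IsClosed B) (r : Rule) (l : List Tree)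
    (hl : l.foldr (fun t P => t ∈ B ∧ P) True)
    (h : (rules r).prems.foldr (fun p P => BDer rules B
      (p.subst fun i => l.getD i (.leaf .nl)) ∧ P) True) {t : Tree}
    (ht : (rules r).concl.subst (fun i => l.getD i (.leaf .nl)) = t) : BDer rules B t := by
  rw [← ht]
  refine .rule r _ (fun i => ?_) ((forall_mem_iff_foldr _ _).2 h)
  have hl := (forall_mem_iff_foldr l (· ∈ B)).2 hl
  rw [List.getD_eq_getElem?_getD]
  cases hi : l[(i : ℕ)]? with
  | none => exact hB.nil
  | some a => exact hl a (List.mem_of_getElem? hi)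

/-! ### Completeness of the clauses: parsing -/

/-! Conjunctions that end in `True`: this is what `IsClosed.der` asks for after its lists of trees
and of premises are unfolded. -/

theorem all₁ {p : Prop} (h : p) : p ∧ True := ⟨h, trivial⟩

theorem all₂ {p q : Prop} (hp : p) (hq : q) : p ∧ q ∧ True := ⟨hp, all₁ hq⟩

theorem all₃ {p q r : Prop} (hp : p) (hq : q) (hr : r) : p ∧ q ∧ r ∧ True := ⟨hp, all₂ hq hr⟩

theorem all₄ {p q r s : Prop} (hp : p) (hq : q) (hr : r) (hs : s) : p ∧ q ∧ r ∧ s ∧ True :=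
  ⟨hp, all₃ hq hr hs⟩

section

variable {B : Set Tree}

theorem IsClosed.str_of_append (hB : IsClosed B) {s s' : List Token} (h : str (s ++ s') ∈ B) :
    str s' ∈ B := by
  induction s with
  | nil => exact h
  | cons t s ih => exact ih (hB.right h)

theorem IsClosed.of_listCode (hB : IsClosed B) {l : List Tree} (h : listCode l ∈ B) :
    ∀ t ∈ l, t ∈ B := by
  induction l with
  | nil => simp
  | cons t l ih => exact List.forall_mem_cons.2 ⟨hB.left h, ih (hB.right h)⟩

theorem IsClosed.pos (hB : IsClosed B) (m : PosNum) (s : List Token)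
    (h : str ((encodePosNum m).map .bit ++ s) ∈ B) (h' : str ((encodePosNum m).map .bit) ∈ B) :
    BDer rules B (factCode .pos [str ((encodePosNum m).map .bit ++ s),
      str ((encodePosNum m).map .bit), str s]) := by
  induction m with
  | one => exact hB.der .posOne [str s] (all₁ (hB.right h)) trivial rfl
  | bit1 m ih =>
    exact hB.der .posTrue [str ((encodePosNum m).map Token.bit ++ s),
      str ((encodePosNum m).map Token.bit), str s]
      (all₃ (hB.right h) (hB.right h') (hB.str_of_append h))
      (all₁ (ih (hB.right h) (hB.right h'))) rfl
  | bit0 m ih =>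
    exact hB.der .posFalse [str ((encodePosNum m).map Token.bit ++ s),
      str ((encodePosNum m).map Token.bit), str s]
      (all₃ (hB.right h) (hB.right h') (hB.str_of_append h))
      (all₁ (ih (hB.right h) (hB.right h'))) rfl

theorem IsClosed.num (hB : IsClosed B) (n : ℕ) (s : List Token) (h : str (encodeBits n ++ s) ∈ B)
    (h' : numCode n ∈ B) :
    BDer rules B (factCode .num [str (encodeBits n ++ s), numCode n, str s]) := by
  cases hn : (n : Num) with
  | zero =>
    have : encodeBits n = [] := by rw [encodeBits, encodeNat, hn]; rfl
    rw [numCode, this] at h' ⊢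
    rw [this] at h
    exact hB.der .numNil [str s] (all₁ h) trivial rfl
  | pos m =>
    have : encodeBits n = (encodePosNum m).map .bit := by rw [encodeBits, encodeNat, hn]; rfl
    rw [numCode, this] at h' ⊢
    rw [this] at h
    exact hB.der .numPos [_, _, _] (all₃ h h' (hB.str_of_append h)) (all₁ (hB.pos m s h h')) rfl

theorem IsClosed.re (hB : IsClosed B) (r : Regex) (s : List Token) (h : str (r.encode ++ s) ∈ B)
    (h' : r.code ∈ B) : BDer rules B (factCode .re [str (r.encode ++ s), r.code, str s]) := by
  induction r generalizing s with
  | empty => exact hB.der .reEmpty [str s] (all₁ (hB.right h)) trivial rfl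
  | eps => exact hB.der .reEps [str s] (all₁ (hB.right h)) trivial rfl
  | any => exact hB.der .reAny [str s] (all₁ (hB.right h)) trivial rfl
  | label n =>
    exact hB.der .reLabel [str (encodeBits n ++ s), numCode n, str s]
      (all₃ (hB.right h) (hB.right h') (hB.str_of_append h))
      (all₁ (hB.num n s (hB.right h) (hB.right h'))) rfl
  | star r ih =>
    exact hB.der .reStar [str (r.encode ++ s), r.code, str s]
      (all₃ (hB.right h) (hB.right h') (hB.str_of_append h))
      (all₁ (ih s (hB.right h) (hB.right h'))) rfl
  | plus r r' ih ih' =>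
    rw [Regex.encode, List.cons_append, List.append_assoc] at *
    have h1 := hB.right h
    have h2 := hB.str_of_append h1
    have h3 := hB.left (hB.right h')
    have h4 := hB.right (hB.right h')
    exact hB.der .rePlus [str (r.encode ++ (r'.encode ++ s)), r.code, str (r'.encode ++ s), r'.code,
      str s] ⟨h1, h3, h2, all₂ h4 (hB.str_of_append h2)⟩ (all₂ (ih _ h1 h3) (ih' _ h2 h4)) rfl
  | comp r r' ih ih' =>
    rw [Regex.encode, List.cons_append, List.append_assoc] at *
    have h1 := hB.right h
    have h2 := hB.str_of_append h1
    have h3 := hB.left (hB.right h')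
    have h4 := hB.right (hB.right h')
    exact hB.der .reComp [str (r.encode ++ (r'.encode ++ s)), r.code, str (r'.encode ++ s), r'.code,
      str s] ⟨h1, h3, h2, all₂ h4 (hB.str_of_append h2)⟩ (all₂ (ih _ h1 h3) (ih' _ h2 h4)) rfl

theorem IsClosed.body (hB : IsClosed B) (b : List Atom) (s : List Token)
    (h : str (b.flatMap Atom.encode ++ s) ∈ B) (h' : bodyCode b ∈ B) :
    BDer rules B (factCode .body [str (b.flatMap Atom.encode ++ s), bodyCode b, str s]) := by
  induction b with
  | nil => exact hB.der .bodyNil [str s] (all₁ h) trivial rfl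
  | cons A b ih =>
    simp only [List.flatMap_cons, Atom.encode, encodeVar, List.cons_append, List.append_assoc] at *
    have h1 := hB.right (hB.right h)
    have h2 := hB.str_of_append h1
    have h3 := hB.right (hB.str_of_append h2)
    have h4 := hB.str_of_append h3
    have h5 := hB.left h'
    exact hB.der .bodyCons [_, numCode A.src, _, A.re.code, _, numCode A.tgt, _, bodyCode b, str s]
      ⟨h1, hB.left h5, h2, hB.left (hB.right h5), h3,
        all₄ (hB.right (hB.right h5)) h4 (hB.right h') (hB.str_of_append h4)⟩
      (all₄ (hB.num _ _ h1 (hB.left h5)) (hB.re _ _ h2 (hB.left (hB.right h5)))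
        (hB.num _ _ h3 (hB.right (hB.right h5))) (ih h4 (hB.right h'))) rfl

theorem IsClosed.head (hB : IsClosed B) (H : List Var) (s : List Token)
    (h : str (H.flatMap encodeVar ++ s) ∈ B) (h' : headCode H ∈ B) :
    BDer rules B (factCode .head [str (H.flatMap encodeVar ++ s), headCode H, str s]) := by
  induction H with
  | nil => exact hB.der .headNil [str s] (all₁ h) trivial rfl
  | cons x H ih =>
    simp only [List.flatMap_cons, encodeVar, List.cons_append, List.append_assoc] at *
    have h1 := hB.right h
    have h2 := hB.str_of_append h1
    exact hB.der .headCons [_, numCode x, _, headCode H, str s]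
      ⟨h1, hB.left h', all₃ h2 (hB.right h') (hB.str_of_append h2)⟩
      (all₂ (hB.num _ _ h1 (hB.left h')) (ih h2 (hB.right h'))) rfl

theorem IsClosed.occ (hB : IsClosed B) {x : Var} {b : List Atom} (h : bodyCode b ∈ B)
    (hx : ∃ A ∈ b, x = A.src ∨ x = A.tgt) :
    numCode x ∈ B ∧ BDer rules B (factCode .occ [numCode x, bodyCode b]) := by
  obtain ⟨A, hA, hx⟩ := hx
  induction b with
  | nil => simp at hA
  | cons A' b ih =>
    have h1 := hB.left h
    rcases List.mem_cons.1 hA with rfl | hA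
    · rcases hx with rfl | rfl
      · exact ⟨hB.left h1, hB.der .occSrc [numCode A.src, A.re.code, numCode A.tgt, bodyCode b]
          (all₄ (hB.left h1) (hB.left (hB.right h1)) (hB.right (hB.right h1)) (hB.right h))
          trivial rfl⟩
      · exact ⟨hB.right (hB.right h1),
          hB.der .occTgt [numCode A.src, A.re.code, numCode A.tgt, bodyCode b]
          (all₄ (hB.left h1) (hB.left (hB.right h1)) (hB.right (hB.right h1)) (hB.right h))
          trivial rfl⟩
    · obtain ⟨h2, h3⟩ := ih (hB.right h) hA
      exact ⟨h2, hB.der .occTail [numCode x, A'.code, bodyCode b] (all₃ h2 h1 (hB.right h))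
        (all₁ h3) rfl⟩

theorem IsClosed.occs (hB : IsClosed B) {H : List Var} {b : List Atom} (h : bodyCode b ∈ B)
    (h' : headCode H ∈ B) (hH : ∀ x ∈ H, ∃ A ∈ b, x = A.src ∨ x = A.tgt) :
    BDer rules B (factCode .occs [headCode H, bodyCode b]) := by
  induction H with
  | nil => exact hB.der .occsNil [bodyCode b] (all₁ h) trivial rfl
  | cons x H ih =>
    rw [List.forall_mem_cons] at hH
    exact hB.der .occsCons [numCode x, headCode H, bodyCode b]
      (all₃ (hB.left h') (hB.right h') h)
      (all₂ (hB.occ h hH.1).2 (ih (hB.right h') hH.2)) rfl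

theorem IsClosed.isString (hB : IsClosed B) {r : Regex} (h : r.code ∈ B) (hr : r.IsString) :
    BDer rules B (factCode .str [r.code]) := by
  induction hr with
  | label a => exact hB.der .strLabel [numCode a] (all₁ (hB.right h)) trivial rfl
  | any => exact hB.der .strAny [] trivial trivial rfl
  | @comp r s _ _ ihr ihs =>
    have h1 := hB.sub (hB.right h)
    exact hB.der .strComp [r.code, s.code] (all₂ h1.1 h1.2) (all₂ (ihr h1.1) (ihs h1.2)) rfl

theorem IsClosed.isW (hB : IsClosed B) {r : Regex} (h : r.code ∈ B) (hr : r.IsW) :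
    BDer rules B (factCode .isW [r.code]) := by
  induction hr with
  | label a => exact hB.der .wLabel [numCode a] (all₁ (hB.right h)) trivial rfl
  | any => exact hB.der .wAny [] trivial trivial rfl
  | @star s hs =>
    exact hB.der .wStar [s.code] (all₁ (hB.right h)) (all₁ (hB.isString (hB.right h) hs)) rfl
  | @comp r s _ _ ihr ihs =>
    have h1 := hB.sub (hB.right h)
    exact hB.der .wComp [r.code, s.code] (all₂ h1.1 h1.2) (all₂ (ihr h1.1) (ihs h1.2)) rfl
  | @plus r s _ _ ihr ihs =>
    have h1 := hB.sub (hB.right h)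
    exact hB.der .wPlus [r.code, s.code] (all₂ h1.1 h1.2) (all₂ (ihr h1.1) (ihs h1.2)) rfl

theorem IsClosed.eps (hB : IsClosed B) {p q : List Regex} (h : stCode p ∈ B) (e : EpsStep p q) :
    BDer rules B (factCode .eps [stCode p, stCode q]) := by
  cases e with
  | eps => exact hB.der .epsEps [stCode q] (all₁ (hB.right h)) trivial rfl
  | plusLeft r s k =>
    have h1 := hB.right h
    have h2 := hB.sub (hB.right (hB.left h))
    exact hB.der .epsPlusLeft [r.code, s.code, stCode k] (all₃ h2.1 h2.2 h1) trivial rfl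
  | plusRight r s k =>
    have h1 := hB.right h
    have h2 := hB.sub (hB.right (hB.left h))
    exact hB.der .epsPlusRight [r.code, s.code, stCode k] (all₃ h2.1 h2.2 h1) trivial rfl
  | comp r s k =>
    have h1 := hB.right h
    have h2 := hB.sub (hB.right (hB.left h))
    exact hB.der .epsComp [r.code, s.code, stCode k] (all₃ h2.1 h2.2 h1) trivial rfl
  | starNil r =>
    exact hB.der .epsStarNil [r.code, stCode q] (all₂ (hB.right (hB.left h)) (hB.right h)) trivial
      rfl
  | starCons r k =>
    exact hB.der .epsStarCons [r.code, stCode k] (all₂ (hB.right (hB.left h)) (hB.right h)) trivial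
      rfl

end

/-! ### Dividing words into pieces -/

namespace Content

/-- The words that are described are words of expressions of the W-fragment. -/
def Ok : Content → Prop
  | exp r _ => r.IsW
  | dbl _ s => s.IsString
  | pw _ s _ => s.IsString

/-- The descriptions of single letters and wildcards. -/
def IsLetter : Content → Prop
  | exp (.label _) _ => True
  | exp .any _ => True
  | _ => False

/-- The word described as a concatenation of at most two words. -/
def expand : Content → List Content
  | exp (.comp r s) (.leaf _) => [exp r (.leaf ()), exp s (.leaf ())]
  | exp (.comp r s) (.node y z) => [exp r y, exp s z]
  | exp (.plus r _) (.leaf _) => [exp r (.leaf ())]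
  | exp (.plus r _) (.node (.leaf _) y) => [exp r y]
  | exp (.plus _ s) (.node (.node _ _) y) => [exp s y]
  | exp (.star s) y => [pw 0 s y]
  | exp _ _ => []
  | dbl 0 s => [exp s (.leaf ())]
  | dbl (i + 1) s => [dbl i s, dbl i s]
  | pw _ _ (.leaf _) => []
  | pw i s (.node (.leaf _) y) => [pw (i + 1) s y]
  | pw i s (.node (.node _ _) y) => [dbl i s, pw (i + 1) s y]

/-- A measure that decreases when a description is expanded. -/
def measure : Content → ℕ
  | exp r y => r.size + 2 * y.size
  | dbl i s => i + 3 + s.size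
  | pw i s y => i + s.size + 2 * y.size

theorem expand_length (C : Content) : C.expand.length ≤ 2 := by
  fun_cases expand C <;> simp

theorem expand_word {C : Content} (h : C.Ok) (h' : ¬C.IsLetter) :
    C.expand.flatMap word = C.word := by
  fun_cases expand C with
  | case7 r y h1 h2 h3 =>
    cases r with
    | empty => cases h
    | eps => cases h
    | label => exact absurd trivial h'
    | any => exact absurd trivial h'
    | plus => rcases y with _ | ⟨_ | _, _⟩ <;> grind
    | comp => cases y <;> grind
    | star => simp_all
  | case6 s y => simp [word, Regex.word_star]
  | case8 s => simp [word, wpow]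
  | case9 i s => simp [word, ← wpow_add, pow_succ, mul_two]
  | _ => simp [word, Regex.word, powWord]

theorem expand_ok {C : Content} (h : C.Ok) : ∀ D ∈ C.expand, D.Ok := by
  fun_cases expand C with
  | case7 => simp
  | case10 => simp
  | case1 => cases h with | comp h1 h2 => simp [Ok, h1, h2]
  | case2 => cases h with | comp h1 h2 => simp [Ok, h1, h2]
  | case3 => cases h with | plus h1 h2 => simp [Ok, h1]
  | case4 => cases h with | plus h1 h2 => simp [Ok, h1]
  | case5 => cases h with | plus h1 h2 => simp [Ok, h2]
  | case6 => cases h with | star h1 => simp [Ok, h1]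
  | case8 s => simpa [Ok] using Regex.IsString.isW h
  | _ => simpa [Ok] using h

theorem expand_measure (C : Content) : ∀ D ∈ C.expand, D.measure < C.measure := by
  fun_cases expand C with
  | case12 i s a b y =>
    have := a.size_pos
    have := b.size_pos
    have := y.size_pos
    simp [measure, LTree.size]
    omega
  | case1 r s y => simp [measure, LTree.size, Regex.size]
  | case2 r s y z =>
    have := y.size_pos
    have := z.size_pos
    simp [measure, LTree.size, Regex.size]; omega
  | case9 => simp [measure]
  | case8 => simp [measure, LTree.size]; omega
  | case7 => simp
  | case10 => simp
  | case11 => simp [measure, LTree.size]; omega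
  | _ => simp [measure, LTree.size, Regex.size] <;> omega

end Content

section

variable {B : Set Tree} {C : Content} {Q : CRPQ}

theorem IsClosed.expand (hB : IsClosed B) (h : C.Ok) (h' : ¬C.IsLetter) (hC : C.code ∈ B) :
    BDer rules B (factCode .expand [C.code, listCode (C.expand.map Content.code)]) := by
  fun_cases Content.expand C with
  | case1 r s _ =>
    have h2 := hB.sub (hB.right (hB.left (hB.right hC)))
    exact hB.der .expCompLeaf [r.code, s.code] (all₂ h2.1 h2.2) trivial rfl
  | case2 r s y z =>
    have h2 := hB.sub (hB.right (hB.left (hB.right hC)))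
    have h3 := hB.sub (hB.right (hB.right hC))
    exact hB.der .expComp [r.code, s.code, y.fill .nl, z.fill .nl] (all₄ h2.1 h2.2 h3.1 h3.2)
      trivial rfl
  | case3 r s _ =>
    have h2 := hB.sub (hB.right (hB.left (hB.right hC)))
    exact hB.der .expPlusLeaf [r.code, s.code] (all₂ h2.1 h2.2) trivial rfl
  | case4 r s _ y =>
    have h2 := hB.sub (hB.right (hB.left (hB.right hC)))
    exact hB.der .expPlusLeft [r.code, s.code, y.fill .nl]
      (all₃ h2.1 h2.2 (hB.right (hB.right (hB.right hC)))) trivial rfl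
  | case5 r s a b y =>
    have h2 := hB.sub (hB.right (hB.left (hB.right hC)))
    have h3 := hB.sub (hB.right (hB.right hC))
    have h4 := hB.sub h3.1
    exact hB.der .expPlusRight [r.code, s.code, a.fill .nl, b.fill .nl, y.fill .nl]
      ⟨h2.1, all₄ h2.2 h4.1 h4.2 h3.2⟩ trivial rfl
  | case6 s y =>
    exact hB.der .expStar [s.code, y.fill .nl]
      (all₂ (hB.right (hB.left (hB.right hC))) (hB.right (hB.right hC))) trivial rfl
  | case7 r y h1 h2 h3 =>
    cases r with
    | empty => cases h
    | eps => cases h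
    | label => exact absurd trivial h'
    | any => exact absurd trivial h'
    | plus => rcases y with _ | ⟨_ | _, _⟩ <;> grind
    | comp => cases y <;> grind
    | star => simp_all
  | case8 s => exact hB.der .dblZero [s.code] (all₁ (hB.right (hB.right hC))) trivial rfl
  | case9 i s =>
    exact hB.der .dblSucc [natCode i, s.code]
      (all₂ (hB.right (hB.left (hB.right hC))) (hB.right (hB.right hC))) trivial rfl
  | case10 i s _ =>
    have h2 := hB.sub (hB.right hC)
    exact hB.der .pwNil [natCode i, s.code] (all₂ h2.1 (hB.left h2.2)) trivial rfl
  | case11 i s _ y =>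
    have h2 := hB.sub (hB.right hC)
    have h3 := hB.sub h2.2
    exact hB.der .pwZero [natCode i, s.code, y.fill .nl] (all₃ h2.1 h3.1 (hB.right h3.2))
      trivial rfl
  | case12 i s a b y =>
    have h2 := hB.sub (hB.right hC)
    have h3 := hB.sub h2.2
    have h4 := hB.sub (hB.left h3.2)
    exact hB.der .pwOne [natCode i, s.code, a.fill .nl, b.fill .nl, y.fill .nl]
      ⟨h2.1, all₄ h3.1 h4.1 h4.2 (hB.right h3.2)⟩ trivial rfl

/-- The description of pieces are in `B`, and so are the lists that result from expanding them. -/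
structure ContentsIn (B : Set Tree) (𝒞 : Set Content) : Prop where
  ok : ∀ C ∈ 𝒞, C.Ok
  code : ∀ C ∈ 𝒞, C.code ∈ B
  expand_code : ∀ C ∈ 𝒞, listCode (C.expand.map Content.code) ∈ B
  expand_mem : ∀ C ∈ 𝒞, ∀ D ∈ C.expand, D ∈ 𝒞

theorem IsClosed.run_eps_right (hB : IsClosed B) (hQ : ∀ p ∈ Q.states, stCode p ∈ B)
    {p q r : List Regex} {c : Tree} (hp : p ∈ Q.states) (hq : q ∈ Q.states) (hc : c ∈ B)
    (h : BDer rules B (factCode .run [stCode p, c, stCode q])) (h' : Run q [] r) :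
    BDer rules B (factCode .run [stCode p, c, stCode r]) := by
  generalize hw : ([] : PWord) = w at h'
  induction h' with
  | refl => exact h
  | @eps q q' r w e h' ih =>
    have hq' := CRPQ.states_closed hq (.inl e)
    exact ih hq' (hB.der .runEpsRight [stCode p, c, stCode q', stCode q]
      (all₄ (hQ p hp) hc (hQ q' hq') (hQ q hq)) (all₂ h (hB.eps (hQ q hq) e)) rfl) hw
  | letter => cases hw

theorem IsClosed.run_letter (hB : IsClosed B) {p q : List Regex} {o : Option Label}
    (hp : stCode p ∈ B) (h : C.IsLetter) (hC : C.code ∈ B) (hw : C.word = [o])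
    (e : LetterStep p o q) : BDer rules B (factCode .run [stCode p, C.code, stCode q]) := by
  match C, h with
  | .exp (.label a) y, _ =>
    change Regex.word _ _ = _ at hw
    rw [Regex.word_label] at hw
    obtain rfl := (List.cons.inj hw).1
    have h2 := hB.right hC
    cases e with
    | label =>
      exact hB.der .runLabel [numCode a, stCode q, y.fill .nl]
        (all₃ (hB.right (hB.left h2)) (hB.right hp) (hB.right h2)) trivial rfl
    | any =>
      exact hB.der .runAnyLabel [stCode q, numCode a, y.fill .nl]
        (all₃ (hB.right hp) (hB.right (hB.left h2)) (hB.right h2)) trivial rfl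
  | .exp .any y, _ =>
    change Regex.word _ _ = _ at hw
    rw [Regex.word_any] at hw
    obtain rfl := (List.cons.inj hw).1
    cases e with
    | any =>
      exact hB.der .runAny [stCode q, y.fill .nl] (all₂ (hB.right hp) (hB.right (hB.right hC)))
        trivial rfl

theorem Content.IsLetter.exists_word (h : C.IsLetter) : ∃ o, C.word = [o] := by
  match C, h with
  | .exp (.label a) y, _ => exact ⟨some a, Regex.word_label a y⟩
  | .exp .any y, _ => exact ⟨none, Regex.word_any y⟩

/-- The description is expanded, and its parts are treated recursively; for powers this is repeated
squaring. Steps without input at the end of the last part are made after the whole word instead,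
since the clause `runsNil` does not allow for them. -/
theorem IsClosed.run (hB : IsClosed B) (hQ : ∀ p ∈ Q.states, stCode p ∈ B) {𝒞 : Set Content}
    (h𝒞 : ContentsIn B 𝒞) (hC : C ∈ 𝒞) {p q : List Regex} (hp : p ∈ Q.states)
    (h : Run p C.word q) : BDer rules B (factCode .run [stCode p, C.code, stCode q]) := by
  induction hm : C.measure using Nat.strong_induction_on generalizing C p q with
  | _ m ih =>
    have hcb := h𝒞.code C hC
    by_cases hl : C.IsLetter
    · obtain ⟨o, ho⟩ := hl.exists_word
      have h' : ∀ w, w = [o] → Run p w q →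
          BDer rules B (factCode .run [stCode p, C.code, stCode q]) := by
        intro w hw h
        clear ih
        induction h with
        | refl => cases hw
        | @eps p p' q w e _ ih =>
          have hp' := CRPQ.states_closed hp (.inl e)
          exact hB.der .runEpsLeft [stCode p, C.code, stCode q, stCode p']
            (all₄ (hQ p hp) hcb (hQ q (Run.mem_states ‹_› hp')) (hQ p' hp'))
            (all₂ (hB.eps (hQ p hp) e) (ih hp' (by rw [ho, ← hw]; assumption) hw)) rfl
        | @letter p p' q o' w e h1 _ =>
          obtain ⟨rfl, rfl⟩ := List.cons.inj hw
          exact hB.run_eps_right hQ hp (CRPQ.states_closed hp (.inr ⟨_, e⟩)) hcb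
            (hB.run_letter (hQ p hp) hl hcb ho e) h1
      exact h' _ ho h
    · have h1 : ∀ l : List Content, listCode (l.map Content.code) ∈ B → (∀ D ∈ l, D ∈ 𝒞) →
          (∀ D ∈ l, D.measure < m) → ∀ p ∈ Q.states, Run p (l.flatMap Content.word) q →
          ∃ q' ∈ Q.states, BDer rules B (factCode .runs
            [stCode p, listCode (l.map Content.code), stCode q']) ∧ Run q' [] q := by
        intro l hl h1 h2 p hp h
        induction l generalizing p with
        | nil => exact ⟨p, hp, hB.der .runsNil [stCode p] (all₁ (hQ p hp)) trivial rfl, h⟩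
        | cons D l ihl =>
          rw [List.forall_mem_cons] at h1 h2
          obtain ⟨r, h3, h4⟩ := Run.exists_of_append h
          have hr := h3.mem_states hp
          obtain ⟨q', hq', h5, h6⟩ := ihl (hB.right hl) h1.2 h2.2 r hr h4
          refine ⟨q', hq', hB.der .runsCons [stCode p, D.code, listCode (l.map Content.code),
            stCode q', stCode r] ⟨hQ p hp, all₄ (hB.left hl) (hB.right hl) (hQ q' hq') (hQ r hr)⟩
            (all₂ (ih _ h2.1 h1.1 hp h3 rfl) h5) rfl, h6⟩
      have hok := h𝒞.ok C hC
      rw [← Content.expand_word hok hl] at h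
      have he := h𝒞.expand_code C hC
      obtain ⟨q', hq', h2, h3⟩ := h1 C.expand he (h𝒞.expand_mem C hC)
        (fun D hD => hm ▸ C.expand_measure D hD) p hp h
      exact hB.run_eps_right hQ hp hq' hcb (hB.der .runExpand [stCode p, C.code, stCode q',
        listCode (C.expand.map Content.code)] (all₄ (hQ p hp) hcb (hQ q' hq') he)
        (all₂ (hB.expand hok hl hcb) h2) rfl) h3

/-- `Flats l l'`: the list `l'` results from `l` if some of the descriptions are expanded. -/
inductive Flats : List Content → List Content → Prop
  | nil : Flats [] []
  | keep {C l l'} : Flats l l' → Flats (C :: l) (C :: l')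
  | expand {C l l₁ l₂} : ¬C.IsLetter → Flats C.expand l₁ → Flats l l₂ → Flats (C :: l) (l₁ ++ l₂)

theorem Flats.mem {B : Set Tree} {𝒞 : Set Content} (h𝒞 : ContentsIn B 𝒞) {l l' : List Content}
    (h : Flats l l') (hl : ∀ C ∈ l, C ∈ 𝒞) : ∀ C ∈ l', C ∈ 𝒞 := by
  induction h with
  | nil => exact hl
  | keep _ ih =>
    rw [List.forall_mem_cons] at hl ⊢
    exact ⟨hl.1, ih hl.2⟩
  | expand _ _ _ ih1 ih2 =>
    rw [List.forall_mem_cons] at hl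
    exact List.forall_mem_append.2 ⟨ih1 (h𝒞.expand_mem _ hl.1), ih2 hl.2⟩

theorem Flats.word {l l' : List Content} (h : Flats l l') (hl : ∀ C ∈ l, C.Ok) :
    l'.flatMap Content.word = l.flatMap Content.word := by
  induction h with
  | nil => rfl
  | keep _ ih => exact congrArg (_ ++ ·) (ih (List.forall_mem_cons.1 hl).2)
  | @expand C l l₁ l₂ h _ _ ih1 ih2 =>
    rw [List.forall_mem_cons] at hl
    rw [List.flatMap_append, ih1 (Content.expand_ok hl.1), ih2 hl.2, List.flatMap_cons,
      Content.expand_word hl.1 h]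

theorem IsClosed.of_listCode_append (hB : IsClosed B) {l l' : List Tree}
    (h : listCode (l ++ l') ∈ B) : listCode l' ∈ B := by
  induction l with
  | nil => exact h
  | cons t l ih => exact ih (hB.right h)

/-- The argument `a` accumulates what follows the list. -/
theorem IsClosed.flats (hB : IsClosed B) {𝒞 : Set Content} (h𝒞 : ContentsIn B 𝒞)
    {l l' : List Content} (h : Flats l l') (hl : ∀ C ∈ l, C ∈ 𝒞)
    (hlb : listCode (l.map Content.code) ∈ B) (a : List Content)
    (ha : listCode ((l' ++ a).map Content.code) ∈ B) :
    BDer rules B (factCode .flats [listCode (l.map Content.code), listCode (a.map Content.code),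
      listCode ((l' ++ a).map Content.code)]) := by
  induction h generalizing a with
  | nil => exact hB.der .flatsNil [listCode (a.map Content.code)] (all₁ ha) trivial rfl
  | @keep C l l' h ih =>
    rw [List.forall_mem_cons] at hl
    have h1 : listCode ((l' ++ a).map Content.code) ∈ B := hB.right ha
    have h2 : listCode (a.map Content.code) ∈ B := by
      rw [List.map_append] at h1
      exact hB.of_listCode_append h1
    exact hB.der .flatsCons [C.code, listCode (l.map Content.code), listCode (a.map Content.code),
      listCode ((C :: l' ++ a).map Content.code), listCode ((l' ++ a).map Content.code)]
      ⟨hB.left hlb, all₄ (hB.right hlb) h2 ha h1⟩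
      (all₂ (ih hl.2 (hB.right hlb) a h1) (hB.der .flatKeep
        [C.code, listCode ((l' ++ a).map Content.code)] (all₂ (hB.left hlb) h1) trivial rfl)) rfl
  | @expand C l l₁ l₂ hC h h' ih ih' =>
    rw [List.forall_mem_cons] at hl
    rw [List.append_assoc] at ha ⊢
    have h1 : listCode ((l₂ ++ a).map Content.code) ∈ B := by
      rw [List.map_append] at ha
      exact hB.of_listCode_append ha
    have h2 : listCode (a.map Content.code) ∈ B := by
      rw [List.map_append] at h1
      exact hB.of_listCode_append h1
    have h3 := h𝒞.expand_code C hl.1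
    exact hB.der .flatsCons [C.code, listCode (l.map Content.code), listCode (a.map Content.code),
      listCode ((l₁ ++ (l₂ ++ a)).map Content.code), listCode ((l₂ ++ a).map Content.code)]
      ⟨hB.left hlb, all₄ (hB.right hlb) h2 ha h1⟩
      (all₂ (ih' hl.2 (hB.right hlb) a h1) (hB.der .flatExpand [C.code,
        listCode ((l₂ ++ a).map Content.code), listCode ((l₁ ++ (l₂ ++ a)).map Content.code),
        listCode (C.expand.map Content.code)] (all₄ (hB.left hlb) h1 ha h3)
        (all₂ (hB.expand (h𝒞.ok C hl.1) hC (hB.left hlb))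
          (ih (h𝒞.expand_mem C hl.1) h3 (l₂ ++ a) ha)) rfl)) rfl

theorem IsClosed.flat (hB : IsClosed B) {𝒞 : Set Content} (h𝒞 : ContentsIn B 𝒞)
    {l : List Content} (h : Flats [C] l) (hC : C ∈ 𝒞) (hl : listCode (l.map Content.code) ∈ B) :
    BDer rules B (factCode .flat [C.code, .leaf .nl, listCode (l.map Content.code)]) := by
  have hc := h𝒞.code C hC
  cases h with
  | keep h =>
    cases h
    exact hB.der .flatKeep [C.code, .leaf .nl] (all₂ hc hB.nil) trivial rfl
  | @expand _ _ l₁ l₂ h1 h2 h3 =>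
    cases h3
    have h4 := h𝒞.expand_code C hC
    have h5 := hB.flats h𝒞 h2 (h𝒞.expand_mem C hC) h4 [] hl
    exact hB.der .flatExpand [C.code, .leaf .nl,
      listCode ((l₁ ++ ([] : List Content)).map Content.code),
        listCode (C.expand.map Content.code)] (all₄ hc hB.nil hl h4)
        (all₂ (hB.expand (h𝒞.ok C hC) h1 hc) h5) rfl

end

/-! ### Few pieces suffice -/

theorem Flats.append {l l' m m' : List Content} (h : Flats l l') (h' : Flats m m') :
    Flats (l ++ m) (l' ++ m') := by
  induction h with
  | nil => exact h'
  | keep _ ih => exact .keep ih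
  | expand h1 h2 _ _ ih =>
    rw [List.append_assoc]
    exact .expand h1 h2 ih

/-- The number of the positions in `K` that are inside of a word of length `n`. -/
def inner (K : List ℕ) (n : ℕ) : ℕ := (K.filter fun c => 0 < c ∧ c < n).length

theorem inner_add_le (K : List ℕ) (m n : ℕ) :
    inner K m + inner (K.map (· - m)) n ≤ inner K (m + n) := by
  induction K with
  | nil => simp [inner]
  | cons c K ih =>
    simp only [inner, List.map_cons, List.filter_cons] at ih ⊢
    split_ifs <;> simp_all <;> omega

theorem inner_le (K : List ℕ) (n : ℕ) : inner K n ≤ K.length := List.length_filter_le ..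

/-- The word described can be divided at given positions into nonempty pieces, not many more than
there are positions. -/
theorem exists_flats {C : Content} (h : C.Ok) (K : List ℕ) : ∃ l, Flats [C] l ∧
    (∀ D ∈ l, D.word ≠ []) ∧ (∀ c ∈ K, c ≤ C.word.length → ∃ l₁ l₂, l = l₁ ++ l₂ ∧
      (l₁.flatMap Content.word).length = c) ∧ l.length ≤ 1 + inner K C.word.length * C.measure := by
  induction hm : C.measure using Nat.strong_induction_on generalizing C K with
  | _ m ih =>
    by_cases hk : C.word ≠ [] ∧ ∀ c ∈ K, ¬(0 < c ∧ c < C.word.length)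
    · refine ⟨[C], .keep .nil, by simpa using hk.1, fun c hc hle => ?_, by simp⟩
      have := hk.2 c hc
      rcases Nat.eq_zero_or_pos c with rfl | h0
      · exact ⟨[], [C], rfl, rfl⟩
      · exact ⟨[C], [], rfl, by simp; omega⟩
    · have hl : ¬C.IsLetter := by
        intro hl
        obtain ⟨o, ho⟩ := hl.exists_word
        refine hk ⟨by simp [ho], fun c _ => ?_⟩
        rw [ho, List.length_singleton]
        omega
      have key : ∀ L : List Content, (∀ D ∈ L, D.Ok ∧ D.measure < m) → ∀ K : List ℕ, ∃ l,
          Flats L l ∧ (∀ D ∈ l, D.word ≠ []) ∧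
          (∀ c ∈ K, c ≤ (L.flatMap Content.word).length → ∃ l₁ l₂, l = l₁ ++ l₂ ∧
            (l₁.flatMap Content.word).length = c) ∧
          l.length ≤ L.length + inner K (L.flatMap Content.word).length * (m - 1) := by
        intro L hL K
        induction L generalizing K with
        | nil =>
          refine ⟨[], .nil, by simp, fun c _ hc => ⟨[], [], rfl, ?_⟩, by simp⟩
          exact (Nat.le_zero.1 hc).symm
        | cons D L ihL =>
          rw [List.forall_mem_cons] at hL
          obtain ⟨l, h1, h2, h3, h4⟩ := ih _ hL.1.2 hL.1.1 K rfl
          obtain ⟨l', h5, h6, h7, h8⟩ := ihL hL.2 (K.map (· - D.word.length))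
          have hw : l.flatMap Content.word = D.word := by
            rw [h1.word (by simpa using hL.1.1), List.flatMap_singleton]
          refine ⟨l ++ l', h1.append h5, List.forall_mem_append.2 ⟨h2, h6⟩, fun c hc hle => ?_, ?_⟩
          · rw [List.flatMap_cons, List.length_append] at hle
            rcases Nat.le_or_ge c D.word.length with hlt | hge
            · obtain ⟨l₁, l₂, rfl, h9⟩ := h3 c hc hlt
              exact ⟨l₁, l₂ ++ l', by simp, h9⟩
            · obtain ⟨l₁, l₂, rfl, h9⟩ := h7 _ (List.mem_map_of_mem hc) (by omega)
              refine ⟨l ++ l₁, l₂, by simp, ?_⟩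
              rw [List.flatMap_append, List.length_append, h9, hw]
              omega
          · have h9 := inner_add_le K D.word.length (L.flatMap Content.word).length
            rw [List.flatMap_cons, List.length_append, List.length_append, List.length_cons]
            have h10 : D.measure ≤ m - 1 := by omega
            have h11 := Nat.mul_le_mul_left (inner K D.word.length) h10
            have h12 := Nat.mul_le_mul_right (m - 1) h9
            rw [add_mul] at h12
            omega
      have hw := Content.expand_word h hl
      obtain ⟨l, h1, h2, h3, h4⟩ := key C.expand
        (fun D hD => ⟨Content.expand_ok h D hD, hm ▸ C.expand_measure D hD⟩) K
      have h5 := h1.word (Content.expand_ok h)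
      rw [hw] at h3 h4 h5
      refine ⟨l, ?_, h2, h3, ?_⟩
      · have := Flats.expand hl h1 .nil
        rwa [List.append_nil] at this
      · by_cases h6 : C.word = []
        · rw [h6, List.flatMap_eq_nil_iff] at h5
          have : l = [] := List.eq_nil_iff_forall_not_mem.2 fun D hD => h2 D hD (h5 D hD)
          simp [this]
        · have h7 : ∃ c ∈ K, 0 < c ∧ c < C.word.length := by
            by_contra hcon
            push Not at hcon
            exact hk ⟨h6, fun c hc h => absurd h.2 (not_lt.2 (hcon c hc h.1))⟩
          obtain ⟨c, hc, h7⟩ := h7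
          have h8 : 0 < inner K C.word.length :=
            List.length_pos_of_mem (List.mem_filter.2 ⟨hc, by simpa using h7⟩)
          have h9 := C.expand_length
          obtain ⟨m, rfl⟩ : ∃ m', m = m' + 1 := by
            have := C.expand_measure
            cases m with
            | zero =>
              exfalso
              have : C.expand = [] := List.eq_nil_iff_forall_not_mem.2 fun D hD => by
                have := this D hD
                omega
              rw [this] at hw
              exact h6 hw.symm
            | succ m => exact ⟨m, rfl⟩
          rw [Nat.add_sub_cancel] at h4
          rw [mul_add]
          omega

/-- An edge of a graph results from an edge with choices by expanding its description. -/
structure IsRefined (K : List ℕ) (e : Var × (Regex × LTree Unit) × Var)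
    (g : Var × List Content × Var) : Prop where
  src : e.1 = g.1
  tgt : e.2.2 = g.2.2
  flats : Flats [.exp e.2.1.1 e.2.1.2] g.2.1
  ne_nil : ∀ D ∈ g.2.1, D.word ≠ []
  cuts : ∀ c ∈ K, c ≤ (g.2.1.flatMap Content.word).length → ∃ l₁ l₂, g.2.1 = l₁ ++ l₂ ∧
    (l₁.flatMap Content.word).length = c
  length_le : g.2.1.length ≤ 1 + K.length * (e.2.1.1.size + 2 * e.2.1.2.size)

theorem exists_refinement (K : List ℕ) (l : List (Var × (Regex × LTree Unit) × Var))
    (hl : ∀ e ∈ l, e.2.1.1.IsW) : ∃ G, List.Forall₂ (IsRefined K) l G := by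
  induction l with
  | nil => exact ⟨[], .nil⟩
  | cons e l ih =>
    rw [List.forall_mem_cons] at hl
    obtain ⟨G, hG⟩ := ih hl.2
    obtain ⟨l', h1, h2, h3, h4⟩ := exists_flats (C := .exp e.2.1.1 e.2.1.2) hl.1 K
    have hw := h1.word (by simpa [Content.Ok] using hl.1)
    refine ⟨(e.1, l', e.2.2) :: G, .cons ⟨rfl, rfl, h1, h2, fun c hc hle => h3 c hc ?_, ?_⟩ hG⟩
    · rwa [hw, List.flatMap_singleton] at hle
    · exact h4.trans (Nat.add_le_add_left (Nat.mul_le_mul_right _ (inner_le ..)) 1)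

theorem mem_choices {b : List Atom} {Y : LTree Unit} {e : Var × (Regex × LTree Unit) × Var}
    (h : e ∈ choices b Y) : (∃ A ∈ b, e.1 = A.src ∧ e.2.1.1 = A.re ∧ e.2.2 = A.tgt) ∧
      (e.2.1.2 = .leaf () ∨ e.2.1.2 ∈ Y.subtrees) := by
  induction b generalizing Y with
  | nil => simp [choices] at h
  | cons A b ih =>
    cases Y with
    | leaf _ =>
      rcases List.mem_cons.1 h with rfl | h
      · exact ⟨⟨A, List.mem_cons_self, rfl, rfl, rfl⟩, .inl rfl⟩
      · obtain ⟨⟨A', h1, h2⟩, h3⟩ := ih h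
        exact ⟨⟨A', List.mem_cons_of_mem _ h1, h2⟩, h3⟩
    | node y Y =>
      rcases List.mem_cons.1 h with rfl | h
      · exact ⟨⟨A, List.mem_cons_self, rfl, rfl, rfl⟩, .inr (List.mem_cons_of_mem _
          (List.mem_append_left _ y.self_mem_subtrees))⟩
      · obtain ⟨⟨A', h1, h2⟩, h3⟩ := ih h
        exact ⟨⟨A', List.mem_cons_of_mem _ h1, h2⟩, h3.imp_right fun h =>
          List.mem_cons_of_mem _ (List.mem_append_right _ h)⟩

theorem flatten_eq_of_isRefined {K : List ℕ} {l : List (Var × (Regex × LTree Unit) × Var)}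
    {G : PGraph Var Content} (hl : ∀ e ∈ l, e.2.1.1.IsW) (h : List.Forall₂ (IsRefined K) l G) :
    flatten Content.word G = l.map fun e => (e.1, e.2.1.1.word e.2.1.2, e.2.2) := by
  induction h with
  | nil => rfl
  | cons h _ ih =>
    rw [List.forall_mem_cons] at hl
    have := h.flats.word (by simpa [Content.Ok] using hl.1)
    rw [List.flatMap_singleton] at this
    rw [List.map_cons, ← ih hl.2, h.src, h.tgt]
    change (_, List.flatMap _ _, _) :: _ = _
    rw [this]
    rfl

theorem exists_of_mem_forall₂ {α β : Type} {R : α → β → Prop} {l : List α} {l' : List β}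
    (h : List.Forall₂ R l l') {b : β} (hb : b ∈ l') : ∃ a ∈ l, R a b := by
  induction h with
  | nil => simp at hb
  | cons h _ ih =>
    rcases List.mem_cons.1 hb with rfl | hb
    · exact ⟨_, List.mem_cons_self, h⟩
    · obtain ⟨a, h1, h2⟩ := ih hb
      exact ⟨a, List.mem_cons_of_mem _ h1, h2⟩

/-- If `Q` has the answer `H` in all knowledge bases that match the graph of the choices, then `Q`
can be mapped into a refinement of this graph with few pieces. -/
theorem exists_refinement_of_good {Q : CRPQ} {H : List Var} {b : List Atom} {Y : LTree Unit}
    (hb : ∀ A ∈ b, A.re.IsW) (hH : ∀ x ∈ H, ∃ A ∈ b, x = A.src ∨ x = A.tgt)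
    (h : Good Q H (choiceGraph b Y)) : ∃ (K : List ℕ) (G : PGraph Var Content),
      K.length ≤ 2 * Q.body.length ∧ List.Forall₂ (IsRefined K) (choices b Y) G ∧
      PMaps Content.word G Q H := by
  have hE : ∀ x ∈ H, ∃ e ∈ choiceGraph b Y, x = e.1 ∨ x = e.2.2 := by
    intro x hx
    obtain ⟨A, hA, h⟩ := hH x hx
    obtain ⟨y, hy⟩ := exists_mem_choiceGraph hA Y
    exact ⟨_, hy, h⟩
  obtain ⟨C, h1, h2, h3⟩ := exists_cuts_of_good hE h
  have hl : ∀ e ∈ choices b Y, e.2.1.1.IsW := fun e he => by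
    obtain ⟨⟨A, hA, -, h, -⟩, -⟩ := mem_choices he
    exact h ▸ hb A hA
  obtain ⟨G, hG⟩ := exists_refinement (C.map Prod.snd) _ hl
  refine ⟨C.map Prod.snd, G, by simpa using h1, hG, ?_⟩
  have hf := flatten_eq_of_isRefined hl hG
  have hr := fun g hg => exists_of_mem_forall₂ hG (b := g) hg
  refine h3 _ _ G hf (fun g hg => (hr g hg).choose_spec.2.ne_nil) fun c hc => ?_
  obtain ⟨e, h4, h5⟩ := h2 c hc
  rw [show choiceGraph b Y = flatten Content.word G from hf.symm, flatten, List.getElem?_map,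
    Option.map_eq_some_iff] at h4
  obtain ⟨g, h6, rfl⟩ := h4
  obtain ⟨l₁, l₂, h7, h8⟩ := (hr g (List.mem_of_getElem? h6)).choose_spec.2.cuts c.2
    (List.mem_map_of_mem hc) h5
  exact ⟨g, l₁, l₂, h6, h7, h8⟩

/-! ### Completeness of the clauses: graphs and maps -/

section

variable {B : Set Tree} {Q : CRPQ} {𝒞 : Set Content} {G : PGraph Var Content}

theorem IsClosed.graph (hB : IsClosed B) (h𝒞 : ContentsIn B 𝒞) {K : List ℕ} {b : List Atom}
    {Y : LTree Unit} (h : List.Forall₂ (IsRefined K) (choices b Y) G) (hb : bodyCode b ∈ B)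
    (hY : Y.fill .nl ∈ B) (hG : graphCode G ∈ B)
    (hc : ∀ e ∈ choices b Y, .exp e.2.1.1 e.2.1.2 ∈ 𝒞) :
    BDer rules B (factCode .graph [bodyCode b, Y.fill .nl, graphCode G]) := by
  induction b generalizing Y G with
  | nil =>
    cases h
    exact hB.der .graphNil [Y.fill .nl] (all₁ hY) trivial rfl
  | cons A b ih =>
    have h1 := hB.sub hb
    have h2 := hB.sub h1.1
    have h3 := hB.sub h2.2
    cases Y with
    | leaf _ =>
      rw [choices] at h hc
      cases h with
      | @cons _ g _ G h h' =>
        rw [List.forall_mem_cons] at hc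
        obtain ⟨x, l, y⟩ := g
        obtain ⟨rfl, rfl, h4⟩ := h
        have h5 := hB.sub hG
        have h6 := hB.left (hB.right h5.1)
        exact hB.der .graphLeaf [numCode A.src, A.re.code, numCode A.tgt, .leaf .nl, bodyCode b,
          listCode (l.map Content.code), .leaf .nl, graphCode G]
          ⟨h2.1, h3.1, h3.2, hB.nil, all₄ h1.2 h6 hB.nil h5.2⟩
          (all₃ (hB.isW h3.1 (h𝒞.ok _ hc.1)) (hB.flat h𝒞 h4 hc.1 h6) (ih h' h1.2 hY h5.2 hc.2)) rfl
    | node z Y =>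
      rw [choices] at h hc
      cases h with
      | @cons _ g _ G h h' =>
        rw [List.forall_mem_cons] at hc
        obtain ⟨x, l, y⟩ := g
        obtain ⟨rfl, rfl, h4⟩ := h
        have h5 := hB.sub hG
        have h6 := hB.left (hB.right h5.1)
        have h7 := hB.sub hY
        exact hB.der .graphCons [numCode A.src, A.re.code, numCode A.tgt, z.fill .nl, bodyCode b,
          listCode (l.map Content.code), Y.fill .nl, graphCode G]
          ⟨h2.1, h3.1, h3.2, h7.1, all₄ h1.2 h6 h7.2 h5.2⟩
          (all₃ (hB.isW h3.1 (h𝒞.ok _ hc.1)) (hB.flat h𝒞 h4 hc.1 h6) (ih h' h1.2 h7.2 h5.2 hc.2))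
          rfl

theorem IsClosed.graphCode_of_suffix (hB : IsClosed B) {g : PGraph Var Content}
    (hG : graphCode G ∈ B) (h : g <:+ G) : graphCode g ∈ B := by
  obtain ⟨l, rfl⟩ := h
  rw [graphCode, List.map_append] at hG
  exact hB.of_listCode_append hG

theorem IsClosed.pieces_of_suffix (hB : IsClosed B) {l l' : List Content}
    (hl : listCode (l'.map Content.code) ∈ B) (h : l <:+ l') :
    listCode (l.map Content.code) ∈ B := by
  obtain ⟨l, rfl⟩ := h
  rw [List.map_append] at hl
  exact hB.of_listCode_append hl

theorem IsClosed.suf (hB : IsClosed B) (hG : graphCode G ∈ B) {g : PGraph Var Content}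
    (h : g <:+ G) : BDer rules B (factCode .suf [graphCode G, graphCode g]) := by
  obtain ⟨l, hl⟩ := h
  induction l using List.reverseRecOn generalizing g with
  | nil =>
    obtain rfl : g = G := hl
    exact hB.der .sufRefl [graphCode g] (all₁ hG) trivial rfl
  | append_singleton l e ih =>
    rw [List.append_assoc] at hl
    have h1 : graphCode (e :: g) ∈ B := hB.graphCode_of_suffix hG ⟨l, hl⟩
    exact hB.der .sufTail [graphCode G, edgeCode e, graphCode g]
      (all₃ hG (hB.left h1) (hB.right h1)) (all₁ (ih hl)) rfl

theorem IsClosed.at_mem (hB : IsClosed B) (hG : graphCode G ∈ B) {g : PGraph Var Content}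
    {l : List Content} (h : (GNode.at g l).Valid G) :
    graphCode g ∈ B ∧ listCode (l.map Content.code) ∈ B := by
  obtain ⟨h1, e, g, rfl, h2⟩ := h
  have h3 := hB.graphCode_of_suffix hG h1
  exact ⟨h3, hB.pieces_of_suffix (hB.left (hB.right (hB.left h3))) h2⟩

theorem IsClosed.valid (hB : IsClosed B) (hG : graphCode G ∈ B) {u : GNode Var Content}
    (h : u.Valid G) (hu : nodeCode u ∈ B) :
    BDer rules B (factCode .valid [graphCode G, nodeCode u]) := by
  rcases u with x | ⟨g, l⟩
  · exact hB.der .validVar [graphCode G, numCode x] (all₂ hG (hB.right hu)) trivial rfl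
  · clear hu
    obtain ⟨h1, e, g, rfl, l', h2⟩ := h
    have h3 := hB.graphCode_of_suffix hG h1
    have h4 := hB.sub (hB.left h3)
    have h5 := hB.sub h4.2
    induction l' using List.reverseRecOn generalizing l with
    | nil =>
      obtain ⟨x, l', y⟩ := e
      obtain rfl : l = l' := h2
      exact hB.der .validStart [graphCode G, numCode x, listCode (l.map Content.code), numCode y,
        graphCode g] ⟨hG, all₄ h4.1 h5.1 h5.2 (hB.right h3)⟩ (all₁ (hB.suf hG h1)) rfl
    | append_singleton l' C ih =>
      rw [List.append_assoc] at h2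
      have h6 : listCode ((C :: l).map Content.code) ∈ B := hB.pieces_of_suffix h5.1 ⟨l', h2⟩
      exact hB.der .validTail [graphCode G, graphCode (e :: g), C.code,
        listCode (l.map Content.code)] (all₄ hG h3 (hB.left h6) (hB.right h6))
        (all₁ (ih _ h2)) rfl

/-- Each step that establishes `PReach` is an instance of a clause. All points that occur are `u`,
points on edges of `G` and vertices of `G`. -/
theorem IsClosed.reach (hB : IsClosed B) (hQ : ∀ p ∈ Q.states, stCode p ∈ B)
    (h𝒞 : ContentsIn B 𝒞) (hG : graphCode G ∈ B) (hp : ∀ e ∈ G, ∀ C ∈ e.2.1, C ∈ 𝒞)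
    {p q : List Regex} {u v : GNode Var Content} (hpQ : p ∈ Q.states) (hu : nodeCode u ∈ B)
    (h : PReach Content.word G p u q v) :
    BDer rules B (factCode .reach [graphCode G, stCode p, nodeCode u, stCode q, nodeCode v]) := by
  have key : (∀ x, v = .var x → numCode x ∈ B) ∧
      BDer rules B (factCode .reach [graphCode G, stCode p, nodeCode u, stCode q, nodeCode v]) := by
    have hpB := hQ p hpQ
    induction h with
    | refl h =>
      exact ⟨fun x hx => hB.right (hx ▸ hu), hB.der .reachRefl [graphCode G, stCode p, nodeCode u]
        (all₃ hG hpB hu) (all₁ (hB.valid hG h hu)) rfl⟩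
    | @eps q q' v h e ih =>
      have hq := h.mem_states hpQ
      have hq' := CRPQ.states_closed hq (.inl e)
      refine ⟨ih.1, ?_⟩
      rcases v with x | ⟨g, l⟩
      · exact hB.der .reachEpsVar [graphCode G, stCode p, nodeCode u, stCode q, numCode x,
          stCode q'] ⟨hG, hpB, all₄ hu (hQ q hq) (ih.1 x rfl) (hQ q' hq')⟩
          (all₂ ih.2 (hB.eps (hQ q hq) e)) rfl
      · have h1 := hB.at_mem hG h.valid
        exact hB.der .reachEpsAt [graphCode G, stCode p, nodeCode u, stCode q, graphCode g,
          stCode q', listCode (l.map Content.code)]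
          ⟨hG, hpB, hu, all₄ (hQ q hq) h1.1 (hQ q' hq') h1.2⟩
          (all₂ ih.2 (hB.eps (hQ q hq) e)) rfl
    | @piece q q' g C l h e ih =>
      have hq := h.mem_states hpQ
      have h1 := hB.at_mem hG h.valid
      have hC : C ∈ 𝒞 := by
        obtain ⟨h2, e, g, rfl, h3⟩ := h.valid
        exact hp e (h2.subset List.mem_cons_self) C (h3.subset List.mem_cons_self)
      exact ⟨(fun x hx => nomatch hx), hB.der .reachPiece [graphCode G, stCode p, nodeCode u,
        stCode q, graphCode g, C.code, listCode (l.map Content.code), stCode q']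
        ⟨hG, hpB, hu, hQ q hq, all₄ h1.1 (hB.left h1.2) (hB.right h1.2) (hQ q' (e.mem_states hq))⟩
        (all₂ ih.2 (hB.run hQ h𝒞 hC hq e)) rfl⟩
    | @fromStart q x l y g h e ih =>
      have h1 := hB.sub (hB.graphCode_of_suffix hG e)
      have h2 := hB.sub h1.1
      have h3 := hB.sub h2.2
      exact ⟨(fun x hx => nomatch hx), hB.der .reachFromStart [graphCode G, stCode p, nodeCode u,
        stCode q, numCode x, listCode (l.map Content.code), numCode y, graphCode g]
        ⟨hG, hpB, hu, hQ q (h.mem_states hpQ), all₄ h2.1 h3.1 h3.2 h1.2⟩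
        (all₂ ih.2 (hB.suf hG e)) rfl⟩
    | @toStart q x l y g h ih =>
      have h1 := hB.sub (hB.at_mem hG h.valid).1
      have h2 := hB.sub h1.1
      have h3 := hB.sub h2.2
      exact ⟨(fun x hx => by cases hx; exact h2.1), hB.der .reachToStart [graphCode G, stCode p,
        nodeCode u, stCode q, numCode x, listCode (l.map Content.code), numCode y, graphCode g]
        ⟨hG, hpB, hu, hQ q (h.mem_states hpQ), all₄ h2.1 h3.1 h3.2 h1.2⟩ (all₁ ih.2) rfl⟩
    | @fromEnd q x l y g h e ih =>
      have h1 := hB.sub (hB.graphCode_of_suffix hG e)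
      have h2 := hB.sub h1.1
      have h3 := hB.sub h2.2
      exact ⟨(fun x hx => nomatch hx), hB.der .reachFromEnd [graphCode G, stCode p, nodeCode u,
        stCode q, numCode x, listCode (l.map Content.code), numCode y, graphCode g]
        ⟨hG, hpB, hu, hQ q (h.mem_states hpQ), all₄ h2.1 h3.1 h3.2 h1.2⟩
        (all₂ ih.2 (hB.suf hG e)) rfl⟩
    | @toEnd q x l y g h ih =>
      have h1 := hB.sub (hB.at_mem hG h.valid).1
      have h2 := hB.sub h1.1
      have h3 := hB.sub h2.2
      exact ⟨(fun x hx => by cases hx; exact h3.2), hB.der .reachToEnd [graphCode G, stCode p,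
        nodeCode u, stCode q, numCode x, listCode (l.map Content.code), numCode y, graphCode g]
        ⟨hG, hpB, hu, hQ q (h.mem_states hpQ), all₄ h2.1 h3.1 h3.2 h1.2⟩ (all₁ ih.2) rfl⟩
  exact key.2

/-- Different strings of bits are shown to be different at the first position where they differ, or
where one of them ends. -/
theorem IsClosed.neq_bits (hB : IsClosed B) {s s' : List Bool} (h : s ≠ s')
    (hs : str (s.map Token.bit) ∈ B) (hs' : str (s'.map Token.bit) ∈ B) :
    BDer rules B (factCode .neq [str (s.map Token.bit), str (s'.map Token.bit)]) := by
  induction s generalizing s' with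
  | nil =>
    cases s' with
    | nil => exact absurd rfl h
    | cons b s' =>
      exact hB.der .neqLeft [.leaf (.tk (.bit b)), str (s'.map Token.bit)]
        (all₂ (hB.left hs') (hB.right hs')) trivial rfl
  | cons a s ih =>
    cases s' with
    | nil =>
      exact hB.der .neqRight [.leaf (.tk (.bit a)), str (s.map Token.bit)]
        (all₂ (hB.left hs) (hB.right hs)) trivial rfl
    | cons b s' =>
      have h1 := hB.right hs
      have h2 := hB.right hs'
      match a, b with
      | true, false =>
        exact hB.der .neqTrue [str (s.map Token.bit), str (s'.map Token.bit)] (all₂ h1 h2)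
          trivial rfl
      | false, true =>
        exact hB.der .neqFalse [str (s.map Token.bit), str (s'.map Token.bit)] (all₂ h1 h2)
          trivial rfl
      | true, true =>
        exact hB.der .neqTail
          [.leaf (.tk (.bit true)), str (s.map Token.bit), str (s'.map Token.bit)]
          (all₃ (hB.left hs) h1 h2) (all₁ (ih (by simpa using h) h1 h2)) rfl
      | false, false =>
        exact hB.der .neqTail
          [.leaf (.tk (.bit false)), str (s.map Token.bit), str (s'.map Token.bit)]
          (all₃ (hB.left hs) h1 h2) (all₁ (ih (by simpa using h) h1 h2)) rfl

theorem IsClosed.neq (hB : IsClosed B) {m n : ℕ} (h : m ≠ n) (hm : numCode m ∈ B)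
    (hn : numCode n ∈ B) : BDer rules B (factCode .neq [numCode m, numCode n]) :=
  hB.neq_bits (fun e => h (Computability.encodingNatBool.encode_injective e)) hm hn

/-- The list of pairs that represents a map on a list of variables. -/
def mapCode (f : Var → GNode Var Content) (l : List Var) : Tree :=
  listCode (l.map fun y => .node (numCode y) (nodeCode (f y)))

theorem IsClosed.look (hB : IsClosed B) {f : Var → GNode Var Content} {l : List Var}
    (hl : mapCode f l ∈ B) {y : Var} (hy : y ∈ l) : nodeCode (f y) ∈ B ∧
      BDer rules B (factCode .look [mapCode f l, numCode y, nodeCode (f y)]) := by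
  have h1 := hB.sub (hB.of_listCode hl _ (List.mem_map_of_mem hy))
  refine ⟨h1.2, ?_⟩
  induction l with
  | nil => simp at hy
  | cons z l ih =>
    have h2 := hB.sub hl
    have h3 := hB.sub h2.1
    by_cases hyz : z = y
    · subst hyz
      exact hB.der .lookHere [numCode z, nodeCode (f z), mapCode f l] (all₃ h1.1 h1.2 h2.2)
        trivial rfl
    · have hy' : y ∈ l := (List.mem_cons.1 hy).resolve_left fun h => hyz h.symm
      exact hB.der .lookTail [numCode z, nodeCode (f z), mapCode f l, numCode y, nodeCode (f y)]
        ⟨h3.1, all₄ h3.2 h2.2 h1.1 h1.2⟩ (all₂ (hB.neq hyz h3.1 h1.1) (ih h2.2 hy')) rfl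

theorem IsClosed.maps (hB : IsClosed B) (hQ : ∀ p ∈ Q.states, stCode p ∈ B)
    (h𝒞 : ContentsIn B 𝒞) (hG : graphCode G ∈ B) (hp : ∀ e ∈ G, ∀ C ∈ e.2.1, C ∈ 𝒞)
    {f : Var → GNode Var Content} {l : List Var} (hl : mapCode f l ∈ B) {b : List Atom}
    (hb : bodyCode b ∈ B) (hbl : ∀ A ∈ b, A ∈ Q.body ∧ A.src ∈ l ∧ A.tgt ∈ l ∧
      PReach Content.word G [A.re] (f A.src) [] (f A.tgt)) :
    BDer rules B (factCode .maps [graphCode G, mapCode f l, bodyCode b]) := by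
  induction b with
  | nil => exact hB.der .mapsNil [graphCode G, mapCode f l] (all₂ hG hl) trivial rfl
  | cons A b ih =>
    rw [List.forall_mem_cons] at hbl
    obtain ⟨⟨h1, h2, h3, h4⟩, h5⟩ := hbl
    have h6 := hB.sub hb
    have h7 := hB.sub h6.1
    have h8 := hB.sub h7.2
    have h9 := hB.look hl h2
    have h10 := hB.look hl h3
    exact hB.der .mapsCons [graphCode G, mapCode f l, numCode A.src, A.re.code, numCode A.tgt,
      nodeCode (f A.src), nodeCode (f A.tgt), bodyCode b]
      ⟨hG, hl, h7.1, h8.1, all₄ h8.2 h9.1 h10.1 h6.2⟩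
      (all₄ h9.2 h10.2
        (hB.reach hQ h𝒞 hG hp (CRPQ.singleton_mem_states h1) h9.1 h4) (ih h6.2 h5)) rfl

theorem IsClosed.heads (hB : IsClosed B) (hQ : ∀ p ∈ Q.states, stCode p ∈ B)
    (h𝒞 : ContentsIn B 𝒞) (hG : graphCode G ∈ B) (hp : ∀ e ∈ G, ∀ C ∈ e.2.1, C ∈ 𝒞)
    {f : Var → GNode Var Content} {l : List Var} (hl : mapCode f l ∈ B) {H H' : List Var}
    (hH : headCode H ∈ B) (hH' : headCode H' ∈ B) (hl' : ∀ y ∈ H', y ∈ l)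
    (h : List.Forall₂ (fun x y => PReach Content.word G [] (f y) [] (.var x)) H H') :
    BDer rules B (factCode .heads [graphCode G, mapCode f l, headCode H, headCode H']) := by
  induction h with
  | nil => exact hB.der .headsNil [graphCode G, mapCode f l] (all₂ hG hl) trivial rfl
  | @cons x y H H' h _ ih =>
    rw [List.forall_mem_cons] at hl'
    have h1 := hB.sub hH
    have h2 := hB.sub hH'
    have h3 := hB.look hl hl'.1
    exact hB.der .headsCons [graphCode G, mapCode f l, numCode x, numCode y, nodeCode (f y),
      headCode H, headCode H'] ⟨hG, hl, h1.1, all₄ h2.1 h3.1 h1.2 h2.2⟩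
      (all₃ h3.2 (hB.reach hQ h𝒞 hG hp Q.nil_mem_states h3.1 h) (ih h1.2 h2.2 hl'.2)) rfl

/-- The goal can be derived if `Q₂` can be mapped into the graph of `Q₁` for given choices. -/
theorem IsClosed.goal (hB : IsClosed B) {Q₁ Q₂ : CRPQ} (hQ : ∀ p ∈ Q₂.states, stCode p ∈ B)
    (h𝒞 : ContentsIn B 𝒞) (hG : graphCode G ∈ B) {K : List ℕ} {Y : LTree Unit}
    (hY : Y.fill .nl ∈ B) (hc : ∀ e ∈ choices Q₁.body Y, .exp e.2.1.1 e.2.1.2 ∈ 𝒞)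
    (hr : List.Forall₂ (IsRefined K) (choices Q₁.body Y) G) {f : Var → GNode Var Content}
    {l : List Var} (hl : mapCode f l ∈ B) (hx : str (encodePair Q₁ Q₂) ∈ B)
    (hb₁ : bodyCode Q₁.body ∈ B) (hb₂ : bodyCode Q₂.body ∈ B) (hh₁ : headCode Q₁.head ∈ B)
    (hh₂ : headCode Q₂.head ∈ B) (hvl : ∀ A ∈ Q₂.body, A.src ∈ l ∧ A.tgt ∈ l)
    (hf : ∀ A ∈ Q₂.body, PReach Content.word G [A.re] (f A.src) [] (f A.tgt))
    (hf' : List.Forall₂ (fun x y => PReach Content.word G [] (f y) [] (.var x)) Q₁.head Q₂.head) :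
    BDer rules B (goalTree .nl .tk .goal (encodePair Q₁ Q₂) Y) := by
  have hp : ∀ e ∈ G, ∀ C ∈ e.2.1, C ∈ 𝒞 := by
    intro g hg
    obtain ⟨e, he, h⟩ := exists_of_mem_forall₂ hr hg
    exact h.flats.mem h𝒞 (by simpa using hc e he)
  have e0 : encodePair Q₁ Q₂ = Q₁.head.flatMap encodeVar ++ (Q₁.body.flatMap Atom.encode ++
      .sep :: (Q₂.head.flatMap encodeVar ++ (Q₂.body.flatMap Atom.encode ++ []))) := by
    simp [encodePair, CRPQ.encode]
  rw [e0] at hx ⊢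
  have h1 := hB.str_of_append hx
  have h2 := hB.str_of_append h1
  have h3 := hB.right h2
  have h4 := hB.str_of_append h3
  have hl' : ∀ y ∈ Q₂.head, y ∈ l := by
    intro y hy
    obtain ⟨A, hA, rfl | rfl⟩ := Q₂.head_occurs y hy
    exacts [(hvl A hA).1, (hvl A hA).2]
  exact hB.der .goal [_, headCode Q₁.head, _, bodyCode Q₁.body, _, headCode Q₂.head, _,
    bodyCode Q₂.body, Y.fill .nl, graphCode G, mapCode f l]
    ⟨hx, hh₁, h1, hb₁, h3, hh₂, h4, all₄ hb₂ hY hG hl⟩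
    ⟨hB.head _ _ hx hh₁, hB.body _ _ h1 hb₁, hB.head _ _ h3 hh₂, hB.body _ [] h4 hb₂,
      hB.occs hb₁ hh₁ Q₁.head_occurs, all₄ (hB.occs hb₂ hh₂ Q₂.head_occurs)
      (hB.graph h𝒞 hr hb₁ hY hG hc)
      (hB.maps hQ h𝒞 hG hp hl hb₂ fun A hA => ⟨hA, (hvl A hA).1, (hvl A hA).2, hf A hA⟩)
      (hB.heads hQ h𝒞 hG hp hl hh₁ hh₂ hl' hf')⟩ rfl

end

/-! ### The sizes of the trees in a derivation -/

theorem size_numCode (n : ℕ) : (numCode n).size = 2 * (encodeBits n).length + 1 :=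
  size_inputTree ..

theorem size_listCode (l : List Tree) :
    (listCode l).size = 1 + (l.map fun t => t.size + 1).sum := by
  induction l with
  | nil => rfl
  | cons t l ih =>
    change t.size + (listCode l).size + 1 = _
    rw [ih, List.map_cons, List.sum_cons]
    omega

theorem size_listCode_le {l : List Tree} {m : ℕ} (h : ∀ t ∈ l, t.size ≤ m) :
    (listCode l).size ≤ 1 + l.length * (m + 1) := by
  rw [size_listCode]
  refine Nat.add_le_add_left ?_ 1
  have := List.sum_le_card_nsmul (l.map fun t => t.size + 1) (m + 1) (by simpa using h)
  simpa using this

theorem size_listCode_append (l l' : List Tree) :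
    (listCode l').size ≤ (listCode (l ++ l')).size := by
  rw [size_listCode, size_listCode, List.map_append, List.sum_append]
  omega

theorem size_natCode (n : ℕ) : (natCode n).size = 2 * n + 1 := by
  induction n with
  | zero => rfl
  | succ n ih => simp [natCode, LTree.size, ih]; omega

theorem Regex.size_code_le (r : Regex) : r.code.size ≤ 3 * r.encode.length := by
  induction r with
  | label a => simp [code, encode, LTree.size, size_numCode]; omega
  | plus R S ihR ihS => simp [code, encode, LTree.size]; omega
  | comp R S ihR ihS => simp [code, encode, LTree.size]; omega
  | star R ih => simp [code, encode, LTree.size]; omega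
  | _ => simp [code, encode, LTree.size]

theorem Regex.size_le_length_encode (r : Regex) : r.size ≤ r.encode.length := by
  induction r with
  | plus R S ihR ihS => simp [size, encode]; omega
  | comp R S ihR ihS => simp [size, encode]; omega
  | star R ih => simpa [size, encode] using ih
  | _ => simp [size, encode]

theorem length_le_length_flatMap {α β : Type} (f : α → List β) {l : List α} {a : α} (h : a ∈ l) :
    (f a).length ≤ (l.flatMap f).length := by
  obtain ⟨l₁, l₂, rfl⟩ := List.append_of_mem h
  simp only [List.flatMap_append, List.flatMap_cons, List.length_append]
  omega

theorem length_le_length_flatMap' {α β : Type} (f : α → List β) {l : List α}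
    (h : ∀ a ∈ l, f a ≠ []) : l.length ≤ (l.flatMap f).length := by
  induction l with
  | nil => simp
  | cons a l ih =>
    rw [List.forall_mem_cons] at h
    have := ih h.2
    have := List.length_pos_iff.2 h.1
    rw [List.flatMap_cons, List.length_append, List.length_cons]
    omega

theorem Atom.length_encode (A : Atom) : A.encode.length =
    3 + (encodeBits A.src).length + A.re.encode.length + (encodeBits A.tgt).length := by
  simp [encode, encodeVar]
  omega

theorem size_bodyCode_le (b : List Atom) :
    (bodyCode b).size ≤ 1 + 3 * (b.flatMap Atom.encode).length := by
  rw [bodyCode, size_listCode]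
  induction b with
  | nil => simp
  | cons A b ih =>
    have := A.re.size_code_le
    simp only [List.map_cons, List.sum_cons, List.flatMap_cons, List.length_append, Atom.code,
      LTree.size, size_numCode, A.length_encode] at ih ⊢
    omega

theorem size_headCode_le (H : List Var) :
    (headCode H).size ≤ 1 + 3 * (H.flatMap encodeVar).length := by
  rw [headCode, size_listCode]
  induction H with
  | nil => simp
  | cons x H ih =>
    simp only [List.map_cons, List.sum_cons, List.flatMap_cons, List.length_append, encodeVar,
      List.length_cons, size_numCode] at ih ⊢
    omega

theorem size_stCode_cons (r : Regex) (k : List Regex) :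
    (stCode (r :: k)).size = r.code.size + (stCode k).size + 1 := rfl

theorem Regex.size_stCode_le (r : Regex) (k : List Regex) {p : List Regex}
    (hp : p ∈ r.stackList k) :
    (stCode p).size ≤ (stCode k).size + r.size * (r.code.size + 1) := by
  induction r generalizing k with
  | plus R S ihR ihS =>
    simp only [stackList, List.mem_cons, List.mem_append] at hp
    have hc : (plus R S).code.size = R.code.size + S.code.size + 3 := by
      simp [code, LTree.size]; omega
    rcases hp with rfl | hp | hp
    · rw [size_stCode_cons, size]; nlinarith
    · have := ihR k hp; rw [size, hc]; nlinarith
    · have := ihS k hp; rw [size, hc]; nlinarith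
  | comp R S ihR ihS =>
    simp only [stackList, List.mem_cons, List.mem_append] at hp
    have hc : (comp R S).code.size = R.code.size + S.code.size + 3 := by
      simp [code, LTree.size]; omega
    rcases hp with rfl | hp | hp
    · rw [size_stCode_cons, size]; nlinarith
    · have := ihR _ hp
      rw [size_stCode_cons] at this
      rw [size, hc]; nlinarith
    · have := ihS k hp; rw [size, hc]; nlinarith
  | star R ih =>
    simp only [stackList, List.mem_cons] at hp
    have hc : (star R).code.size = R.code.size + 2 := by simp [code, LTree.size]; omega
    rcases hp with rfl | hp
    · rw [size_stCode_cons, size]; nlinarith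
    · have := ih _ hp
      rw [size_stCode_cons] at this
      rw [size, hc] at *; nlinarith
  | _ =>
    rw [stackList, List.mem_singleton] at hp
    subst hp
    rw [size_stCode_cons]
    simp [size]
    omega

/-- The subexpressions of an expression. -/
def Regex.subs : Regex → List Regex
  | plus R S => plus R S :: (R.subs ++ S.subs)
  | comp R S => comp R S :: (R.subs ++ S.subs)
  | star R => star R :: R.subs
  | r => [r]

theorem Regex.length_subs (r : Regex) : r.subs.length = r.size := by
  induction r <;> simp_all [subs, size]

theorem Regex.self_mem_subs (r : Regex) : r ∈ r.subs := by
  cases r <;> simp [subs]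

theorem Regex.size_code_le_of_mem_subs {r s : Regex} (h : s ∈ r.subs) :
    s.code.size ≤ r.code.size := by
  induction r with
  | plus R S ihR ihS =>
    simp only [subs, List.mem_cons, List.mem_append] at h
    rcases h with rfl | h | h
    · exact le_rfl
    · have := ihR h; simp only [code, LTree.size]; omega
    · have := ihS h; simp only [code, LTree.size]; omega
  | comp R S ihR ihS =>
    simp only [subs, List.mem_cons, List.mem_append] at h
    rcases h with rfl | h | h
    · exact le_rfl
    · have := ihR h; simp only [code, LTree.size]; omega
    · have := ihS h; simp only [code, LTree.size]; omega
  | star R ih =>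
    simp only [subs, List.mem_cons] at h
    rcases h with rfl | h
    · exact le_rfl
    · have := ih h; simp only [code, LTree.size]; omega
  | _ => rw [List.mem_singleton.1 h]

/-- The proper subexpressions at the top of an expression. -/
def Regex.parts : Regex → List Regex
  | plus R S => [R, S]
  | comp R S => [R, S]
  | star R => [R]
  | _ => []

theorem Regex.parts_subset_subs {r s : Regex} (h : s ∈ r.subs) : s.parts ⊆ r.subs := by
  induction r with
  | plus R S ihR ihS =>
    simp only [subs, List.mem_cons, List.mem_append] at h
    rcases h with rfl | h | h
    · simp [parts, subs, self_mem_subs]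
    · exact fun t ht => by simp [subs, ihR h ht]
    · exact fun t ht => by simp [subs, ihS h ht]
  | comp R S ihR ihS =>
    simp only [subs, List.mem_cons, List.mem_append] at h
    rcases h with rfl | h | h
    · simp [parts, subs, self_mem_subs]
    · exact fun t ht => by simp [subs, ihR h ht]
    · exact fun t ht => by simp [subs, ihS h ht]
  | star R ih =>
    simp only [subs, List.mem_cons] at h
    rcases h with rfl | h
    · simp [parts, subs, self_mem_subs]
    · exact fun t ht => by simp [subs, ih h ht]
  | _ => rw [List.mem_singleton.1 h]; simp [parts]

theorem Content.size_code_expand (C : Content) : ∀ D ∈ C.expand, D.code.size ≤ C.code.size := by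
  fun_cases Content.expand C with
  | case7 => simp
  | case10 => simp
  | _ => simp [code, Regex.code, LTree.fill, LTree.size, natCode] <;> omega

/-- The descriptions that occur if the words of a query are expanded: `RS` lists the subexpressions,
`ys` the choices for them, and `N` bounds the exponents. -/
def Content.Within (RS : List Regex) (ys : List (LTree Unit)) (N : ℕ) : Content → Prop
  | exp r y => r.IsW ∧ r ∈ RS ∧ y ∈ ys
  | dbl i s => s.IsString ∧ s ∈ RS ∧ i ≤ N
  | pw i s y => s.IsString ∧ s ∈ RS ∧ y ∈ ys ∧ i + y.size ≤ N

/-- A list that contains these descriptions. -/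
def contentList (RS : List Regex) (ys : List (LTree Unit)) (N : ℕ) : List Content :=
  (RS.flatMap fun r => ys.map fun y => .exp r y) ++
  (RS.flatMap fun s => (List.range (N + 1)).map fun i => .dbl i s) ++
  RS.flatMap fun s => ys.flatMap fun y => (List.range (N + 1)).map fun i => .pw i s y

theorem Content.Within.mem {RS : List Regex} {ys : List (LTree Unit)} {N : ℕ} {C : Content}
    (h : C.Within RS ys N) : C ∈ contentList RS ys N := by
  cases C with
  | exp r y => simp [contentList, h.2.1, h.2.2]
  | dbl i s => simp [contentList, h.2.1, h.2.2]
  | pw i s y =>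
    have := h.2.2.2
    simp [contentList, h.2.1, h.2.2.1]
    omega

theorem length_contentList (RS : List Regex) (ys : List (LTree Unit)) (N : ℕ) :
    (contentList RS ys N).length =
      RS.length * ys.length + RS.length * (N + 1) + RS.length * (ys.length * (N + 1)) := by
  simp [contentList, List.length_flatMap, add_assoc]

theorem size_code_of_mem_contentList {RS : List Regex} {ys : List (LTree Unit)} {N a b : ℕ}
    (ha : ∀ r ∈ RS, r.code.size ≤ a) (hb : ∀ y ∈ ys, y.size ≤ b) {C : Content}
    (h : C ∈ contentList RS ys N) : C.code.size ≤ a + b + 2 * N + 5 := by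
  simp only [contentList, List.mem_append, List.mem_flatMap, List.mem_map, List.mem_range] at h
  rcases h with (⟨r, hr, y, hy, rfl⟩ | ⟨s, hs, i, hi, rfl⟩) | ⟨s, hs, y, hy, i, hi, rfl⟩
  · have := ha r hr
    have := hb y hy
    simp only [Content.code, LTree.size, LTree.size_fill]
    omega
  · have := ha s hs
    simp only [Content.code, LTree.size, size_natCode]
    omega
  · have := ha s hs
    have := hb y hy
    simp only [Content.code, LTree.size, LTree.size_fill, size_natCode]
    omega

/-- The polynomially many descriptions that may occur are closed under expansion. -/
theorem Content.Within.expand {RS : List Regex} {Y : LTree Unit}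
    (hRS : ∀ r ∈ RS, r.parts ⊆ RS) {C : Content}
    (h : C.Within RS (.leaf () :: Y.subtrees) Y.size) :
    ∀ D ∈ C.expand, D.Within RS (.leaf () :: Y.subtrees) Y.size := by
  have hY : ∀ {a b : LTree Unit}, LTree.node a b ∈ LTree.leaf () :: Y.subtrees →
      a ∈ LTree.leaf () :: Y.subtrees ∧ b ∈ LTree.leaf () :: Y.subtrees := by
    intro a b h
    have := LTree.mem_subtrees_of_node ((List.mem_cons.1 h).resolve_left (by simp))
    exact ⟨List.mem_cons_of_mem _ this.1, List.mem_cons_of_mem _ this.2⟩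
  have h0 : LTree.leaf () ∈ LTree.leaf () :: Y.subtrees := List.mem_cons_self
  have hs : ∀ y ∈ LTree.leaf () :: Y.subtrees, y.size ≤ Y.size := by
    intro y hy
    rcases List.mem_cons.1 hy with rfl | hy
    · exact Y.size_pos
    · exact LTree.size_le_of_mem_subtrees hy
  fun_cases Content.expand C with
  | case1 r s y =>
    obtain ⟨h1, h2, h3⟩ := h
    have h4 := hRS _ h2
    cases h1 with
    | comp h5 h6 =>
      simp [Within, h5, h6, h4 (show r ∈ _ by simp [Regex.parts]),
        h4 (show s ∈ _ by simp [Regex.parts])]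
  | case2 r s y z =>
    obtain ⟨h1, h2, h3⟩ := h
    have h4 := hRS _ h2
    have h7 := hY h3
    cases h1 with
    | comp h5 h6 =>
      simpa [Within, h5, h6, h4 (show r ∈ _ by simp [Regex.parts]),
        h4 (show s ∈ _ by simp [Regex.parts])] using h7
  | case3 r s y =>
    obtain ⟨h1, h2, h3⟩ := h
    have h4 := hRS _ h2
    cases h1 with
    | plus h5 h6 =>
      simp [Within, h5, h4 (show r ∈ _ by simp [Regex.parts])]
  | case4 r s a y =>
    obtain ⟨h1, h2, h3⟩ := h
    have h4 := hRS _ h2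
    have h7 := hY h3
    cases h1 with
    | plus h5 h6 =>
      simpa [Within, h5, h4 (show r ∈ _ by simp [Regex.parts])] using h7.2
  | case5 r s a b y =>
    obtain ⟨h1, h2, h3⟩ := h
    have h4 := hRS _ h2
    have h7 := hY h3
    cases h1 with
    | plus h5 h6 =>
      simpa [Within, h6, h4 (show s ∈ _ by simp [Regex.parts])] using h7.2
  | case6 s y =>
    obtain ⟨h1, h2, h3⟩ := h
    have h4 := hRS _ h2
    cases h1 with
    | star h5 =>
      intro D hD
      obtain rfl := List.mem_singleton.1 hD
      exact ⟨h5, h4 (by simp [Regex.parts]), h3, by simpa using hs y h3⟩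
  | case7 => simp
  | case8 s =>
    intro D hD
    obtain rfl := List.mem_singleton.1 hD
    exact ⟨Regex.IsString.isW h.1, h.2.1, h0⟩
  | case9 i s =>
    obtain ⟨h1, h2, h3⟩ := h
    intro D hD
    obtain rfl : D = .dbl i s := by simpa using hD
    exact ⟨h1, h2, by omega⟩
  | case10 => simp
  | case11 i s a y =>
    obtain ⟨h1, h2, h3, h4⟩ := h
    intro D hD
    obtain rfl := List.mem_singleton.1 hD
    rw [LTree.size] at h4
    exact ⟨h1, h2, (hY h3).2, by have := (LTree.leaf a).size_pos; omega⟩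
  | case12 i s a b y =>
    obtain ⟨h1, h2, h3, h4⟩ := h
    rw [LTree.size, LTree.size] at h4
    intro D hD
    simp only [List.mem_cons, List.not_mem_nil, or_false] at hD
    rcases hD with rfl | rfl
    · exact ⟨h1, h2, by omega⟩
    · exact ⟨h1, h2, (hY h3).2, by omega⟩

/-! ### Short derivations of the goal -/

section

variable {V P : Type} {ω : P → PWord} {G : PGraph V P}

theorem PReach.valid_left {p q : List Regex} {u v : GNode V P} (h : PReach ω G p u q v) :
    u.Valid G := by
  induction h with
  | refl h => exact h
  | _ => assumption

/-- Rename the vertices. -/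
def GNode.mapVar (ρ : V → V) : GNode V P → GNode V P
  | var x => .var (ρ x)
  | .at g l => .at g l

/-- Vertices that do not occur in the graph may be renamed. -/
theorem PReach.mapVar {ρ : V → V} (hρ : ∀ e ∈ G, ρ e.1 = e.1 ∧ ρ e.2.2 = e.2.2)
    {p q : List Regex} {u v : GNode V P} (h : PReach ω G p u q v) :
    PReach ω G p (u.mapVar ρ) q (v.mapVar ρ) := by
  induction h with
  | refl h =>
    refine .refl ?_
    cases u
    · exact trivial
    · exact h
  | eps _ e ih => exact .eps ih e
  | piece _ e ih => exact .piece ih e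
  | fromStart _ e ih =>
    have := (hρ _ (e.subset List.mem_cons_self)).1
    dsimp only at this
    rw [GNode.mapVar, this] at ih
    exact .fromStart ih e
  | toStart h ih =>
    have := (hρ _ (h.valid.1.subset List.mem_cons_self)).1
    dsimp only at this
    rw [GNode.mapVar, this]
    exact .toStart ih
  | fromEnd _ e ih =>
    have := (hρ _ (e.subset List.mem_cons_self)).2
    dsimp only at this
    rw [GNode.mapVar, this] at ih
    exact .fromEnd ih e
  | toEnd h ih =>
    have := (hρ _ (h.valid.1.subset List.mem_cons_self)).2
    dsimp only at this
    rw [GNode.mapVar, this]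
    exact .toEnd ih

end

theorem size_graphCode_le {G : PGraph Var Content} {a m c : ℕ}
    (h : ∀ e ∈ G, (numCode e.1).size ≤ a ∧ (numCode e.2.2).size ≤ a ∧ e.2.1.length ≤ m ∧
      ∀ C ∈ e.2.1, C.code.size ≤ c) :
    (graphCode G).size ≤ 1 + G.length * (2 * a + m * (c + 1) + 4) := by
  have := size_listCode_le (l := G.map edgeCode) (m := 2 * a + m * (c + 1) + 3) fun t ht => by
    obtain ⟨e, he, rfl⟩ := List.mem_map.1 ht
    obtain ⟨h1, h2, h3, h4⟩ := h e he
    have h5 := size_listCode_le (l := e.2.1.map Content.code) (m := c) (by simpa using h4)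
    rw [List.length_map] at h5
    have h6 := Nat.mul_le_mul_right (c + 1) h3
    simp only [edgeCode, LTree.size]
    omega
  rwa [List.length_map] at this

theorem size_nodeCode_le {G : PGraph Var Content} {a : ℕ} {u : GNode Var Content}
    (hu : u.Valid G) (ha : ∀ x, u = .var x → (numCode x).size ≤ a) :
    (nodeCode u).size ≤ 2 * (graphCode G).size + a + 3 := by
  rcases u with x | ⟨g, l⟩
  · have := ha x rfl
    simp only [nodeCode, LTree.size]
    omega
  · obtain ⟨⟨g', rfl⟩, e, g, rfl, l', h⟩ := hu
    have h1 : (graphCode (e :: g)).size ≤ (graphCode (g' ++ e :: g)).size := by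
      rw [graphCode, graphCode, List.map_append]
      exact size_listCode_append ..
    have h2 : (listCode (l.map Content.code)).size ≤ (listCode (e.2.1.map Content.code)).size := by
      rw [← h, List.map_append]
      exact size_listCode_append ..
    have h3 : (listCode (e.2.1.map Content.code)).size ≤ (graphCode (e :: g)).size := by
      change _ ≤ (LTree.node (edgeCode e) (graphCode g)).size
      simp only [edgeCode, LTree.size]
      omega
    simp only [nodeCode, LTree.size]
    omega

theorem isClosed_subtrees {l : List Tree} (h : .leaf .nl ∈ l) :
    IsClosed {b | b ∈ l.flatMap LTree.subtrees} where
  nil := List.mem_flatMap.2 ⟨_, h, LTree.self_mem_subtrees _⟩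
  sub := by
    intro a b h
    obtain ⟨t, h1, h2⟩ := List.mem_flatMap.1 h
    have := LTree.mem_subtrees_of_node h2
    exact ⟨List.mem_flatMap.2 ⟨t, h1, this.1⟩, List.mem_flatMap.2 ⟨t, h1, this.2⟩⟩

theorem length_flatMap_subtrees_le {l : List Tree} {m : ℕ} (h : ∀ t ∈ l, t.size ≤ m) :
    (l.flatMap LTree.subtrees).length ≤ l.length * m := by
  induction l with
  | nil => simp
  | cons t l ih =>
    rw [List.forall_mem_cons] at h
    have := ih h.2
    rw [List.flatMap_cons, List.length_append, LTree.length_subtrees, List.length_cons, add_mul]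
    omega

theorem length_encodePair (Q₁ Q₂ : CRPQ) : (encodePair Q₁ Q₂).length =
    (Q₁.head.flatMap encodeVar).length + (Q₁.body.flatMap Atom.encode).length +
    ((Q₂.head.flatMap encodeVar).length + (Q₂.body.flatMap Atom.encode).length) + 1 := by
  simp only [encodePair, CRPQ.encode, List.length_append, List.length_cons]
  omega

theorem length_flatMap_le_length_flatMap {α β γ : Type} (f : α → List β) (g : α → List γ)
    {l : List α} (h : ∀ a ∈ l, (f a).length ≤ (g a).length) :
    (l.flatMap f).length ≤ (l.flatMap g).length := by
  rw [List.length_flatMap, List.length_flatMap]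
  exact List.sum_le_sum h

theorem length_states_le (Q : CRPQ) :
    Q.states.length ≤ (Q.body.flatMap Atom.encode).length + 1 := by
  rw [CRPQ.states, List.length_cons]
  refine Nat.add_le_add_right (length_flatMap_le_length_flatMap _ _ fun A _ => ?_) 1
  rw [Regex.length_stackList, A.length_encode]
  have := A.re.size_le_length_encode
  omega

/-- If `Q₂` is good for the choices `Y`, then there is a short proof of the goal. -/
theorem exists_short_proof {Q₁ Q₂ : CRPQ} (hW : Q₁ ∈ CRPQ.W) {Y : LTree Unit}
    (h : Good Q₂ Q₁.head (choiceGraph Q₁.body Y)) {V : ℕ}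
    (hV : (encodePair Q₁ Q₂).length + Y.size + 1 ≤ V) :
    ∃ ss : List (Line Lf Rule), IsProof rules ss ∧
      goalTree .nl .tk .goal (encodePair Q₁ Q₂) Y ∈ ss.map (Line.fact rules) ∧
      (ss.flatMap Line.enc).length ≤
        Nat.card Rule * (20 * V ^ 3 * (400 * V ^ 5)) ^ 12 * (1 + 12 * (400 * V ^ 5)) := by
  classical
  obtain ⟨K, G, hK, hG, f₀, hf₀, hf₀'⟩ := exists_refinement_of_good hW Q₁.head_occurs h
  have hlen := length_encodePair Q₁ Q₂
  -- All vertices of `G` are small, and those outside of `G` may be replaced by `0`.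
  have hsrc : ∀ A ∈ Q₁.body, (numCode A.src).size ≤ 2 * V ∧ (numCode A.tgt).size ≤ 2 * V := by
    intro A hA
    have := length_le_length_flatMap Atom.encode hA
    rw [A.length_encode] at this
    rw [size_numCode, size_numCode]
    omega
  have hGe : ∀ g ∈ G, (numCode g.1).size ≤ 2 * V ∧ (numCode g.2.2).size ≤ 2 * V := by
    intro g hg
    obtain ⟨e, he, hr⟩ := exists_of_mem_forall₂ hG hg
    obtain ⟨⟨A, hA, h1, -, h2⟩, -⟩ := mem_choices he
    rw [← hr.src, ← hr.tgt, h1, h2]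
    exact hsrc A hA
  set ρ : Var → Var := fun x => if (numCode x).size ≤ 2 * V then x else 0
  have hρ : ∀ x, (numCode x).size ≤ 2 * V → ρ x = x := fun x hx => if_pos hx
  have hρ' : ∀ x, (numCode (ρ x)).size ≤ 2 * V := by
    intro x
    by_cases hx : (numCode x).size ≤ 2 * V
    · rwa [hρ x hx]
    · rw [show ρ x = 0 from if_neg hx]
      change 1 ≤ _
      omega
  have hρG : ∀ e ∈ G, ρ e.1 = e.1 ∧ ρ e.2.2 = e.2.2 := fun e he =>
    ⟨hρ _ (hGe e he).1, hρ _ (hGe e he).2⟩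
  set f : Var → GNode Var Content := fun y => (f₀ y).mapVar ρ
  have hf : ∀ A ∈ Q₂.body, PReach Content.word G [A.re] (f A.src) [] (f A.tgt) :=
    fun A hA => (hf₀ A hA).mapVar hρG
  have hf' : List.Forall₂ (fun x y => PReach Content.word G [] (f y) [] (.var x))
      Q₁.head Q₂.head := by
    have : ∀ x ∈ Q₁.head, ρ x = x := by
      intro x hx
      obtain ⟨A, hA, rfl | rfl⟩ := Q₁.head_occurs x hx
      exacts [hρ _ (hsrc A hA).1, hρ _ (hsrc A hA).2]
    have aux : ∀ H H' : List Var,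
        List.Forall₂ (fun x y => PReach Content.word G [] (f₀ y) [] (.var x)) H H' →
        (∀ x ∈ H, ρ x = x) →
        List.Forall₂ (fun x y => PReach Content.word G [] (f y) [] (.var x)) H H' := by
      intro H H' h hH
      induction h with
      | nil => exact .nil
      | @cons x y _ _ h _ ih =>
        rw [List.forall_mem_cons] at hH
        have := h.mapVar hρG
        rw [GNode.mapVar, hH.1] at this
        exact .cons this (ih hH.2)
    exact aux _ _ hf₀' this
  set l : List Var := Q₂.body.flatMap fun A => [A.src, A.tgt] with hl
  have hll : l.length ≤ 2 * V := by
    have h1 : l.length = Q₂.body.length * 2 := by simp [hl, List.length_flatMap]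
    have h2 := length_le_length_flatMap' Atom.encode (l := Q₂.body) (by simp [Atom.encode])
    omega
  have hlmem : ∀ A ∈ Q₂.body, A.src ∈ l ∧ A.tgt ∈ l := fun A hA =>
    ⟨List.mem_flatMap.2 ⟨A, hA, by simp⟩, List.mem_flatMap.2 ⟨A, hA, by simp⟩⟩
  have hvalid : ∀ y ∈ l, (f y).Valid G := by
    intro y hy
    obtain ⟨A, hA, hy⟩ := List.mem_flatMap.1 hy
    simp only [List.mem_cons, List.not_mem_nil, or_false] at hy
    rcases hy with rfl | rfl
    exacts [(hf A hA).valid_left, (hf A hA).valid]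
  -- The descriptions of words.
  set RS : List Regex := Q₁.body.flatMap fun A => A.re.subs with hRSdef
  set ys : List (LTree Unit) := .leaf () :: Y.subtrees with hysdef
  have hRS : ∀ r ∈ RS, r.parts ⊆ RS := by
    intro r hr s hs
    obtain ⟨A, hA, hr⟩ := List.mem_flatMap.1 hr
    exact List.mem_flatMap.2 ⟨A, hA, Regex.parts_subset_subs hr hs⟩
  have hRSsize : ∀ r ∈ RS, r.code.size ≤ 3 * V := by
    intro r hr
    obtain ⟨A, hA, hr⟩ := List.mem_flatMap.1 hr
    have h1 := Regex.size_code_le_of_mem_subs hr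
    have h2 := A.re.size_code_le
    have h3 := length_le_length_flatMap Atom.encode hA
    rw [A.length_encode] at h3
    omega
  have hRSlen : RS.length ≤ V := by
    have := length_flatMap_le_length_flatMap (fun A : Atom => A.re.subs) Atom.encode (l := Q₁.body)
      fun A _ => by
        have := A.re.size_le_length_encode
        rw [Regex.length_subs, A.length_encode]
        omega
    change RS.length ≤ _ at this
    omega
  have hyslen : ys.length ≤ V := by
    rw [hysdef, List.length_cons, LTree.length_subtrees]
    omega
  have hyssize : ∀ y ∈ ys, y.size ≤ Y.size := by
    intro y hy
    rcases List.mem_cons.1 hy with rfl | hy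
    · exact Y.size_pos
    · exact LTree.size_le_of_mem_subtrees hy
  set 𝒞 : Set Content := {C | C.Within RS ys Y.size}
  set CL := contentList RS ys Y.size
  have hCLsize : ∀ C ∈ CL, C.code.size ≤ 8 * V := by
    intro C hC
    have := size_code_of_mem_contentList hRSsize hyssize hC
    have := Y.size_pos
    omega
  have hCLlen : CL.length ≤ 3 * V ^ 3 := by
    rw [length_contentList]
    have h1 : Y.size + 1 ≤ V := by omega
    have h2 : 1 ≤ V := by omega
    calc _ ≤ V * V + V * V + V * (V * V) := by gcongr
      _ ≤ _ := by nlinarith [Nat.mul_le_mul (Nat.mul_le_mul h2 (le_refl V)) (le_refl V)]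
  have hc : ∀ e ∈ choices Q₁.body Y, .exp e.2.1.1 e.2.1.2 ∈ 𝒞 := by
    intro e he
    obtain ⟨⟨A, hA, -, h1, -⟩, h2⟩ := mem_choices he
    refine ⟨h1 ▸ hW A hA, List.mem_flatMap.2 ⟨A, hA, h1 ▸ Regex.self_mem_subs _⟩, ?_⟩
    rcases h2 with h2 | h2
    · rw [h2]; exact List.mem_cons_self
    · exact List.mem_cons_of_mem _ h2
  -- The trees in the derivation are subtrees of these trees.
  set Ro : List Tree := [.leaf .nl, str (encodePair Q₁ Q₂), headCode Q₁.head, bodyCode Q₁.body,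
    headCode Q₂.head, bodyCode Q₂.body, Y.fill .nl, graphCode G, mapCode f l] ++
    (Q₂.states.map stCode ++ (CL.map Content.code ++
      CL.map fun C => listCode (C.expand.map Content.code))) with hRo
  set B : List Tree := Ro.flatMap LTree.subtrees
  have hmem : ∀ t ∈ Ro, t ∈ {b | b ∈ B} := fun t ht =>
    List.mem_flatMap.2 ⟨t, ht, t.self_mem_subtrees⟩
  have hB : IsClosed {b | b ∈ B} := isClosed_subtrees (by simp [hRo])
  have h𝒞 : ContentsIn {b | b ∈ B} 𝒞 := by
    refine ⟨fun C hC => ?_, fun C hC => hmem _ ?_, fun C hC => hmem _ ?_, fun C hC => ?_⟩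
    · cases C with
      | exp r y => exact hC.1
      | dbl i s => exact hC.1
      | pw i s y => exact hC.1
    · exact List.mem_append_right _ (List.mem_append_right _ (List.mem_append_left _
        (List.mem_map_of_mem hC.mem)))
    · exact List.mem_append_right _ (List.mem_append_right _ (List.mem_append_right _
        (List.mem_map.2 ⟨C, hC.mem, rfl⟩)))
    · exact hC.expand hRS
  have hder := hB.goal (fun p hp => hmem _ (List.mem_append_right _ (List.mem_append_left _
    (List.mem_map_of_mem hp)))) h𝒞 (hmem _ (by simp [hRo])) (hmem _ (by simp [hRo])) hc hG
    (hmem (mapCode f l) (by simp [hRo])) (hmem _ (by simp [hRo])) (hmem _ (by simp [hRo]))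
    (hmem _ (by simp [hRo])) (hmem _ (by simp [hRo])) (hmem _ (by simp [hRo])) hlmem hf hf'
  -- Bounds for the number and the size of these trees.
  have hV1 : 1 ≤ V := by omega
  have hp1 : V ≤ V ^ 5 := Nat.le_self_pow (by omega) V
  have hp2 : V ^ 2 ≤ V ^ 5 := Nat.pow_le_pow_right hV1 (by omega)
  have hp4 : V ^ 4 ≤ V ^ 5 := Nat.pow_le_pow_right hV1 (by omega)
  have hGsize : (graphCode G).size ≤ 74 * V ^ 4 := by
    have hGl : G.length ≤ V := by
      have h1 := length_le_length_flatMap' Atom.encode (l := Q₁.body) (by simp [Atom.encode])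
      have h2 : ∀ (b : List Atom) (Y : LTree Unit), (choices b Y).length = b.length := by
        intro b Y
        fun_induction choices b Y <;> simp_all
      have h3 := hG.length_eq
      rw [h2] at h3
      omega
    have h1 := size_graphCode_le (G := G) (a := 2 * V) (m := 5 * V ^ 2) (c := 8 * V)
      fun g hg => by
        obtain ⟨e, he, hr⟩ := exists_of_mem_forall₂ hG hg
        refine ⟨(hGe g hg).1, (hGe g hg).2, hr.length_le.trans ?_, fun C hC =>
          hCLsize C (hr.flats.mem h𝒞 (by simpa using hc e he) C hC).mem⟩
        obtain ⟨⟨A, hA, -, h1, -⟩, h2⟩ := mem_choices he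
        have h3 : K.length ≤ 2 * V := by
          have := length_le_length_flatMap' Atom.encode (l := Q₂.body) (by simp [Atom.encode])
          omega
        have h4 : e.2.1.1.size + 2 * e.2.1.2.size ≤ 2 * V := by
          have h5 := length_le_length_flatMap Atom.encode hA
          have h6 := A.re.size_le_length_encode
          have h7 : e.2.1.2.size ≤ Y.size := hyssize _ (List.mem_cons.2 h2)
          rw [A.length_encode] at h5
          rw [h1]
          omega
        calc _ ≤ 1 + 2 * V * (2 * V) := Nat.add_le_add_left (Nat.mul_le_mul h3 h4) 1
          _ ≤ _ := by nlinarith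
    refine h1.trans ?_
    have h2 : V ≤ V ^ 3 := Nat.le_self_pow (by omega) V
    have h3 : V ^ 2 ≤ V ^ 3 := Nat.pow_le_pow_right hV1 (by omega)
    have h4 : 2 * (2 * V) + 5 * V ^ 2 * (8 * V + 1) + 4 ≤ 73 * V ^ 3 := by
      have : 5 * V ^ 2 * (8 * V + 1) = 40 * V ^ 3 + 5 * V ^ 2 := by ring
      omega
    have h5 : 1 ≤ V ^ 4 := Nat.one_le_pow _ _ hV1
    calc _ ≤ 1 + V * (73 * V ^ 3) := Nat.add_le_add_left (Nat.mul_le_mul hGl h4) 1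
      _ = 1 + 73 * V ^ 4 := by ring
      _ ≤ _ := by omega
  have hRosize : ∀ t ∈ Ro, t.size ≤ 400 * V ^ 5 := by
    intro t ht
    have hmap : (mapCode f l).size ≤ 400 * V ^ 5 := by
      have h1 : (mapCode f l).size ≤ 1 + l.length * (155 * V ^ 4 + 1) := by
        have h2 := size_listCode_le (l := l.map fun y => .node (numCode y) (nodeCode (f y)))
          (m := 155 * V ^ 4) fun t ht => by
            obtain ⟨y, hy, rfl⟩ := List.mem_map.1 ht
            have h3 := size_nodeCode_le (a := 2 * V) (hvalid y hy) fun x hx => by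
              have : (f₀ y).mapVar ρ = .var x := hx
              cases h0 : f₀ y with
              | var z =>
                rw [h0, GNode.mapVar] at this
                cases this
                exact hρ' z
              | _ => rw [h0] at this; cases this
            have h4 : (numCode y).size ≤ 2 * V := by
              obtain ⟨A, hA, hy⟩ := List.mem_flatMap.1 hy
              have := length_le_length_flatMap Atom.encode hA
              rw [A.length_encode] at this
              simp only [List.mem_cons, List.not_mem_nil, or_false] at hy
              rw [size_numCode]
              rcases hy with rfl | rfl <;> omega
            have h5 : V ≤ V ^ 4 := Nat.le_self_pow (by omega) V
            have h6 : 1 ≤ V ^ 4 := Nat.one_le_pow _ _ hV1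
            rw [LTree.size]
            omega
        rwa [List.length_map] at h2
      have h5 : 1 ≤ V ^ 4 := Nat.one_le_pow _ _ hV1
      calc _ ≤ 1 + 2 * V * (156 * V ^ 4) := h1.trans
              (Nat.add_le_add_left (Nat.mul_le_mul hll (by omega)) 1)
        _ = 1 + 312 * V ^ 5 := by ring
        _ ≤ _ := by omega
    have h1 := size_headCode_le Q₁.head
    have h2 := size_headCode_le Q₂.head
    have h3 := size_bodyCode_le Q₁.body
    have h4 := size_bodyCode_le Q₂.body
    simp only [hRo, List.mem_append, List.mem_cons, List.not_mem_nil, or_false, List.mem_map] at ht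
    rcases ht with (rfl | rfl | rfl | rfl | rfl | rfl | rfl | rfl | rfl) | ⟨p, hp, rfl⟩ |
      ⟨C, hC, rfl⟩ | ⟨C, hC, rfl⟩
    · rw [LTree.size]; omega
    · rw [size_inputTree]; omega
    · omega
    · omega
    · omega
    · omega
    · rw [LTree.size_fill]; omega
    · omega
    · exact hmap
    · rcases List.mem_cons.1 hp with rfl | hp
      · change 1 ≤ _
        omega
      · obtain ⟨A, hA, hp⟩ := List.mem_flatMap.1 hp
        have h5 := A.re.size_stCode_le [] hp
        have h6 := length_le_length_flatMap Atom.encode hA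
        have h7 := A.re.size_le_length_encode
        have h8 := A.re.size_code_le
        rw [A.length_encode] at h6
        have h9 : A.re.size * (A.re.code.size + 1) ≤ V * (3 * V) :=
          Nat.mul_le_mul (by omega) (by omega)
        have h10 : V * (3 * V) = 3 * V ^ 2 := by ring
        have h11 : (stCode []).size = 1 := rfl
        omega
    · have := hCLsize C hC
      omega
    · have h5 := size_listCode_le (l := C.expand.map Content.code) (m := 8 * V) (by
        intro t ht
        obtain ⟨D, hD, rfl⟩ := List.mem_map.1 ht
        exact (C.size_code_expand D hD).trans (hCLsize C hC))
      have h6 := Nat.mul_le_mul_right (8 * V + 1) C.expand_length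
      rw [List.length_map] at h5
      omega
  have hRolen : Ro.length ≤ 20 * V ^ 3 := by
    have h1 := length_states_le Q₂
    have h2 : V ≤ V ^ 3 := Nat.le_self_pow (by omega) V
    simp only [hRo, List.length_append, List.length_cons, List.length_nil, List.length_map]
    omega
  have hBlen : B.length ≤ 20 * V ^ 3 * (400 * V ^ 5) :=
    (length_flatMap_subtrees_le hRosize).trans (Nat.mul_le_mul_right _ hRolen)
  have hBsize : ∀ b ∈ B, b.size ≤ 400 * V ^ 5 := by
    intro b hb
    obtain ⟨t, ht, hb⟩ := List.mem_flatMap.1 hb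
    exact (LTree.size_le_of_mem_subtrees hb).trans (hRosize t ht)
  obtain ⟨ss, h1, h2, h3⟩ := hder.exists_short B _ hBsize
  refine ⟨ss, h1, h2, h3.trans ?_⟩
  gcongr

/-! ### The containment problem -/

/-- The choices for which containment has to be tested are small. -/
theorem sum_choices_le (Q₁ Q₂ : CRPQ) : 1 + (Q₁.body.map fun A =>
    (4 * (2 * Q₂.body.length + Q₂.states.length ^ 2 + 2) + 5) * A.re.size + 1).sum ≤
      ((encodePair Q₁ Q₂).length + 2) ^ 6 := by
  have hlen := length_encodePair Q₁ Q₂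
  have h1 := length_states_le Q₂
  have h2 := length_le_length_flatMap' Atom.encode (l := Q₂.body) (by simp [Atom.encode])
  set u := (encodePair Q₁ Q₂).length + 2 with hu
  have h3 : Q₂.states.length ≤ u := by omega
  have h4 : 4 * (2 * Q₂.body.length + Q₂.states.length ^ 2 + 2) + 5 ≤ 20 * u ^ 2 := by
    have := Nat.pow_le_pow_left h3 2
    nlinarith
  set c := 4 * (2 * Q₂.body.length + Q₂.states.length ^ 2 + 2) + 5
  have h5 : ∀ b : List Atom,
      (b.map fun A => c * A.re.size + 1).sum ≤ (c + 1) * (b.flatMap Atom.encode).length := by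
    intro b
    induction b with
    | nil => simp
    | cons A b ih =>
      have h6 := A.re.size_le_length_encode
      have h7 : c * A.re.size + 1 ≤ (c + 1) * A.encode.length := by
        rw [A.length_encode]
        nlinarith
      rw [List.map_cons, List.sum_cons, List.flatMap_cons, List.length_append, mul_add]
      omega
  have h6 : (c + 1) * (Q₁.body.flatMap Atom.encode).length ≤ (20 * u ^ 2 + 1) * (u - 2) :=
    Nat.mul_le_mul (by omega) (by omega)
  have h7 := h5 Q₁.body
  obtain ⟨v, hv⟩ : ∃ v, u = v + 3 := ⟨(encodePair Q₁ Q₂).length - 1, by omega⟩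
  rw [hv] at h6 ⊢
  have h8 : (20 * (v + 3) ^ 2 + 1) * (v + 3 - 2) + 1 ≤ (v + 3) ^ 6 := by
    rw [show v + 3 - 2 = v + 1 by omega]
    have : 27 ≤ (v + 3) ^ 3 := Nat.pow_le_pow_left (show 3 ≤ v + 3 by omega) 3
    calc _ ≤ 27 * (v + 3) ^ 3 := by ring_nf; nlinarith [sq_nonneg v]
      _ ≤ (v + 3) ^ 3 * (v + 3) ^ 3 := Nat.mul_le_mul_right _ this
      _ = _ := by ring
  omega

end CRPQContainment

open CRPQContainment in
theorem mainTheorem2 :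
    CRPQContainment.InPi2P
      (CRPQContainment.queryContainment CRPQContainment.CRPQ.W Set.univ) := by
  let v : Polynomial ℕ := 2 * (Polynomial.X + 2) ^ 6 + Polynomial.X + 2
  refine inPi2P_of_horn .nl .tk rules 6 .goal (Polynomial.C (Nat.card Rule) *
    (20 * v ^ 3 * (400 * v ^ 5)) ^ 12 * (1 + 12 * (400 * v ^ 5))) _ ?_ ?_
  · intro x h
    have hx := fun t ht => (h t ht).meaning
    obtain ⟨Q₁, Q₂, h1, hW, -⟩ := hx (.leaf ()) (Nat.one_le_pow _ _ (by omega))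
    obtain rfl := str_injective h1
    refine ⟨Q₁, hW, Q₂, trivial, rfl, containedIn_of_good hW fun Y hY => ?_⟩
    obtain ⟨Q₁', Q₂', h1, -, h2⟩ := hx Y (hY.trans (sum_choices_le Q₁ Q₂))
    obtain ⟨rfl, rfl⟩ := encodePair_inj (str_injective h1)
    rwa [decChoice_fill] at h2
  · rintro _ ⟨Q₁, hW, Q₂, -, rfl, h⟩ Y hY
    obtain ⟨ss, h1, h2, h3⟩ := exists_short_proof hW (good_choiceGraph hW h Y)
      (V := v.eval (encodePair Q₁ Q₂).length) (by simp [v]; omega)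
    refine ⟨ss, h1, h2, h3.trans (le_of_eq ?_)⟩
    simp
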